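/- Let $\Gamma=\mathbb Z\mathbf r_1+\mathbb Z\mathbf r_2\subset\mathbb R^2$ with $\mathbf r_1=(\tfrac{\sqrt3}2,\tfrac12)$, $\mathbf r_2=(\tfrac{\sqrt3}2,-\tfrac12)$, let $\mathbf K=(0,\tfrac{4\pi}3)$, and let $R$ be the rotation of the plane by $2\pi/3$. A real function is called honeycomb symmetric if it is $\Gamma$-periodic, even and $R$-invariant. For integers $s\ge 0$ let $H^s(\mathbb R^2/\Gamma)$ be the space of $\Gamma$-periodic complex functions all of whose weak derivatives of order at most $s$ lie in $L^2(\mathbb R^2/\Gamma)$, with its usual norm; $\langle f,g\rangle=\int_{\mathbb R^2/\Gamma}\overline f g$. Let $V(\mathbf x,\rho)$ be a real $C^\infty$ function of $\mathbf x\in\mathbb R^2$ and $\rho\ge 0$, $\Gamma$-periodic in $\mathbf x$, such that $V_L=V(\cdot,0)$ is honeycomb symmetric and $V(\mathbf x,\rho)=V_L(\mathbf x)+K(\mathbf x)\rho+O(\rho^2)$ as $\rho\to0$, uniformly in $\mathbf x$, with $K$ honeycomb symmetric. Then there are constants $C_s$ $(s\in\mathbb N)$, depending only on $V$ and $s$,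 such that for every $M$ there is $\epsilon_0>0$ for which the following holds. Suppose that the first eigenvalue $E_0$ of $-(\nabla+i\mathbf K)^2+V_L$ on $L^2(\mathbb R^2/\Gamma)$ has a two-dimensional eigenspace, spanned by $L^2$-normalised functions $\phi_0^a,\phi_0^b\in H^2(\mathbb R^2/\Gamma)$ with $\widetilde R\phi_0^a=\omega\phi_0^a$, $\widetilde R\phi_0^b=\overline\omega\phi_0^b$ and $\phi_0^a(\mathbf x)=\overline{\phi_0^b(-\mathbf x)}$, where $\omega=e^{2\pi i/3}$ and $(\widetilde Rf)(\mathbf x)=e^{-i\mathbf K\cdot\mathbf x}e^{i\mathbf K\cdot R\mathbf x}f(R\mathbf x)$, and that $$\int_{\mathbb R^2/\Gamma} K\left(|\phi_0^a|^4-2|\phi_0^a|^2|\phi_0^b|^2\right)=\int_{\mathbb R^2/\Gamma} K\left(|\phi_0^b|^4-2|\phi_0^a|^2|\phi_0^b|^2\right)\ne0 .$$ Let $M_\perp$ be the $L^2$-orthogonal projection onto $\{\phi_0^a,\phi_0^b\}^\perp$. Let $0<\epsilon<\epsilon_0$ and, for $i=1,2$, let $a^{(i)},b^{(i)},E^{(i)}\in\mathbb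 C$ and $\phi^{(i)}\in H^2(\mathbb R^2/\Gamma)$ satisfy $$-(\nabla+i\mathbf K)^2\phi^{(i)}+V(\mathbf x,|\phi^{(i)}|^2)\phi^{(i)}=E^{(i)}\phi^{(i)},\qquad |a^{(i)}|^2+|b^{(i)}|^2=1,$$ $$\langle\phi_0^a,\phi^{(i)}\rangle=\epsilon a^{(i)},\quad \langle\phi_0^b,\phi^{(i)}\rangle=\epsilon b^{(i)},\quad |E^{(i)}-E_0|\le\epsilon,\quad \|\phi^{(i)}\|_{L^2}\le M\epsilon,\quad \|\phi^{(i)}\|_{H^2}\le M .$$ Then for every integer $s\ge2$ the function $M_\perp(\phi^{(1)}-\phi^{(2)})$ lies in $H^s(\mathbb R^2/\Gamma)$ and $$\|M_\perp(\phi^{(1)}-\phi^{(2)})\|_{H^s(\mathbb R^2/\Gamma)}\le C_s\left(|a^{(1)}-a^{(2)}|+|b^{(1)}-b^{(2)}|\right)\epsilon^3 .$$ -/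

import Mathlib

open MeasureTheory Set
open scoped ContDiff

noncomputable section

namespace HoneycombNLS

/-- The Euclidean plane. -/
abbrev Plane : Type := EuclideanSpace ℝ (Fin 2)

/-! Geometry of the honeycomb lattice. -/

/-- First primitive vector of the lattice `Γ`. -/
def latVec1 : Plane := !₂[Real.sqrt 3 / 2, 1 / 2]

/-- Second primitive vector of the lattice `Γ`. -/
def latVec2 : Plane := !₂[Real.sqrt 3 / 2, -(1 / 2)]

/-- The half-open fundamental cell of `Γ`. Functions on the torus `ℝ² / Γ` are represented by
`Γ`-periodic functions on the plane, and integrals over the torus are integrals over this cell. -/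
def cell : Set Plane :=
  {x | ∃ s ∈ Ico (0 : ℝ) 1, ∃ t ∈ Ico (0 : ℝ) 1, x = s • latVec1 + t • latVec2}

/-- `Γ`-periodicity. -/
def LatPeriodic {β : Type*} (f : Plane → β) : Prop :=
  (∀ x, f (x + latVec1) = f x) ∧ (∀ x, f (x + latVec2) = f x)

/-- The rotation `R` of the plane by the angle `2π/3`. -/
def rot (x : Plane) : Plane :=
  !₂[-(1 / 2) * x 0 - Real.sqrt 3 / 2 * x 1, Real.sqrt 3 / 2 * x 0 - 1 / 2 * x 1]

/-- Honeycomb symmetry of a real function: periodic, even, and invariant under `R`. -/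
def IsHoneycomb (f : Plane → ℝ) : Prop :=
  LatPeriodic f ∧ (∀ x, f (-x) = f x) ∧ (∀ x, f (rot x) = f x)

/-- The Dirac point `K`. -/
def diracPt : Plane := !₂[0, 4 * Real.pi / 3]

/-- The transformed rotation `(R̃ f)(x) = exp(-i K·x) exp(i K·Rx) f(Rx)`. -/
def twistedRot (f : Plane → ℂ) (x : Plane) : ℂ :=
  Complex.exp (-(Complex.I * (inner ℝ diracPt x : ℝ))) *
    (Complex.exp (Complex.I * (inner ℝ diracPt (rot x) : ℝ)) * f (rot x))

/-- The cube root of unity `ω = exp(2πi/3)`. -/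
def omega : ℂ := Complex.exp (2 * Real.pi * Complex.I / 3)

/-! Lebesgue and Sobolev spaces on the torus. -/

/-- `L²(ℝ² / Γ)`. -/
def MemL2 (f : Plane → ℂ) : Prop :=
  LatPeriodic f ∧ MemLp f 2 (volume.restrict cell)

/-- The inner product `⟨f, g⟩` of `L²(ℝ² / Γ)`, conjugate-linear in the first argument. -/
def l2Inner (f g : Plane → ℂ) : ℂ := ∫ x in cell, (starRingEnd ℂ) (f x) * g x

/-- The norm of `L²(ℝ² / Γ)`. -/
def l2Norm (f : Plane → ℂ) : ℝ := Real.sqrt (∫ x in cell, ‖f x‖ ^ 2)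

/-- Classical partial derivative of a real function in the `i`-th coordinate direction. -/
def partialDeriv (i : Fin 2) (η : Plane → ℝ) (x : Plane) : ℝ :=
  fderiv ℝ η x (EuclideanSpace.single i 1)

/-- `g` is the weak derivative `∂₀ᵐ ∂₁ⁿ f`. -/
def IsWeakDeriv (m n : ℕ) (f g : Plane → ℂ) : Prop :=
  ∀ η : Plane → ℝ, ContDiff ℝ ∞ η → HasCompactSupport η →
    ∫ x, ((partialDeriv 0)^[m] ((partialDeriv 1)^[n] η) x) • f x
      = (-1 : ℝ) ^ (m + n) • ∫ x, η x • g x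

/-- The Sobolev space `H^s(ℝ² / Γ)`: all weak derivatives up to order `s` exist in
`L²(ℝ² / Γ)`. -/
def MemSobolev (s : ℕ) (f : Plane → ℂ) : Prop :=
  MemL2 f ∧ ∀ m n : ℕ, m + n ≤ s → ∃ g, MemL2 g ∧ IsWeakDeriv m n f g

open Classical in
/-- The weak derivative `∂₀ᵐ ∂₁ⁿ f` as a function in `L²(ℝ² / Γ)` (unique up to null sets), and
`0` if there is none. -/
def weakDeriv (m n : ℕ) (f : Plane → ℂ) : Plane → ℂ :=
  if h : ∃ g, MemL2 g ∧ IsWeakDeriv m n f g then h.choose else 0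

/-- The norm of `H^s(ℝ² / Γ)`. -/
def sobolevNorm (s : ℕ) (f : Plane → ℂ) : ℝ :=
  Real.sqrt (∑ k ∈ Finset.range (s + 1), ∑ p ∈ Finset.HasAntidiagonal.antidiagonal k,
    ∫ x in cell, ‖weakDeriv p.1 p.2 f x‖ ^ 2)

/-! The Schrödinger operators at the Dirac point. -/

/-- `(∇ + iK)² f = Δ f + 2i K·∇ f - |K|² f`. -/
def blochLaplacian (f : Plane → ℂ) (x : Plane) : ℂ :=
  weakDeriv 2 0 f x + weakDeriv 0 2 f x
    + 2 * Complex.I * ((diracPt 0 : ℂ) * weakDeriv 1 0 f x + (diracPt 1 : ℂ) * weakDeriv 0 1 f x)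
    - ((‖diracPt‖ ^ 2 : ℝ) : ℂ) * f x

/-- `φ ∈ H²(ℝ² / Γ)` solves `-(∇ + iK)² φ + W φ = E φ` (the zero function is allowed). -/
def SolvesBloch (W : Plane → ℝ) (E : ℂ) (φ : Plane → ℂ) : Prop :=
  MemSobolev 2 φ ∧ ∀ᵐ x, -blochLaplacian φ x + (W x : ℂ) * φ x = E * φ x

/-- `E₀` is the first eigenvalue of `-(∇ + iK)² + W`, its eigenspace is two-dimensional, and
`φa`, `φb` are the normalised basis functions of it in the rotation classes `ω` and `conj ω`,
exchanged by conjugation and inversion. -/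
structure IsGroundPair (W : Plane → ℝ) (E₀ : ℝ) (φa φb : Plane → ℂ) : Prop where
  solves_a : SolvesBloch W E₀ φa
  solves_b : SolvesBloch W E₀ φb
  norm_a : l2Norm φa = 1
  norm_b : l2Norm φb = 1
  rot_a : ∀ᵐ x, twistedRot φa x = omega * φa x
  rot_b : ∀ᵐ x, twistedRot φb x = (starRingEnd ℂ) omega * φb x
  conj_inv : ∀ᵐ x, φa x = (starRingEnd ℂ) (φb (-x))
  spans : ∀ φ, SolvesBloch W E₀ φ → ∃ α β : ℂ, ∀ᵐ x, φ x = α * φa x + β * φb x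
  first : ∀ (E : ℝ) (φ : Plane → ℂ), SolvesBloch W E φ → ¬ (∀ᵐ x, φ x = 0) → E₀ ≤ E

/-- The condition `∫ K (|φa|⁴ - 2|φa|²|φb|²) = ∫ K (|φb|⁴ - 2|φa|²|φb|²) ≠ 0`. -/
def Nonresonant (K : Plane → ℝ) (φa φb : Plane → ℂ) : Prop :=
  (∫ x in cell, K x * (‖φa x‖ ^ 4 - 2 * ‖φb x‖ ^ 2 * ‖φa x‖ ^ 2))
      = (∫ x in cell, K x * (‖φb x‖ ^ 4 - 2 * ‖φb x‖ ^ 2 * ‖φa x‖ ^ 2)) ∧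
    (∫ x in cell, K x * (‖φb x‖ ^ 4 - 2 * ‖φb x‖ ^ 2 * ‖φa x‖ ^ 2)) ≠ 0

/-- The projection `M_⊥` onto the orthogonal complement of the span of `φa`, `φb`. -/
def projPerp (φa φb f : Plane → ℂ) (x : Plane) : ℂ :=
  f x - l2Inner φa f * φa x - l2Inner φb f * φb x

/-- `(a, b, E, φ)` is a small solution at amplitude `ε` of the nonlinear eigenvalue problem
`-(∇ + iK)² φ + V(x, |φ|²) φ = E φ`, with `M_∥ φ = ε (a φa + b φb)`, `|a|² + |b|² = 1` and
`|E - E₀| ≤ ε`; its `L²` norm is at most `M ε` and its `H²` norm at most `M`. -/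
structure IsSolutionTuple (V : Plane → ℝ → ℝ) (E₀ : ℝ) (φa φb : Plane → ℂ) (M ε : ℝ)
    (a b E : ℂ) (φ : Plane → ℂ) : Prop where
  normalised : ‖a‖ ^ 2 + ‖b‖ ^ 2 = 1
  solves : SolvesBloch (fun x => V x (‖φ x‖ ^ 2)) E φ
  coeff_a : l2Inner φa φ = ε * a
  coeff_b : l2Inner φb φ = ε * b
  energy : ‖E - E₀‖ ≤ ε
  l2_small : l2Norm φ ≤ M * ε
  h2_bound : sobolevNorm 2 φ ≤ M

end HoneycombNLS

end

open scoped Pointwise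

noncomputable section

namespace HoneycombNLS

/-! ### The lattice and its fundamental cell -/

/-! Write `L = -(∇ + iK)² + V(·, 0)` and `N(φ) = (V(x,|φ|²) - V(x,0)) φ`, which is cubic at the
origin. A solution satisfies `(L - E₀) φ = (E - E₀) φ - N(φ)`. The proof is a Lyapunov-Schmidt
reduction: the components along the ground space are prescribed, and the perpendicular part is
controlled by the spectral gap `‖ψ‖ ≤ C ‖(L - E₀) ψ‖` for `ψ` orthogonal to the eigenspace
(`exists_gap`, a compactness argument).

A priori size (`exists_sobBound_solution`): interpolating the `H²` bound `M` against the `L²` bound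
`M ε` makes `φ` uniformly small. Then the right-hand side is a small multiple of `φ`, the gap gives
`‖φ_⊥‖ ≤ ‖φ‖ / 2`, and hence `‖φ‖ ≤ 4 ε`. The number `M` therefore only affects the threshold for
`ε`. Elliptic bootstrap turns this into `‖φ‖ ≤ A_k ε` in every Sobolev space.

Energies: pairing the equation with a ground state annihilates the left side
(`BlochEq.l2Inner_rhs`), so `(E - E₀) ε a = ⟨φa, N(φ)⟩ = O(ε³)`, and likewise for `b`. As `|a| + |b|
≥ 1`, this gives `E - E₀ = O(ε²)`.

Differences: `d = φ₁ - φ₂` solves `(L - E₀) d = (E₁ - E₂) φ₁ + (E₂ - E₀) d - (N(φ₁) - N(φ₂))`. Let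
`δ = |a₁ - a₂| + |b₁ - b₂|`. Pairing with the ground states again bounds `|E₁ - E₂| ε` by `C ε² (ε δ
+ ‖d_⊥‖)`, so the whole right-hand side has this size (`exists_sobBound_diffRhs`). The gap yields
`‖d_⊥‖ ≤ C ε² (ε δ + ‖d_⊥‖)` in `H²`; for small `ε` the last term is absorbed and `ε³ δ` remains
(`exists_sobBound_two_perp`). Regularity carries this to all orders (`exists_sobBound_perp`).

The nonlinear input is `N(φ₁) - N(φ₂) = ε² S(x, φ₁/ε, φ₂/ε, ε) (φ₁ - φ₂)` with a smooth `S`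
(`nonlin_sub`), together with a composition estimate from `H^{k+2}` to `H^{k+1}`
(`exists_sobBound_comp`). Losing one derivative is harmless because `L` gains two. Sobolev spaces
are handled through Fourier coefficients: `SobBound` bounds finite weighted sums, a condition stable
under coefficientwise limits.

All constants are chosen before the ground pair. This is possible because the first eigenvalue is
determined by the potential (`IsGroundPair.energy_unique`) and the gap and regularity bounds hold
for every choice of eigenfunctions. -/

lemma plane_ext {x y : Plane} (h0 : x 0 = y 0) (h1 : x 1 = y 1) : x = y := by
  ext i; fin_cases i <;> assumption

/-- The linear coordinates `(s, t)` of `s • latVec1 + t • latVec2`. -/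
def latCoordEquiv : Plane ≃ₗ[ℝ] (Fin 2 → ℝ) where
  toFun x := ![x 0 / Real.sqrt 3 + x 1, x 0 / Real.sqrt 3 - x 1]
  map_add' x y := by ext i; fin_cases i <;> simp <;> ring
  map_smul' c x := by ext i; fin_cases i <;> simp <;> ring
  invFun v := v 0 • latVec1 + v 1 • latVec2
  left_inv x := by
    have h3 : Real.sqrt 3 ≠ 0 := by positivity
    apply plane_ext
    · simp [latVec1, latVec2]; field_simp; ring
    · simp [latVec1, latVec2]; ring
  right_inv v := by
    have h3 : Real.sqrt 3 ≠ 0 := by positivity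
    ext i; fin_cases i
    · simp [latVec1, latVec2]; field_simp; ring
    · simp [latVec1, latVec2]; field_simp; ring

/-- The basis `(latVec1, latVec2)` of the plane. -/
def latBasis : Module.Basis (Fin 2) ℝ Plane := Module.Basis.ofEquivFun latCoordEquiv

lemma latBasis_zero : latBasis 0 = latVec1 := by
  simp [latBasis, latCoordEquiv]

lemma latBasis_one : latBasis 1 = latVec2 := by
  simp [latBasis, latCoordEquiv]

/-- The lattice `Γ`. -/
abbrev lat : Submodule ℤ Plane := Submodule.span ℤ (Set.range latBasis)

lemma mem_lat_iff {x : Plane} : x ∈ lat ↔ ∃ m n : ℤ, x = (m : ℝ) • latVec1 + (n : ℝ) • latVec2 := by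
  have : Set.range latBasis = {latVec1, latVec2} := by
    ext y; simp [latBasis_zero, latBasis_one, eq_comm]
  rw [lat, this, Submodule.mem_span_pair]
  simp only [eq_comm, Int.cast_smul_eq_zsmul]

/-- Makes the theory of `ZSpan` available: measurability, boundedness, positive volume and the
tiling of the plane by lattice translates. -/
lemma cell_eq : cell = ZSpan.fundamentalDomain latBasis := by
  ext x
  simp only [cell, ZSpan.fundamentalDomain, Set.mem_ofPred_eq]
  constructor
  · rintro ⟨s, hs, t, ht, rfl⟩
    have h : ∀ i, latBasis.repr (s • latVec1 + t • latVec2) i = ![s, t] i := by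
      intro i
      rw [← latBasis_zero, ← latBasis_one]
      fin_cases i <;> simp
    intro i
    rw [h]
    fin_cases i
    · exact hs
    · exact ht
  · intro h
    refine ⟨latBasis.repr x 0, h 0, latBasis.repr x 1, h 1, ?_⟩
    have := latBasis.sum_repr x
    rw [Fin.sum_univ_two, latBasis_zero, latBasis_one] at this
    exact this.symm

lemma isAddFundamentalDomain_cell : IsAddFundamentalDomain lat cell (volume : Measure Plane) := by
  rw [cell_eq]; exact ZSpan.isAddFundamentalDomain latBasis volume

lemma measurableSet_cell : MeasurableSet cell := by
  rw [cell_eq]; exact ZSpan.fundamentalDomain_measurableSet latBasis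

lemma isBounded_cell : Bornology.IsBounded cell := by
  rw [cell_eq]; exact ZSpan.fundamentalDomain_isBounded latBasis

instance : VAddInvariantMeasure lat Plane volume :=
  inferInstanceAs <| VAddInvariantMeasure lat.toAddSubgroup Plane volume

instance : IsFiniteMeasure (volume.restrict cell : Measure Plane) :=
  ⟨by rw [Measure.restrict_apply_univ]; exact isBounded_cell.measure_lt_top⟩

/-- The area of the cell. -/
def cellVol : ℝ := (volume : Measure Plane).real cell

lemma cellVol_pos : 0 < cellVol := by
  refine ENNReal.toReal_pos ?_ isBounded_cell.measure_lt_top.ne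
  rw [cell_eq]; exact ZSpan.measure_fundamentalDomain_ne_zero latBasis

lemma LatPeriodic.add_smul {β : Type*} {f : Plane → β} (hf : LatPeriodic f) (m n : ℤ) (x : Plane) :
    f (x + ((m : ℝ) • latVec1 + (n : ℝ) • latVec2)) = f x := by
  have key : ∀ (v : Plane), (∀ x, f (x + v) = f x) → ∀ (m : ℤ) x, f (x + (m : ℝ) • v) = f x := by
    intro v hv m
    induction m with
    | zero => simp
    | succ k ih =>
      intro x
      have := hv (x + (k : ℝ) • v)
      rw [← Int.cast_natCast (R := ℝ) k] at this
      rw [ih] at this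
      rw [← this]; congr 1; push_cast; module
    | pred k ih =>
      intro x
      have := hv (x + ((-(k : ℤ) - 1 : ℤ) : ℝ) • v)
      rw [← this, ← ih x]; congr 1; push_cast; module
  rw [← add_assoc, key _ hf.2, key _ hf.1]

lemma LatPeriodic.vadd {β : Type*} {f : Plane → β} (hf : LatPeriodic f) (g : lat) (x : Plane) :
    f (g +ᵥ x) = f x := by
  obtain ⟨m, n, h⟩ := mem_lat_iff.1 g.2
  rw [Submodule.vadd_def, vadd_eq_add, h, add_comm, hf.add_smul]

lemma LatPeriodic.comp {β γ : Type*} {f : Plane → β} (hf : LatPeriodic f) (g : β → γ) :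
    LatPeriodic (fun x => g (f x)) :=
  ⟨fun x => by simp only [hf.1], fun x => by simp only [hf.2]⟩

lemma LatPeriodic.comp₂ {β γ δ : Type*} {f : Plane → β} {g : Plane → γ} (hf : LatPeriodic f)
    (hg : LatPeriodic g) (h : β → γ → δ) : LatPeriodic (fun x => h (f x) (g x)) :=
  ⟨fun x => by simp only [hf.1, hg.1], fun x => by simp only [hf.2, hg.2]⟩

/-- Every point is congruent to a point of the cell modulo the lattice. -/
lemma exists_vadd_mem_cell (x : Plane) : ∃ g : lat, g +ᵥ x ∈ cell := by
  rw [cell_eq]; exact (ZSpan.exist_unique_vadd_mem_fundamentalDomain latBasis x).exists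

/-- A translate of the cell is a fundamental domain. -/
lemma setIntegral_translate {E : Type*} [NormedAddCommGroup E] [NormedSpace ℝ E] {f : Plane → E}
    (hf : LatPeriodic f) (y : Plane) : ∫ x in cell, f (x + y) = ∫ x in cell, f x := by
  have h2 : IsAddFundamentalDomain lat ((fun x => x - y) ⁻¹' cell) (volume : Measure Plane) := by
    refine isAddFundamentalDomain_cell.preimage_of_equiv (f := fun x => x - y)
      (measurePreserving_sub_right volume y).quasiMeasurePreserving (e := id) Function.bijective_id ?_
    intro g x
    simp [Submodule.vadd_def, add_sub_assoc]
  rw [isAddFundamentalDomain_cell.setIntegral_eq h2 (fun g x => hf.vadd g x)]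
  have h3 := (measurePreserving_add_right (volume : Measure Plane) y).setIntegral_preimage_emb
    (measurableEmbedding_addRight y) f ((fun x => x - y) ⁻¹' cell)
  rw [← h3]
  congr 2
  ext x; simp

lemma rot_add (x y : Plane) : rot (x + y) = rot x + rot y := by
  apply plane_ext <;> simp [rot] <;> ring

/-- The rotation as a linear isometry. -/
def rotIsometry : Plane ≃ₗᵢ[ℝ] Plane :=
  LinearIsometry.toLinearIsometryEquiv
    { toFun := rot
      map_add' := rot_add
      map_smul' := fun c x => by apply plane_ext <;> simp [rot] <;> ring
      norm_map' := fun x => by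
        have h3 : Real.sqrt 3 ^ 2 = 3 := Real.sq_sqrt (by norm_num)
        rw [← sq_eq_sq₀ (norm_nonneg _) (norm_nonneg _), EuclideanSpace.norm_sq_eq,
          EuclideanSpace.norm_sq_eq]
        simp [rot, Fin.sum_univ_two]
        ring_nf
        rw [h3]; ring } rfl

lemma rotIsometry_apply (x : Plane) : rotIsometry x = rot x := rfl

lemma rot_latVec1 : rot latVec1 = -latVec2 := by
  have h3 : Real.sqrt 3 ^ 2 = 3 := Real.sq_sqrt (by norm_num)
  apply plane_ext <;> simp [rot, latVec1, latVec2] <;> ring_nf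
  rw [h3]; ring

lemma rot_latVec2 : rot latVec2 = latVec1 - latVec2 := by
  have h3 : Real.sqrt 3 ^ 2 = 3 := Real.sq_sqrt (by norm_num)
  apply plane_ext <;> simp [rot, latVec1, latVec2] <;> ring_nf
  rw [h3]; ring

/-- The rotation as an automorphism of the lattice. -/
lemma rot_mem_lat_iff {x : Plane} : rot x ∈ lat ↔ x ∈ lat := by
  have key : ∀ {x : Plane}, x ∈ lat → rot x ∈ lat := by
    intro x hx
    obtain ⟨m, n, rfl⟩ := mem_lat_iff.1 hx
    refine mem_lat_iff.2 ⟨n, -m - n, ?_⟩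
    rw [rot_add, ← rotIsometry_apply, ← rotIsometry_apply, map_smul, map_smul, rotIsometry_apply,
      rotIsometry_apply, rot_latVec1, rot_latVec2]
    push_cast; module
  -- Since `rot` has order three, the converse inclusion is the direct one applied twice.
  have h3 : ∀ x : Plane, rot (rot (rot x)) = x := by
    intro x
    have h3 : Real.sqrt 3 ^ 2 = 3 := Real.sq_sqrt (by norm_num)
    have h4 : Real.sqrt 3 ^ 3 = 3 * Real.sqrt 3 := by rw [pow_succ, h3]
    apply plane_ext <;> simp [rot] <;> ring_nf <;> rw [h3] <;> try rw [h4]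
    all_goals ring
  exact ⟨fun h => by simpa [h3] using key (key h), key⟩

/-- The rotation preserves both the lattice and the measure, so the rotated cell is another
fundamental domain, and the integral of a periodic function is the same over each of them. This
serves the orthogonality of the two ground states. -/
lemma setIntegral_rot {E : Type*} [NormedAddCommGroup E] [NormedSpace ℝ E] {f : Plane → E}
    (hf : LatPeriodic f) : ∫ x in cell, f (rot x) = ∫ x in cell, f x := by
  have hmp : MeasurePreserving rotIsometry (volume : Measure Plane) volume :=
    rotIsometry.measurePreserving
  let e : lat ≃ lat := Equiv.subtypeEquiv rotIsometry.toEquiv (fun x => rot_mem_lat_iff.symm)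
  have h2 : IsAddFundamentalDomain lat (rotIsometry.symm ⁻¹' cell) (volume : Measure Plane) := by
    refine isAddFundamentalDomain_cell.preimage_of_equiv (f := rotIsometry.symm)
      rotIsometry.symm.measurePreserving.quasiMeasurePreserving (e := e) e.bijective ?_
    intro g x
    have : ((e g : lat) : Plane) = rotIsometry g := rfl
    simp [Submodule.vadd_def, this]
  rw [isAddFundamentalDomain_cell.setIntegral_eq h2 (fun g x => hf.vadd g x)]
  have h3 := hmp.setIntegral_preimage_emb
    rotIsometry.toHomeomorph.measurableEmbedding f (rotIsometry.symm ⁻¹' cell)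
  rw [← h3]
  congr 2
  ext x; simp

/-! ### Passing between the cell and the plane -/

/-- A lattice-invariant set that is null in one fundamental domain is null in the plane. -/
lemma ae_of_ae_cell {p : Plane → Prop} (hp : LatPeriodic p)
    (h : ∀ᵐ x ∂(volume.restrict cell), p x) : ∀ᵐ x, p x := by
  have := isAddFundamentalDomain_cell.measure_zero_of_invariant {x | ¬ p x} (fun g => by
    ext x
    rw [Set.mem_vadd_set_iff_neg_vadd_mem]
    simp only [Set.mem_ofPred_eq]
    rw [hp.vadd]) (by
      rw [← Measure.restrict_apply₀' measurableSet_cell.nullMeasurableSet]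
      exact h)
  exact this

lemma measurePreserving_vadd_cell (g : lat) :
    MeasurePreserving (fun x : Plane => -g +ᵥ x) (volume.restrict (g +ᵥ cell))
      (volume.restrict cell) := by
  have := (measurePreserving_vadd (-g) (volume : Measure Plane)).restrict_preimage measurableSet_cell
  convert this using 2
  rw [Set.preimage_vadd, neg_neg]

lemma LatPeriodic.eq_iff {β : Type*} {f g : Plane → β} (hf : LatPeriodic f) (hg : LatPeriodic g) :
    LatPeriodic (fun x => f x = g x) := hf.comp₂ hg _

lemma MemL2.add {f g : Plane → ℂ} (hf : MemL2 f) (hg : MemL2 g) : MemL2 (fun x => f x + g x) :=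
  ⟨hf.1.comp₂ hg.1 _, hf.2.add hg.2⟩

lemma MemL2.sub {f g : Plane → ℂ} (hf : MemL2 f) (hg : MemL2 g) : MemL2 (fun x => f x - g x) :=
  ⟨hf.1.comp₂ hg.1 _, hf.2.sub hg.2⟩

lemma MemL2.const_mul {f : Plane → ℂ} (c : ℂ) (hf : MemL2 f) : MemL2 (fun x => c * f x) :=
  ⟨hf.1.comp _, hf.2.const_mul c⟩

lemma memL2_of_bound {f : Plane → ℂ} (hf : LatPeriodic f)
    (hm : AEStronglyMeasurable f (volume.restrict cell)) {B : ℝ}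
    (hB : ∀ᵐ x ∂(volume.restrict cell), ‖f x‖ ≤ B) : MemL2 f :=
  ⟨hf, MemLp.of_bound hm B hB⟩

/-! ### The exponentials of the dual lattice -/

/-- The dual lattice vector with index `k`. -/
def xi (k : ℤ × ℤ) (i : Fin 2) : ℝ :=
  ![2 * Real.pi * (k.1 + k.2) / Real.sqrt 3, 2 * Real.pi * (k.1 - k.2)] i

/-- The pairing of the dual lattice vector with index `k` with a point. -/
def phase (k : ℤ × ℤ) (x : Plane) : ℝ := xi k 0 * x 0 + xi k 1 * x 1

/-- The exponential with frequency `xi k`. -/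
def mode (k : ℤ × ℤ) (x : Plane) : ℂ := Complex.exp (Complex.I * (phase k x : ℝ))

lemma norm_mode (k : ℤ × ℤ) (x : Plane) : ‖mode k x‖ = 1 := by
  rw [mode, mul_comm, Complex.norm_exp_ofReal_mul_I]

lemma phase_add (k : ℤ × ℤ) (x y : Plane) : phase k (x + y) = phase k x + phase k y := by
  simp [phase]; ring

lemma mode_add (k : ℤ × ℤ) (x y : Plane) : mode k (x + y) = mode k x * mode k y := by
  rw [mode, mode, mode, ← Complex.exp_add, phase_add]
  congr 1; push_cast; ring

lemma phase_coord (k : ℤ × ℤ) (s t : ℝ) :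
    phase k (s • latVec1 + t • latVec2) = 2 * Real.pi * (k.1 * s + k.2 * t) := by
  have h3 : Real.sqrt 3 ≠ 0 := by positivity
  simp [phase, xi, latVec1, latVec2]
  field_simp
  ring

lemma mode_coord (k : ℤ × ℤ) (s t : ℝ) : mode k (s • latVec1 + t • latVec2)
    = Complex.exp (2 * Real.pi * Complex.I * (k.1 * s + k.2 * t)) := by
  rw [mode, phase_coord]; congr 1; push_cast; ring

lemma latPeriodic_mode (k : ℤ × ℤ) : LatPeriodic (mode k) := by
  constructor <;> intro x <;> rw [mode_add]
  · have := mode_coord k 1 0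
    simp only [one_smul, zero_smul, add_zero] at this
    rw [this]
    have : Complex.exp (2 * Real.pi * Complex.I * (k.1 * (1 : ℝ) + k.2 * (0 : ℝ))) = 1 := by
      rw [Complex.exp_eq_one_iff]; exact ⟨k.1, by push_cast; ring⟩
    rw [this, mul_one]
  · have := mode_coord k 0 1
    simp only [one_smul, zero_smul, zero_add] at this
    rw [this]
    have : Complex.exp (2 * Real.pi * Complex.I * (k.1 * (0 : ℝ) + k.2 * (1 : ℝ))) = 1 := by
      rw [Complex.exp_eq_one_iff]; exact ⟨k.2, by push_cast; ring⟩
    rw [this, mul_one]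

lemma contDiff_mode (k : ℤ × ℤ) : ContDiff ℝ ∞ (mode k) := by
  unfold mode
  apply ContDiff.cexp
  refine ContDiff.mul contDiff_const (Complex.ofRealCLM.contDiff.comp ?_)
  change ContDiff ℝ ∞ fun x : Plane => xi k 0 * x 0 + xi k 1 * x 1
  fun_prop

lemma continuous_mode (k : ℤ × ℤ) : Continuous (mode k) := (contDiff_mode k).continuous

lemma memL2_mode (k : ℤ × ℤ) : MemL2 (mode k) :=
  memL2_of_bound (latPeriodic_mode k) (continuous_mode k).aestronglyMeasurable (B := 1)
    (Filter.Eventually.of_forall fun x => (norm_mode k x).le)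

lemma mode_mul_conj (k l : ℤ × ℤ) (x : Plane) :
    (starRingEnd ℂ) (mode k x) * mode l x = mode (l - k) x := by
  have : (starRingEnd ℂ) (mode k x) = Complex.exp (-(Complex.I * (phase k x : ℝ))) := by
    rw [mode, ← Complex.exp_conj]; simp
  rw [this, mode, mode, ← Complex.exp_add]
  congr 1
  simp [phase, xi]
  ring

/-- Translating by `y` multiplies the integral by `mode k y`. A nonzero integral would thus force
`mode k` to be identically `1`. -/
lemma setIntegral_mode (k : ℤ × ℤ) :
    ∫ x in cell, mode k x = if k = 0 then (cellVol : ℂ) else 0 := by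
  split_ifs with h
  · have : ∀ x, mode k x = 1 := by intro x; simp [mode, phase, xi, h]
    simp only [this]
    simp [cellVol]
  · have h1 : ∀ y, (∫ x in cell, mode k x) = (∫ x in cell, mode k x) * mode k y := by
      intro y
      rw [← integral_mul_const, ← setIntegral_translate (latPeriodic_mode k) y]
      simp only [mode_add]
    by_contra h0
    have h2 : ∀ y, mode k y = 1 := fun y => (mul_right_injective₀ h0 (by simpa using (h1 y).symm))
    -- At this point the phase of `mode k` equals `π`, so the mode takes the value `-1`.
    have h3 := h2 ((k.1 / (2 * (k.1 ^ 2 + k.2 ^ 2)) : ℝ) • latVec1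
      + (k.2 / (2 * (k.1 ^ 2 + k.2 ^ 2)) : ℝ) • latVec2)
    have hne : (k.1 : ℝ) ^ 2 + (k.2 : ℝ) ^ 2 ≠ 0 := by
      intro h4
      apply h
      have h5 : (k.1 : ℝ) = 0 := by nlinarith [sq_nonneg (k.1 : ℝ), sq_nonneg (k.2 : ℝ)]
      have h6 : (k.2 : ℝ) = 0 := by nlinarith [sq_nonneg (k.1 : ℝ), sq_nonneg (k.2 : ℝ)]
      ext <;> simpa using (by assumption_mod_cast)
    rw [mode, phase_coord] at h3
    have h4 : 2 * Real.pi * (k.1 * (k.1 / (2 * (k.1 ^ 2 + k.2 ^ 2)))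
        + k.2 * (k.2 / (2 * (k.1 ^ 2 + k.2 ^ 2)))) = Real.pi := by
      field_simp
    rw [h4, mul_comm, Complex.exp_pi_mul_I] at h3
    norm_num at h3

/-- The normalising factor of the exponentials. -/
def cellNorm : ℝ := (Real.sqrt cellVol)⁻¹

lemma cellNorm_pos : 0 < cellNorm := inv_pos.2 (Real.sqrt_pos.2 cellVol_pos)

lemma cellNorm_sq : cellNorm ^ 2 * cellVol = 1 := by
  rw [cellNorm, inv_pow, Real.sq_sqrt cellVol_pos.le, inv_mul_cancel₀ cellVol_pos.ne']

/-- The normalised Fourier coefficients of a periodic function. -/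
def fc (f : Plane → ℂ) (k : ℤ × ℤ) : ℂ :=
  cellNorm * ∫ x in cell, (starRingEnd ℂ) (mode k x) * f x

lemma fc_mode (k l : ℤ × ℤ) : fc (mode l) k = if k = l then (cellNorm : ℂ) * cellVol else 0 := by
  simp only [fc, mode_mul_conj, setIntegral_mode, sub_eq_zero, eq_comm (a := k), mul_ite, mul_zero]

/-- The normalised exponentials in `L²`. -/
def modeLp (k : ℤ × ℤ) : Lp ℂ 2 (volume.restrict cell : Measure Plane) :=
  ((memL2_mode k).const_mul cellNorm).2.toLp _

lemma inner_modeLp {f : Plane → ℂ} (hf : MemLp f 2 (volume.restrict cell)) (k : ℤ × ℤ) :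
    inner ℂ (modeLp k) (hf.toLp f) = fc f k := by
  rw [L2.inner_def, fc, ← integral_const_mul]
  apply integral_congr_ae
  filter_upwards [MemLp.coeFn_toLp ((memL2_mode k).const_mul cellNorm).2, hf.coeFn_toLp]
    with x h1 h2
  rw [modeLp, h1, h2]
  simp
  ring

lemma orthonormal_modeLp : Orthonormal ℂ modeLp := by
  rw [orthonormal_iff_ite]
  intro k l
  rw [modeLp, modeLp, ← modeLp, inner_modeLp]
  have : fc (fun x => (cellNorm : ℂ) * mode l x) k = cellNorm * fc (mode l) k := by
    simp only [fc, mul_left_comm _ (cellNorm : ℂ), integral_const_mul]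
  rw [this, fc_mode]
  split_ifs
  · rw [← mul_assoc, ← sq]; exact_mod_cast cellNorm_sq
  · simp

/-! ### Completeness of the exponentials -/

-- The circle carries normalised Haar measure, for which the characters are orthonormal.
local instance : MeasureSpace UnitAddCircle := ⟨AddCircle.haarAddCircle⟩

local instance : Measure.IsAddHaarMeasure (volume : Measure UnitAddCircle) :=
  inferInstanceAs (Measure.IsAddHaarMeasure AddCircle.haarAddCircle)

local instance : IsProbabilityMeasure (volume : Measure UnitAddCircle) :=
  inferInstanceAs (IsProbabilityMeasure AddCircle.haarAddCircle)

/-- The point of the half-open cell that represents a point of the standard torus. -/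
def torusRep (t : UnitAddTorus (Fin 2)) : Plane :=
  latCoordEquiv.symm (UnitAddTorus.measurableEquivPiIoc 0 t).1

lemma mode_torusRep (k : ℤ × ℤ) (t : UnitAddTorus (Fin 2)) :
    (starRingEnd ℂ) (mode k (torusRep t)) = UnitAddTorus.mFourier (-![k.1, k.2]) t := by
  rw [UnitAddTorus.mFourier_neg]
  congr 1
  have ht : t = fun i => (((UnitAddTorus.measurableEquivPiIoc 0 t).1 i : ℝ) : UnitAddCircle) := by
    conv_lhs => rw [← (UnitAddTorus.measurableEquivPiIoc 0).symm_apply_apply t]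
    rfl
  set v := (UnitAddTorus.measurableEquivPiIoc 0 t).1 with hv
  have : torusRep t = v 0 • latVec1 + v 1 • latVec2 := rfl
  rw [this, mode_coord, ht]
  simp only [UnitAddTorus.mFourier, ContinuousMap.coe_mk, Fin.prod_univ_two, fourier_coe_apply,
    ← Complex.exp_add]
  congr 1
  simp
  ring

/-- The coordinate isomorphism pushes Lebesgue measure to another Haar measure of the plane, and `c`
is their ratio. Only `0 < c < ∞` matters later, because null sets and vanishing integrals do not see
it. -/
lemma exists_measurePreserving_torusRep :
    ∃ c : ENNReal, c ≠ 0 ∧ c ≠ ⊤ ∧ MeasurePreserving torusRep volume (c • volume.restrict cell) := by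
  let L : (Fin 2 → ℝ) ≃L[ℝ] Plane := latCoordEquiv.symm.toContinuousLinearEquiv
  have hL : Measurable L := L.continuous.measurable
  have hmap : Measure.map L volume
      = Measure.addHaarScalarFactor (Measure.map L volume) volume • (volume : Measure Plane) := by
    have : Measure.IsAddHaarMeasure (Measure.map L (volume : Measure (Fin 2 → ℝ))) :=
      L.isAddHaarMeasure_map _
    exact Measure.isAddLeftInvariant_eq_smul _ _
  have : Measure.IsAddHaarMeasure (Measure.map L (volume : Measure (Fin 2 → ℝ))) :=
      L.isAddHaarMeasure_map _
  set c := Measure.addHaarScalarFactor (Measure.map L volume) (volume : Measure Plane)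
  have hc : c ≠ 0 := (Measure.addHaarScalarFactor_pos_of_isAddHaarMeasure _ _).ne'
  refine ⟨c, by exact_mod_cast hc, ENNReal.coe_ne_top, ?_, ?_⟩
  · exact hL.comp (measurable_subtype_coe.comp (UnitAddTorus.measurableEquivPiIoc 0).measurable)
  · have h1 : torusRep = L ∘ (Subtype.val ∘ UnitAddTorus.measurableEquivPiIoc 0) := rfl
    set Q : Set (Fin 2 → ℝ) := {x | ∀ i, x i ∈ Ioc ((0 : Fin 2 → ℝ) i) ((0 : Fin 2 → ℝ) i + 1)}
    have hQm : MeasurableSet Q := MeasurableSet.univ_pi' fun _ => measurableSet_Ioc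
    -- The torus is represented by `Ioc` boxes and the cell by `Ico` boxes; they differ by a null
    -- set.
    have hQ : Q =ᵐ[volume] L ⁻¹' cell := by
      have e1 : Q = Set.univ.pi fun _ => Ioc (0 : ℝ) 1 := by ext; simp [Q]
      have e2 : L ⁻¹' cell = Set.univ.pi fun _ => Ico (0 : ℝ) 1 := by
        ext v
        have hLv : ∀ v : Fin 2 → ℝ, L v = v 0 • latVec1 + v 1 • latVec2 := fun _ => rfl
        simp only [Set.mem_preimage, cell, Set.mem_ofPred_eq, Set.mem_pi, Set.mem_univ,
          forall_true_left, Fin.forall_fin_two]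
        constructor
        · rintro ⟨s, hs, t, ht, h⟩
          have : L v = L ![s, t] := h
          rw [L.injective this]
          exact ⟨hs, ht⟩
        · rintro ⟨h0, h1⟩
          exact ⟨v 0, h0, v 1, h1, rfl⟩
      rw [e1, e2]
      exact Measure.univ_pi_Ioc_ae_eq_Icc.trans Measure.univ_pi_Ico_ae_eq_Icc.symm
    rw [h1, ← Measure.map_map hL
      (measurable_subtype_coe.comp (UnitAddTorus.measurableEquivPiIoc 0).measurable),
      ← Measure.map_map measurable_subtype_coe (UnitAddTorus.measurableEquivPiIoc 0).measurable,
      (UnitAddTorus.measurePreserving_equivPiIoc 0).map_eq]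
    have h2 : Measure.map Subtype.val (Measure.comap (Subtype.val :
        {x : Fin 2 → ℝ // ∀ i, x i ∈ Ioc ((0 : Fin 2 → ℝ) i) ((0 : Fin 2 → ℝ) i + 1)} → _) volume)
        = volume.restrict Q := map_comap_subtype_coe hQm volume
    rw [h2, Measure.restrict_congr_set hQ, ← Measure.restrict_map hL measurableSet_cell, hmap,
      Measure.restrict_smul]
    rfl

/-- Completeness is inherited from the standard torus: `torusRep` carries the modes to characters,
so all Fourier coefficients of `f ∘ torusRep` vanish. -/
lemma ae_eq_zero_of_fc_eq_zero {f : Plane → ℂ} (hf : MemLp f 2 (volume.restrict cell))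
    (h : ∀ k, fc f k = 0) : f =ᵐ[volume.restrict cell] 0 := by
  obtain ⟨c, hc0, hc, hmp⟩ := exists_measurePreserving_torusRep
  have hf' : MemLp f 2 (c • volume.restrict cell) := hf.smul_measure hc
  have hF := hf'.comp_measurePreserving hmp
  have hcoef : ∀ n, UnitAddTorus.mFourierBasis.repr (hF.toLp _) n = 0 := by
    intro n
    rw [UnitAddTorus.mFourierBasis_repr, UnitAddTorus.mFourierCoeff]
    have hn : n = ![(n 0, n 1).1, (n 0, n 1).2] := by ext i; fin_cases i <;> rfl
    have e1 : ∫ t, UnitAddTorus.mFourier (-n) t • (hF.toLp _ : UnitAddTorus (Fin 2) → ℂ) t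
        = ∫ t, (fun x => (starRingEnd ℂ) (mode (n 0, n 1) x) * f x) (torusRep t) := by
      apply integral_congr_ae
      filter_upwards [hF.coeFn_toLp] with t ht
      rw [ht]
      simp only [mode_torusRep]
      rw [← hn]; rfl
    have hm : AEStronglyMeasurable (fun x => (starRingEnd ℂ) (mode (n 0, n 1) x) * f x)
        (c • volume.restrict cell) :=
      ((Complex.continuous_conj.comp (continuous_mode _)).aestronglyMeasurable).mul hf'.1
    have e2 := integral_map (μ := volume) hmp.measurable.aemeasurable (by rwa [hmp.map_eq])
    rw [e1, ← e2, hmp.map_eq, integral_smul_measure]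
    have h2 := h (n 0, n 1)
    rw [fc, mul_eq_zero] at h2
    rw [h2.resolve_left (by exact_mod_cast cellNorm_pos.ne'), smul_zero]
  have h0 : hF.toLp _ = 0 := by
    apply UnitAddTorus.mFourierBasis.repr.injective
    ext n
    rw [hcoef, map_zero]; rfl
  have h1 : f ∘ torusRep =ᵐ[volume] 0 := by
    exact hF.coeFn_toLp.symm.trans (by rw [h0]; exact Lp.coeFn_zero _ _ _)
  have h2 : f =ᵐ[c • volume.restrict cell] 0 := by
    -- A strongly measurable representative makes the exceptional set measurable, as pushing the
    -- null set forward through `torusRep` requires.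
    obtain ⟨g, hg, hfg⟩ := hf'.1
    have h3 : g ∘ torusRep =ᵐ[volume] 0 := (hmp.quasiMeasurePreserving.ae_eq_comp hfg).symm.trans h1
    refine hfg.trans ?_
    rw [← hmp.map_eq]
    exact (ae_map_iff hmp.measurable.aemeasurable
      (hg.measurable (measurableSet_singleton 0))).2 h3
  rw [Filter.EventuallyEq, Measure.ae_ennreal_smul_measure_eq hc0] at h2
  exact h2

lemma span_modeLp_orthogonal : (Submodule.span ℂ (Set.range modeLp))ᗮ = ⊥ := by
  rw [Submodule.eq_bot_iff]
  intro f hf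
  have hf2 := Lp.memLp f
  have h : ∀ k, fc f k = 0 := by
    intro k
    rw [← inner_modeLp hf2, Lp.toLp_coeFn]
    exact Submodule.inner_right_of_mem_orthogonal
      (Submodule.subset_span (Set.mem_range_self k)) hf
  exact (Lp.eq_zero_iff_ae_eq_zero).2 (ae_eq_zero_of_fc_eq_zero hf2 h)

/-- The Hilbert basis of exponentials of `L²` of the cell. -/
def modeBasis : HilbertBasis (ℤ × ℤ) ℂ (Lp ℂ 2 (volume.restrict cell : Measure Plane)) :=
  HilbertBasis.mkOfOrthogonalEqBot orthonormal_modeLp span_modeLp_orthogonal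

lemma modeBasis_repr {f : Plane → ℂ} (hf : MemLp f 2 (volume.restrict cell)) (k : ℤ × ℤ) :
    modeBasis.repr (hf.toLp f) k = fc f k := by
  rw [HilbertBasis.repr_apply_apply, modeBasis, HilbertBasis.coe_mkOfOrthogonalEqBot,
    inner_modeLp]

/-! ### Parseval and Riesz-Fischer -/

lemma hasSum_l2Inner {f g : Plane → ℂ} (hf : MemLp f 2 (volume.restrict cell))
    (hg : MemLp g 2 (volume.restrict cell)) :
    HasSum (fun k => (starRingEnd ℂ) (fc f k) * fc g k) (l2Inner f g) := by
  have h := modeBasis.hasSum_inner_mul_inner (hf.toLp f) (hg.toLp g)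
  have e : inner ℂ (hf.toLp f) (hg.toLp g) = l2Inner f g := by
    rw [L2.inner_def, l2Inner]
    apply integral_congr_ae
    filter_upwards [hf.coeFn_toLp, hg.coeFn_toLp] with x h1 h2
    rw [h1, h2]; simp [mul_comm]
  rw [e] at h
  refine h.congr_fun fun k => ?_
  rw [modeBasis, HilbertBasis.coe_mkOfOrthogonalEqBot, inner_modeLp, ← inner_conj_symm,
    inner_modeLp]

lemma l2Inner_self (f : Plane → ℂ) : l2Inner f f = ((∫ x in cell, ‖f x‖ ^ 2 : ℝ) : ℂ) := by
  rw [l2Inner, ← integral_complex_ofReal]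
  congr 1 with x
  rw [← Complex.normSq_eq_conj_mul_self, Complex.normSq_eq_norm_sq]

lemma hasSum_fc_sq {f : Plane → ℂ} (hf : MemL2 f) :
    HasSum (fun k => ‖fc f k‖ ^ 2) (∫ x in cell, ‖f x‖ ^ 2) := by
  have h := hasSum_l2Inner hf.2 hf.2
  rw [l2Inner_self] at h
  have h2 : (fun k => (starRingEnd ℂ) (fc f k) * fc f k)
      = fun k => ((‖fc f k‖ ^ 2 : ℝ) : ℂ) := by
    ext k
    rw [← Complex.normSq_eq_conj_mul_self, Complex.normSq_eq_norm_sq]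
  rw [h2] at h
  exact Complex.hasSum_ofReal.1 h

/-- The periodic extension of a function on the cell. -/
def periodize {β : Type*} (f : Plane → β) (x : Plane) : β := f (ZSpan.fract latBasis x)

lemma latPeriodic_periodize {β : Type*} (f : Plane → β) : LatPeriodic (periodize f) := by
  have h : ∀ v ∈ lat, ∀ x, periodize f (x + v) = periodize f x := by
    intro v hv x
    rw [periodize, ZSpan.fract_add_ZSpan _ _ hv]; rfl
  exact ⟨h _ (mem_lat_iff.2 ⟨1, 0, by simp⟩), h _ (mem_lat_iff.2 ⟨0, 1, by simp⟩)⟩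

lemma periodize_eq {β : Type*} (f : Plane → β) : ∀ᵐ x ∂volume.restrict cell, periodize f x = f x := by
  filter_upwards [ae_restrict_mem measurableSet_cell] with x hx
  rw [periodize, ZSpan.fract_eq_self.2 (by rwa [← cell_eq])]

/-- The Hilbert basis only yields a function up to null sets on the cell. `periodize` restores
periodicity at every point, which `MemL2` demands. -/
lemma exists_of_summable_sq {c : ℤ × ℤ → ℂ} (hc : Summable fun k => ‖c k‖ ^ 2) :
    ∃ f, MemL2 f ∧ ∀ k, fc f k = c k := by
  have hm : Memℓp c 2 := memℓp_gen (by simpa using hc)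
  set g : Lp ℂ 2 (volume.restrict cell : Measure Plane) := modeBasis.repr.symm ⟨c, hm⟩ with hg
  have hae := periodize_eq (g : Plane → ℂ)
  have hmem : MemLp (periodize g) 2 (volume.restrict cell) := (Lp.memLp g).ae_eq (hae.mono fun _ h => h.symm)
  refine ⟨periodize g, ⟨latPeriodic_periodize _, hmem⟩, fun k => ?_⟩
  rw [← modeBasis_repr hmem]
  have : hmem.toLp _ = g := by
    apply Lp.ext
    exact hmem.coeFn_toLp.trans hae
  rw [this, hg, LinearIsometryEquiv.apply_symm_apply]

lemma fc_congr {f g : Plane → ℂ} (h : f =ᵐ[volume.restrict cell] g) (k : ℤ × ℤ) :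
    fc f k = fc g k := by
  rw [fc, fc]; congr 1
  apply integral_congr_ae
  filter_upwards [h] with x hx
  rw [hx]

lemma integrable_conj_mode_mul {f : Plane → ℂ} (hf : MemL2 f) (k : ℤ × ℤ) :
    Integrable (fun x => (starRingEnd ℂ) (mode k x) * f x) (volume.restrict cell) := by
  refine (hf.2.integrable (by norm_num)).bdd_mul (c := 1)
    (Complex.continuous_conj.comp (continuous_mode k)).aestronglyMeasurable ?_
  exact Filter.Eventually.of_forall fun x => by simp [norm_mode]

lemma fc_add {f g : Plane → ℂ} (hf : MemL2 f) (hg : MemL2 g) (k : ℤ × ℤ) :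
    fc (fun x => f x + g x) k = fc f k + fc g k := by
  simp only [fc, mul_add]
  rw [integral_add (integrable_conj_mode_mul hf k) (integrable_conj_mode_mul hg k), mul_add]

lemma fc_const_mul (c : ℂ) (f : Plane → ℂ) (k : ℤ × ℤ) :
    fc (fun x => c * f x) k = c * fc f k := by
  simp only [fc, mul_left_comm _ c, integral_const_mul]

lemma fc_sub {f g : Plane → ℂ} (hf : MemL2 f) (hg : MemL2 g) (k : ℤ × ℤ) :
    fc (fun x => f x - g x) k = fc f k - fc g k := by
  simp only [fc, mul_sub]
  rw [integral_sub (integrable_conj_mode_mul hf k) (integrable_conj_mode_mul hg k), mul_sub]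

lemma ae_eq_of_fc_eq {f g : Plane → ℂ} (hf : MemL2 f) (hg : MemL2 g) (h : ∀ k, fc f k = fc g k) :
    ∀ᵐ x, f x = g x := by
  apply ae_of_ae_cell (hf.1.eq_iff hg.1)
  have := ae_eq_zero_of_fc_eq_zero (hf.sub hg).2 (fun k => by rw [fc_sub hf hg, h, sub_self])
  filter_upwards [this] with x hx
  exact sub_eq_zero.1 hx

/-! ### Unfolding integrals of test functions -/

lemma finite_vadd_cell_meets {K : Set Plane} (hK : Bornology.IsBounded K) :
    {g : lat | ∃ x ∈ cell, g +ᵥ x ∈ K}.Finite := by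
  have hb : Bornology.IsBounded (K - cell) := hK.sub isBounded_cell
  have h := ZSpan.setFinite_inter latBasis hb
  refine Set.Finite.of_finite_image (f := Subtype.val) (h.subset ?_) Subtype.val_injective.injOn
  rintro _ ⟨g, ⟨x, hx, hgx⟩, rfl⟩
  refine ⟨⟨g +ᵥ x, hgx, x, hx, ?_⟩, g.2⟩
  simp [Submodule.vadd_def]

lemma MemL2.locallyIntegrable {f : Plane → ℂ} (hf : MemL2 f) : LocallyIntegrable f volume := by
  rw [locallyIntegrable_iff]
  intro K hK
  have hfin := finite_vadd_cell_meets hK.isBounded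
  have h1 : IntegrableOn f (⋃ g ∈ {g : lat | ∃ x ∈ cell, g +ᵥ x ∈ K}, g +ᵥ cell) := by
    rw [integrableOn_finite_biUnion hfin]
    intro g _
    have h2 := ((measurePreserving_vadd_cell g).integrable_comp hf.2.1).2
      (hf.2.integrable (by norm_num))
    refine Integrable.congr h2 (Filter.Eventually.of_forall fun x => ?_)
    simp only [Function.comp_apply, hf.1.vadd]
  refine h1.mono_set fun x hx => ?_
  obtain ⟨g, hg⟩ := exists_vadd_mem_cell x
  simp only [Set.mem_iUnion]
  refine ⟨-g, ⟨g +ᵥ x, hg, by simpa using hx⟩, ?_⟩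
  rw [Set.mem_vadd_set_iff_neg_vadd_mem, neg_neg]
  exact hg

lemma MemL2.integrable_smul {f : Plane → ℂ} (hf : MemL2 f) {ζ : Plane → ℝ} (hζ : Continuous ζ)
    (hc : HasCompactSupport ζ) : Integrable (fun x => ζ x • f x) :=
  hf.locallyIntegrable.integrable_smul_left_of_hasCompactSupport hζ hc

/-- Tile the plane by translates of the cell; only the finitely many that meet the support of `ζ`
contribute. `Z` agrees on the cell with the periodisation of `ζ`, and as a fixed finite sum it is
continuous. -/
lemma exists_unfold {ζ : Plane → ℝ} (hζ : Continuous ζ) (hc : HasCompactSupport ζ) :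
    ∃ Z : Plane → ℝ, Continuous Z ∧
      ∀ f, MemL2 f → ∫ x, ζ x • f x = ∫ x in cell, Z x • f x := by
  have hfin := finite_vadd_cell_meets hc.isCompact.isBounded
  refine ⟨fun x => ∑ g ∈ hfin.toFinset, ζ (g +ᵥ x), ?_, fun f hf => ?_⟩
  · refine continuous_finsetSum _ fun g _ => hζ.comp ?_
    exact continuous_const_vadd g
  · have hterm : ∀ g : lat, Integrable (fun x => ζ (g +ᵥ x) • f x) (volume.restrict cell) := by
      intro g
      have := ((measurePreserving_vadd g (volume : Measure Plane)).integrable_comp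
        (hf.integrable_smul hζ hc).1).2 (hf.integrable_smul hζ hc)
      refine (this.mono_measure Measure.restrict_le_self).congr
        (Filter.Eventually.of_forall fun x => ?_)
      simp only [Function.comp_apply, hf.1.vadd]
    rw [isAddFundamentalDomain_cell.integral_eq_tsum'' _ (hf.integrable_smul hζ hc),
      tsum_eq_sum (s := hfin.toFinset)]
    · simp only [Finset.sum_smul]
      rw [integral_finsetSum _ fun g _ => hterm g]
      simp only [hf.1.vadd]
    · intro g hg
      apply setIntegral_eq_zero_of_forall_eq_zero
      intro x hx
      rw [image_eq_zero_of_notMem_tsupport (f := ζ), zero_smul]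
      intro hx2
      exact hg (by simpa using ⟨x, hx, hx2⟩)

lemma memLp_of_continuous_ofReal {Z : Plane → ℝ} (hZ : Continuous Z) :
    MemLp (fun x => (Z x : ℂ)) 2 (volume.restrict cell) := by
  have hK : IsCompact (closure cell) := isBounded_cell.isCompact_closure
  obtain ⟨B, hB⟩ := hK.exists_bound_of_continuousOn hZ.continuousOn
  refine MemLp.of_bound (Complex.continuous_ofReal.comp hZ).aestronglyMeasurable B ?_
  filter_upwards [ae_restrict_mem measurableSet_cell] with x hx
  simpa using hB x (subset_closure hx)

/-- Parseval for the unfolded test function. This is the bridge between weak derivatives, tested on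
the plane, and Fourier coefficients, computed on the cell. -/
lemma hasSum_integral_smul {ζ : Plane → ℝ} (hζ : Continuous ζ) (hc : HasCompactSupport ζ)
    {f : Plane → ℂ} (hf : MemL2 f) :
    HasSum (fun k => (cellNorm * ∫ x, ζ x • mode k x) * fc f k) (∫ x, ζ x • f x) := by
  obtain ⟨Z, hZ, h⟩ := exists_unfold hζ hc
  have h1 := hasSum_l2Inner (memLp_of_continuous_ofReal hZ) hf.2
  have e1 : l2Inner (fun x => (Z x : ℂ)) f = ∫ x, ζ x • f x := by
    rw [h f hf, l2Inner]; congr 1 with x; simp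
  rw [e1] at h1
  refine h1.congr_fun fun k => ?_
  congr 1
  rw [h _ (memL2_mode k), fc, map_mul, Complex.conj_ofReal, ← integral_conj]
  congr 2 with x
  simp [mul_comm]

/-! ### Integration by parts -/

lemma contDiff_partialDeriv {η : Plane → ℝ} (hη : ContDiff ℝ ∞ η) (i : Fin 2) :
    ContDiff ℝ ∞ (partialDeriv i η) := by
  unfold partialDeriv
  exact (hη.fderiv_right (m := ∞) (by simp)).clm_apply contDiff_const

lemma hasCompactSupport_partialDeriv {η : Plane → ℝ} (hc : HasCompactSupport η) (i : Fin 2) :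
    HasCompactSupport (partialDeriv i η) :=
  hc.fderiv_apply (𝕜 := ℝ) _

lemma contDiff_iterate_partialDeriv {η : Plane → ℝ} (hη : ContDiff ℝ ∞ η) (i : Fin 2) (m : ℕ) :
    ContDiff ℝ ∞ ((partialDeriv i)^[m] η) := by
  induction m with
  | zero => exact hη
  | succ m ih => rw [Function.iterate_succ_apply']; exact contDiff_partialDeriv ih i

lemma hasCompactSupport_iterate_partialDeriv {η : Plane → ℝ} (hc : HasCompactSupport η) (i : Fin 2)
    (m : ℕ) : HasCompactSupport ((partialDeriv i)^[m] η) := by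
  induction m with
  | zero => exact hc
  | succ m ih => rw [Function.iterate_succ_apply']; exact hasCompactSupport_partialDeriv ih i

lemma integral_partialDeriv_smul {η : Plane → ℝ} (hη : ContDiff ℝ ∞ η) (hc : HasCompactSupport η)
    {h : Plane → ℂ} (hh : ContDiff ℝ ∞ h) (i : Fin 2) :
    ∫ x, partialDeriv i η x • h x = -∫ x, η x • fderiv ℝ h x (EuclideanSpace.single i 1) := by
  have hd : Continuous fun x => fderiv ℝ h x (EuclideanSpace.single i 1) :=
    ((hh.fderiv_right (m := ∞) (by simp)).clm_apply contDiff_const).continuous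
  have hpc := hasCompactSupport_partialDeriv hc i
  have hp := (contDiff_partialDeriv hη i).continuous
  have h1 := integral_bilinear_fderiv_right_eq_neg_left_of_integrable (μ := volume)
    (B := (ContinuousLinearMap.lsmul ℝ ℝ : ℝ →L[ℝ] ℂ →L[ℝ] ℂ)) (f := η) (g := h)
    (v := EuclideanSpace.single i 1) ?_ ?_ ?_
      (fun x _ => (hη.differentiable (by simp)) x) (fun x _ => (hh.differentiable (by simp)) x)
  · simp only [ContinuousLinearMap.lsmul_apply] at h1
    rw [h1, neg_neg]; rfl
  · exact (hp.smul hh.continuous).integrable_of_hasCompactSupport hpc.smul_right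
  · exact (hη.continuous.smul hd).integrable_of_hasCompactSupport hc.smul_right
  · exact (hη.continuous.smul hh.continuous).integrable_of_hasCompactSupport hc.smul_right

lemma fderiv_mode (k : ℤ × ℤ) (i : Fin 2) (x : Plane) :
    fderiv ℝ (mode k) x (EuclideanSpace.single i 1) = Complex.I * xi k i * mode k x := by
  have hp : HasFDerivAt (phase k) (xi k 0 • (EuclideanSpace.proj 0 : Plane →L[ℝ] ℝ)
      + xi k 1 • (EuclideanSpace.proj 1 : Plane →L[ℝ] ℝ)) x := by
    have h0 := ((EuclideanSpace.proj 0 : Plane →L[ℝ] ℝ).hasFDerivAt (x := x)).const_mul (xi k 0)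
    have h1 := ((EuclideanSpace.proj 1 : Plane →L[ℝ] ℝ).hasFDerivAt (x := x)).const_mul (xi k 1)
    exact h0.add h1
  have h := ((Complex.ofRealCLM.hasFDerivAt.comp x hp).const_mul Complex.I).cexp
  have h' : HasFDerivAt (mode k) _ x := h
  rw [h'.fderiv]
  fin_cases i <;> simp [mode] <;> ring

lemma integral_iterate_partialDeriv_smul_mode {η : Plane → ℝ} (hη : ContDiff ℝ ∞ η)
    (hc : HasCompactSupport η) (i : Fin 2) (m : ℕ) (k : ℤ × ℤ) :
    ∫ x, (partialDeriv i)^[m] η x • mode k x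
      = (-1) ^ m * (Complex.I * xi k i) ^ m * ∫ x, η x • mode k x := by
  induction m with
  | zero => simp
  | succ m ih =>
    rw [Function.iterate_succ_apply', integral_partialDeriv_smul
      (contDiff_iterate_partialDeriv hη i m) (hasCompactSupport_iterate_partialDeriv hc i m)
      (contDiff_mode k)]
    have : ∀ x, (partialDeriv i)^[m] η x • (Complex.I * xi k i * mode k x)
        = Complex.I * xi k i * ((partialDeriv i)^[m] η x • mode k x) :=
      fun x => (mul_smul_comm _ _ _).symm
    simp only [fderiv_mode, this]
    rw [integral_const_mul, ih]; ring

/-- The Fourier symbol of `∂₀ᵐ ∂₁ⁿ`. -/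
def symb (m n : ℕ) (k : ℤ × ℤ) : ℂ := (Complex.I * xi k 0) ^ m * (Complex.I * xi k 1) ^ n

lemma integral_partialDeriv_smul_mode {η : Plane → ℝ} (hη : ContDiff ℝ ∞ η)
    (hc : HasCompactSupport η) (m n : ℕ) (k : ℤ × ℤ) :
    ∫ x, ((partialDeriv 0)^[m] ((partialDeriv 1)^[n] η) x) • mode k x
      = (-1) ^ (m + n) * symb m n k * ∫ x, η x • mode k x := by
  rw [integral_iterate_partialDeriv_smul_mode (contDiff_iterate_partialDeriv hη 1 n)
    (hasCompactSupport_iterate_partialDeriv hc 1 n),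
    integral_iterate_partialDeriv_smul_mode hη hc, symb]
  ring

/-! ### Absolutely convergent Fourier series -/

lemma fc_tsum_mode {a : ℤ × ℤ → ℂ} (ha : Summable fun k => ‖a k‖) (l : ℤ × ℤ) :
    fc (fun x => ∑' k, a k * mode k x) l = cellNorm * cellVol * a l := by
  have h1 : ∀ x, (starRingEnd ℂ) (mode l x) * ∑' k, a k * mode k x
      = ∑' k, (starRingEnd ℂ) (mode l x) * (a k * mode k x) := fun x => by rw [tsum_mul_left]
  have hn : ∀ k x, ‖(starRingEnd ℂ) (mode l x) * (a k * mode k x)‖ = ‖a k‖ := by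
    intro k x; simp [norm_mode]
  have hcont : ∀ k, Continuous fun x => (starRingEnd ℂ) (mode l x) * (a k * mode k x) := by
    intro k
    exact (Complex.continuous_conj.comp (continuous_mode l)).mul
      (continuous_const.mul (continuous_mode k))
  have h2 := hasSum_integral_of_summable_integral_norm (μ := volume.restrict cell)
    (F := fun k x => (starRingEnd ℂ) (mode l x) * (a k * mode k x)) (fun k =>
      Integrable.of_bound (hcont k).aestronglyMeasurable ‖a k‖
        (Filter.Eventually.of_forall fun x => (hn k x).le)) (by
      simp only [hn, integral_const, smul_eq_mul]
      exact ha.mul_left _)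
  simp only [fc, h1]
  rw [← h2.tsum_eq]
  have h3 : ∀ k, ∫ x in cell, (starRingEnd ℂ) (mode l x) * (a k * mode k x)
      = if k = l then a l * cellVol else 0 := by
    intro k
    simp only [mul_left_comm _ (a k), integral_const_mul, mode_mul_conj, setIntegral_mode,
      sub_eq_zero]
    split_ifs with h
    · rw [h]
    · simp
  simp only [h3, tsum_ite_eq]
  ring

lemma continuous_tsum_mode {a : ℤ × ℤ → ℂ} (ha : Summable fun k => ‖a k‖) :
    Continuous fun x => ∑' k, a k * mode k x :=
  continuous_tsum (fun k => continuous_const.mul (continuous_mode k)) ha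
    fun k x => by simp [norm_mode]

lemma memL2_tsum_mode {a : ℤ × ℤ → ℂ} (ha : Summable fun k => ‖a k‖) :
    MemL2 fun x => ∑' k, a k * mode k x := by
  refine memL2_of_bound ⟨fun x => ?_, fun x => ?_⟩ (continuous_tsum_mode ha).aestronglyMeasurable
    (B := ∑' k, ‖a k‖) (Filter.Eventually.of_forall fun x => ?_)
  · simp only [(latPeriodic_mode _).1]
  · simp only [(latPeriodic_mode _).2]
  · exact tsum_of_norm_bounded ha.hasSum fun k => by simp [norm_mode]

lemma ae_eq_tsum_mode {f : Plane → ℂ} (hf : MemL2 f) (h : Summable fun k => ‖fc f k‖) :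
    ∀ᵐ x, f x = ∑' k, cellNorm * fc f k * mode k x := by
  have ha : Summable fun k => ‖cellNorm * fc f k‖ := by
    simp only [norm_mul]; exact h.mul_left _
  apply ae_eq_of_fc_eq hf (memL2_tsum_mode ha)
  intro k
  rw [fc_tsum_mode ha]
  have : (cellNorm : ℂ) ^ 2 * cellVol = 1 := by exact_mod_cast cellNorm_sq
  linear_combination -(fc f k) * this

/-! ### Weak derivatives are Fourier multipliers -/

/-- Test with every translate `η(· - y)`. With `c k = symb m n k * fc f k - fc g k`, this says that
the Fourier series in `y` with coefficients `c k * ∫ η • mode k` vanishes identically, so each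
coefficient is zero. If `c l ≠ 0`, then `mode l` integrates to zero against all test functions and
vanishes almost everywhere, contradicting `|mode l| = 1`. -/
lemma IsWeakDeriv.fc_eq {m n : ℕ} {f g : Plane → ℂ} (hf : MemL2 f) (hg : MemL2 g)
    (h : IsWeakDeriv m n f g) (l : ℤ × ℤ) : fc g l = symb m n l * fc f l := by
  by_contra hne
  have hd : symb m n l * fc f l - fc g l ≠ 0 := sub_ne_zero.2 (Ne.symm hne)
  have key : ∀ η : Plane → ℝ, ContDiff ℝ ∞ η → HasCompactSupport η → ∫ x, η x • mode l x = 0 := by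
    intro η hη hc
    have hs : ∀ y, HasSum (fun k => (symb m n k * fc f k - fc g k) * (∫ x, η x • mode k x)
        * mode k y) 0 := by
      intro y
      have hη' : ContDiff ℝ ∞ (fun x => η (x - y)) := hη.comp (contDiff_id.sub contDiff_const)
      have hc' : HasCompactSupport (fun x => η (x - y)) :=
        hc.comp_homeomorph (Homeomorph.subRight y)
      have e1 := hasSum_integral_smul (contDiff_iterate_partialDeriv
        (contDiff_iterate_partialDeriv hη' 1 n) 0 m).continuous
        (hasCompactSupport_iterate_partialDeriv (hasCompactSupport_iterate_partialDeriv hc' 1 n) 0 m)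
        hf
      have e2 := (hasSum_integral_smul hη'.continuous hc' hg).mul_left ((-1 : ℂ) ^ (m + n))
      have e3 := h _ hη' hc'
      rw [e3] at e1
      have e4 := (e1.sub e2).mul_left ((-1) ^ (m + n) * (cellNorm : ℂ)⁻¹)
      simp only [integral_partialDeriv_smul_mode hη' hc'] at e4
      have e5 : ∀ k, ∫ x, η (x - y) • mode k x = mode k y * ∫ x, η x • mode k x := by
        intro k
        rw [← integral_const_mul, ← integral_add_right_eq_self _ y]
        congr 1 with x
        rw [add_sub_cancel_right, mode_add]; simp; ring
      have hN : (cellNorm : ℂ) ≠ 0 := by exact_mod_cast cellNorm_pos.ne'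
      have hsq : ((-1 : ℂ) ^ (m + n)) * (-1) ^ (m + n) = 1 := by
        rw [← mul_pow]; simp
      have e6 : ((-1 : ℝ) ^ (m + n) • ∫ x, η (x - y) • g x)
          - (-1 : ℂ) ^ (m + n) * ∫ x, η (x - y) • g x = 0 := by
        rw [Complex.real_smul]; push_cast; ring
      rw [e6, mul_zero] at e4
      refine e4.congr_fun fun k => ?_
      rw [e5]
      field_simp
      linear_combination (fc g k - symb m n k * fc f k) * (∫ x, η x • mode k x) * mode k y * hsq
    -- Modes have modulus one, so convergence at the single point `y = 0` already gives absolute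
    -- convergence everywhere.
    have hsum : Summable fun k => ‖(symb m n k * fc f k - fc g k) * (∫ x, η x • mode k x)‖ := by
      refine ((hs 0).summable.norm).congr fun k => ?_
      rw [norm_mul _ (mode k 0), norm_mode, mul_one]
    have h0 := fc_tsum_mode hsum l
    have hz : (fun x => ∑' k, (symb m n k * fc f k - fc g k) * (∫ x, η x • mode k x) * mode k x)
        = fun _ => 0 := by
      ext y; exact (hs y).tsum_eq
    rw [hz] at h0
    have : fc (fun _ => 0) l = 0 := by simp [fc]
    rw [this] at h0
    have hV : (cellVol : ℂ) ≠ 0 := by exact_mod_cast cellVol_pos.ne'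
    have hN : (cellNorm : ℂ) ≠ 0 := by exact_mod_cast cellNorm_pos.ne'
    simpa [hV, hN, hd] using h0.symm
  have h0 := ae_eq_zero_of_integral_contDiff_smul_eq_zero (μ := volume)
    (memL2_mode l).locallyIntegrable key
  have : ∀ᵐ x : Plane, False := by
    filter_upwards [h0] with x hx
    have := norm_mode l x
    rw [hx] at this
    simp at this
  exact this.exists.choose_spec

lemma isWeakDeriv_of_fc_eq {m n : ℕ} {f g : Plane → ℂ} (hf : MemL2 f) (hg : MemL2 g)
    (h : ∀ k, fc g k = symb m n k * fc f k) : IsWeakDeriv m n f g := by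
  intro η hη hc
  have e1 := hasSum_integral_smul (contDiff_iterate_partialDeriv
    (contDiff_iterate_partialDeriv hη 1 n) 0 m).continuous
    (hasCompactSupport_iterate_partialDeriv (hasCompactSupport_iterate_partialDeriv hc 1 n) 0 m) hf
  have e2 := (hasSum_integral_smul hη.continuous hc hg).mul_left ((-1 : ℂ) ^ (m + n))
  simp only [integral_partialDeriv_smul_mode hη hc] at e1
  have := e1.unique (e2.congr_fun fun k => ?_)
  · rw [this]; simp [Complex.real_smul]
  · rw [h]; ring

lemma weakDeriv_spec {m n : ℕ} {f : Plane → ℂ} (h : ∃ g, MemL2 g ∧ IsWeakDeriv m n f g) :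
    MemL2 (weakDeriv m n f) ∧ IsWeakDeriv m n f (weakDeriv m n f) := by
  rw [weakDeriv, dif_pos h]; exact h.choose_spec

lemma fc_weakDeriv {s m n : ℕ} {f : Plane → ℂ} (h : MemSobolev s f) (hmn : m + n ≤ s)
    (k : ℤ × ℤ) : fc (weakDeriv m n f) k = symb m n k * fc f k := by
  have := weakDeriv_spec (h.2 m n hmn)
  exact this.2.fc_eq h.1 this.1 k

/-! ### Sobolev bounds in terms of Fourier coefficients -/

/-- The weight `1 + |ξ|²`. -/
def wt (k : ℤ × ℤ) : ℝ := 1 + xi k 0 ^ 2 + xi k 1 ^ 2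

lemma one_le_wt (k : ℤ × ℤ) : 1 ≤ wt k := by
  unfold wt; nlinarith [sq_nonneg (xi k 0), sq_nonneg (xi k 1)]

lemma wt_pos (k : ℤ × ℤ) : 0 < wt k := zero_lt_one.trans_le (one_le_wt k)

/-- `f` is a periodic `L²` function whose `H^s` norm, expressed through the Fourier coefficients,
is at most `B`. -/
structure SobBound (s : ℕ) (f : Plane → ℂ) (B : ℝ) : Prop where
  memL2 : MemL2 f
  nonneg : 0 ≤ B
  sum_le : ∀ S : Finset (ℤ × ℤ), ∑ k ∈ S, wt k ^ s * ‖fc f k‖ ^ 2 ≤ B ^ 2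

/-- Minkowski's inequality in a weighted finite `ℓ²`, with Cauchy-Schwarz for the cross term. -/
lemma sum_mul_add_sq_le {ι : Type*} (S : Finset ι) (w a b : ι → ℝ) (hw : ∀ k, 0 ≤ w k)
    {A B : ℝ} (hA0 : 0 ≤ A) (hB0 : 0 ≤ B) (hA : ∑ k ∈ S, w k * a k ^ 2 ≤ A ^ 2)
    (hB : ∑ k ∈ S, w k * b k ^ 2 ≤ B ^ 2) : ∑ k ∈ S, w k * (a k + b k) ^ 2 ≤ (A + B) ^ 2 := by
  have h1 := Finset.sum_mul_sq_le_sq_mul_sq S (fun k => Real.sqrt (w k) * a k)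
    (fun k => Real.sqrt (w k) * b k)
  have e1 : ∀ k, (Real.sqrt (w k) * a k) * (Real.sqrt (w k) * b k) = w k * (a k * b k) := by
    intro k
    rw [mul_mul_mul_comm, Real.mul_self_sqrt (hw k)]
  simp only [e1, mul_pow, Real.sq_sqrt (hw _)] at h1
  have h2 : ∑ k ∈ S, w k * (a k * b k) ≤ A * B := by
    apply le_of_sq_le_sq _ (by positivity)
    rw [mul_pow]
    exact h1.trans (mul_le_mul hA hB (Finset.sum_nonneg fun k _ =>
      mul_nonneg (hw k) (sq_nonneg _)) (sq_nonneg _))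
  have e2 : ∑ k ∈ S, w k * (a k + b k) ^ 2 = ∑ k ∈ S, w k * a k ^ 2
      + 2 * ∑ k ∈ S, w k * (a k * b k) + ∑ k ∈ S, w k * b k ^ 2 := by
    rw [Finset.mul_sum, ← Finset.sum_add_distrib, ← Finset.sum_add_distrib]
    exact Finset.sum_congr rfl fun k _ => by ring
  rw [e2]; nlinarith

namespace SobBound

variable {s : ℕ} {f g : Plane → ℂ} {A B : ℝ}

lemma mono (h : SobBound s f A) (hAB : A ≤ B) : SobBound s f B :=
  ⟨h.memL2, h.nonneg.trans hAB, fun S => (h.sum_le S).trans (pow_le_pow_left₀ h.nonneg hAB 2)⟩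

lemma mono_order (h : SobBound s f A) {r : ℕ} (hrs : r ≤ s) : SobBound r f A :=
  ⟨h.memL2, h.nonneg, fun S => (Finset.sum_le_sum fun k _ => mul_le_mul_of_nonneg_right
    (pow_le_pow_right₀ (one_le_wt k) hrs) (sq_nonneg _)).trans (h.sum_le S)⟩

/-- Comparison of Fourier coefficients. -/
lemma of_le {h : Plane → ℂ} {r : ℕ} {C : ℝ} (hf : SobBound s f A) (hg : SobBound s g B)
    (hh : MemL2 h) (hC : 0 ≤ C)
    (hle : ∀ k, wt k ^ r * ‖fc h k‖ ≤ C * (‖fc f k‖ + ‖fc g k‖)) :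
    SobBound (s + 2 * r) h (C * (A + B)) := by
  refine ⟨hh, mul_nonneg hC (add_nonneg hf.nonneg hg.nonneg), fun S => ?_⟩
  have h1 := sum_mul_add_sq_le S (fun k => wt k ^ s) (fun k => ‖fc f k‖) (fun k => ‖fc g k‖)
    (fun k => pow_nonneg (wt_pos k).le _) hf.nonneg hg.nonneg (hf.sum_le S) (hg.sum_le S)
  rw [mul_pow]
  refine le_trans ?_ (mul_le_mul_of_nonneg_left h1 (sq_nonneg C))
  rw [Finset.mul_sum]
  refine Finset.sum_le_sum fun k _ => ?_
  have h2 := pow_le_pow_left₀ (mul_nonneg (pow_nonneg (wt_pos k).le r) (norm_nonneg _)) (hle k) 2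
  have h3 := mul_le_mul_of_nonneg_left h2 (pow_nonneg (wt_pos k).le s)
  calc wt k ^ (s + 2 * r) * ‖fc h k‖ ^ 2 = wt k ^ s * (wt k ^ r * ‖fc h k‖) ^ 2 := by ring
    _ ≤ _ := h3
    _ = _ := by ring

lemma zero (s : ℕ) : SobBound s (fun _ => 0) 0 := by
  refine ⟨memL2_of_bound ⟨fun _ => rfl, fun _ => rfl⟩ aestronglyMeasurable_const (B := 0)
    (by simp), le_rfl, fun S => ?_⟩
  simp [fc]

lemma add (hf : SobBound s f A) (hg : SobBound s g B) :
    SobBound s (fun x => f x + g x) (A + B) := by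
  have := hf.of_le (r := 0) (C := 1) hg (hf.memL2.add hg.memL2) zero_le_one fun k => by
    rw [fc_add hf.memL2 hg.memL2, pow_zero, one_mul, one_mul]; exact norm_add_le _ _
  simpa using this

lemma sub (hf : SobBound s f A) (hg : SobBound s g B) :
    SobBound s (fun x => f x - g x) (A + B) := by
  have := hf.of_le (r := 0) (C := 1) hg (hf.memL2.sub hg.memL2) zero_le_one fun k => by
    rw [fc_sub hf.memL2 hg.memL2, pow_zero, one_mul, one_mul]; exact norm_sub_le _ _
  simpa using this

lemma const_mul (hf : SobBound s f A) (c : ℂ) : SobBound s (fun x => c * f x) (‖c‖ * A) := by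
  have := hf.of_le (r := 0) (C := ‖c‖) (zero s) (hf.memL2.const_mul c) (norm_nonneg _) fun k => by
    rw [fc_const_mul, norm_mul]; simp [fc]
  simpa using this

lemma summable (hf : SobBound s f A) : Summable fun k => wt k ^ s * ‖fc f k‖ ^ 2 :=
  summable_of_sum_le (fun k => mul_nonneg (pow_nonneg (wt_pos k).le _) (sq_nonneg _)) hf.sum_le

lemma tsum_le (hf : SobBound s f A) : ∑' k, wt k ^ s * ‖fc f k‖ ^ 2 ≤ A ^ 2 :=
  hf.summable.tsum_le_of_sum_le hf.sum_le

end SobBound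

lemma l2Norm_nonneg (f : Plane → ℂ) : 0 ≤ l2Norm f := Real.sqrt_nonneg _

lemma l2Norm_sq (f : Plane → ℂ) : l2Norm f ^ 2 = ∫ x in cell, ‖f x‖ ^ 2 :=
  Real.sq_sqrt (integral_nonneg fun _ => sq_nonneg _)

lemma MemL2.sobBound {f : Plane → ℂ} (hf : MemL2 f) : SobBound 0 f (l2Norm f) := by
  refine ⟨hf, l2Norm_nonneg f, fun S => ?_⟩
  rw [l2Norm_sq]
  simpa using sum_le_hasSum S (fun _ _ => sq_nonneg _) (hasSum_fc_sq hf)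

lemma SobBound.setIntegral_le {f : Plane → ℂ} {B : ℝ} (h : SobBound 0 f B) :
    ∫ x in cell, ‖f x‖ ^ 2 ≤ B ^ 2 := by
  refine hasSum_le_of_sum_le (hasSum_fc_sq h.memL2) fun S => ?_
  simpa using h.sum_le S

lemma SobBound.l2Norm_le {f : Plane → ℂ} {B : ℝ} (h : SobBound 0 f B) : l2Norm f ≤ B :=
  Real.sqrt_le_iff.2 ⟨h.nonneg, h.setIntegral_le⟩

lemma norm_symb_sq_le (m n : ℕ) (k : ℤ × ℤ) : ‖symb m n k‖ ^ 2 ≤ wt k ^ (m + n) := by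
  have h0 : xi k 0 ^ 2 ≤ wt k := by unfold wt; nlinarith [sq_nonneg (xi k 1)]
  have h1 : xi k 1 ^ 2 ≤ wt k := by unfold wt; nlinarith [sq_nonneg (xi k 0)]
  have : ‖symb m n k‖ ^ 2 = (xi k 0 ^ 2) ^ m * (xi k 1 ^ 2) ^ n := by
    simp only [symb, norm_mul, norm_pow, Complex.norm_I, one_mul, Complex.norm_real,
      Real.norm_eq_abs]
    rw [← sq_abs (xi k 0), ← sq_abs (xi k 1)]
    ring
  rw [this, pow_add]
  exact mul_le_mul (pow_le_pow_left₀ (sq_nonneg _) h0 m) (pow_le_pow_left₀ (sq_nonneg _) h1 n)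
    (by positivity) (pow_nonneg (wt_pos k).le _)

/-- Existence of weak derivatives and their size. -/
lemma SobBound.exists_weakDeriv {s m n : ℕ} {f : Plane → ℂ} {B : ℝ} (h : SobBound s f B)
    (hmn : m + n ≤ s) : ∃ g, SobBound (s - (m + n)) g B ∧ (∀ k, fc g k = symb m n k * fc f k) ∧
      IsWeakDeriv m n f g := by
  have key : ∀ k, wt k ^ (s - (m + n)) * ‖symb m n k * fc f k‖ ^ 2 ≤ wt k ^ s * ‖fc f k‖ ^ 2 := by
    intro k
    rw [norm_mul, mul_pow, ← mul_assoc]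
    refine mul_le_mul_of_nonneg_right ?_ (sq_nonneg _)
    calc _ ≤ wt k ^ (s - (m + n)) * wt k ^ (m + n) :=
          mul_le_mul_of_nonneg_left (norm_symb_sq_le m n k) (pow_nonneg (wt_pos k).le _)
      _ = wt k ^ s := by rw [← pow_add, Nat.sub_add_cancel hmn]
  have hs : Summable fun k => ‖symb m n k * fc f k‖ ^ 2 := by
    refine Summable.of_nonneg_of_le (fun _ => sq_nonneg _) (fun k => ?_) h.summable
    refine le_trans ?_ (key k)
    exact le_mul_of_one_le_left (sq_nonneg _) (one_le_pow₀ (one_le_wt k))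
  obtain ⟨g, hg, hgc⟩ := exists_of_summable_sq hs
  refine ⟨g, ⟨hg, h.nonneg, fun S => ?_⟩, hgc, isWeakDeriv_of_fc_eq h.memL2 hg hgc⟩
  refine (Finset.sum_le_sum fun k _ => ?_).trans (h.sum_le S)
  rw [hgc]; exact key k

lemma SobBound.memSobolev {s : ℕ} {f : Plane → ℂ} {B : ℝ} (h : SobBound s f B) :
    MemSobolev s f := by
  refine ⟨h.memL2, fun m n hmn => ?_⟩
  obtain ⟨g, hg, _, hw⟩ := h.exists_weakDeriv hmn
  exact ⟨g, hg.memL2, hw⟩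

/-- The number of derivatives of order at most `s`. -/
def sobCount (s : ℕ) : ℝ :=
  ∑ k ∈ Finset.range (s + 1), ((Finset.HasAntidiagonal.antidiagonal k).card : ℝ)

lemma SobBound.sobolevNorm_le {s : ℕ} {f : Plane → ℂ} {B : ℝ} (h : SobBound s f B) :
    sobolevNorm s f ≤ Real.sqrt (sobCount s) * B := by
  have e : Real.sqrt (sobCount s) * B = Real.sqrt (sobCount s * B ^ 2) := by
    have h0 : 0 ≤ sobCount s := Finset.sum_nonneg fun _ _ => Nat.cast_nonneg _
    rw [Real.sqrt_mul h0, Real.sqrt_sq h.nonneg]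
  rw [sobolevNorm, e]
  apply Real.sqrt_le_sqrt
  rw [sobCount, Finset.sum_mul]
  refine Finset.sum_le_sum fun k hk => ?_
  rw [← nsmul_eq_mul]
  refine Finset.sum_le_card_nsmul _ _ _ fun p hp => ?_
  have hmn : p.1 + p.2 ≤ s := by
    rw [Finset.HasAntidiagonal.mem_antidiagonal.1 hp]; exact Nat.lt_succ_iff.1 (Finset.mem_range.1 hk)
  have hm := (weakDeriv_spec (h.memSobolev.2 p.1 p.2 hmn)).1
  refine hasSum_le_of_sum_le (hasSum_fc_sq hm) fun S => ?_
  refine (Finset.sum_le_sum fun k _ => ?_).trans (h.sum_le S)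
  rw [fc_weakDeriv h.memSobolev hmn, norm_mul, mul_pow]
  exact mul_le_mul_of_nonneg_right ((norm_symb_sq_le _ _ k).trans
    (pow_le_pow_right₀ (one_le_wt k) hmn)) (sq_nonneg _)

lemma sobolevNorm_nonneg (s : ℕ) (f : Plane → ℂ) : 0 ≤ sobolevNorm s f := Real.sqrt_nonneg _

lemma MemSobolev.setIntegral_weakDeriv_le {s m n : ℕ} (f : Plane → ℂ) (hmn : m + n ≤ s) :
    ∫ x in cell, ‖weakDeriv m n f x‖ ^ 2 ≤ sobolevNorm s f ^ 2 := by
  set F : ℕ × ℕ → ℝ := fun p => ∫ x in cell, ‖weakDeriv p.1 p.2 f x‖ ^ 2 with hF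
  have h0 : ∀ p, 0 ≤ F p := fun p => integral_nonneg fun _ => sq_nonneg _
  have hG : ∀ k, 0 ≤ ∑ p ∈ Finset.HasAntidiagonal.antidiagonal k, F p :=
    fun k => Finset.sum_nonneg fun p _ => h0 p
  rw [sobolevNorm, Real.sq_sqrt (Finset.sum_nonneg fun k _ => hG k)]
  have hmem : (m, n) ∈ Finset.HasAntidiagonal.antidiagonal (m + n) := by
    rw [Finset.HasAntidiagonal.mem_antidiagonal]
  have h1 := Finset.single_le_sum (fun p _ => h0 p) hmem
  have h2 := Finset.single_le_sum (fun k _ => hG k)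
    (Finset.mem_range.2 (Nat.lt_succ_of_le hmn))
  exact h1.trans h2

/-- Since `(1 + x + y)² ≤ 3 (1 + x² + y²)`, orders zero and the two pure second derivatives suffice.
Three terms with factor `3` give `9 = 3²`. -/
lemma MemSobolev.sobBound {f : Plane → ℂ} (h : MemSobolev 2 f) :
    SobBound 2 f (3 * sobolevNorm 2 f) := by
  refine ⟨h.1, by have := sobolevNorm_nonneg 2 f; positivity, fun S => ?_⟩
  have key : ∀ m n, m + n ≤ 2 → ∑ k ∈ S, ‖symb m n k * fc f k‖ ^ 2 ≤ sobolevNorm 2 f ^ 2 := by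
    intro m n hmn
    refine le_trans ?_ (MemSobolev.setIntegral_weakDeriv_le f hmn)
    simp only [← fc_weakDeriv h hmn]
    exact sum_le_hasSum S (fun _ _ => sq_nonneg _)
      (hasSum_fc_sq (weakDeriv_spec (h.2 m n hmn)).1)
  have h1 := key 0 0 (by norm_num)
  have h2 := key 2 0 (by norm_num)
  have h3 := key 0 2 (by norm_num)
  have h4 : ∑ k ∈ S, wt k ^ 2 * ‖fc f k‖ ^ 2 ≤ ∑ k ∈ S, (3 * ‖symb 0 0 k * fc f k‖ ^ 2
      + 3 * ‖symb 2 0 k * fc f k‖ ^ 2 + 3 * ‖symb 0 2 k * fc f k‖ ^ 2) := by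
    refine Finset.sum_le_sum fun k _ => ?_
    simp only [symb, norm_mul, norm_pow, Complex.norm_I, one_mul, Complex.norm_real,
      Real.norm_eq_abs, pow_zero, mul_pow, sq_abs, mul_one, one_pow, ← mul_assoc, ← add_mul]
    refine mul_le_mul_of_nonneg_right ?_ (sq_nonneg _)
    unfold wt
    nlinarith [sq_nonneg (xi k 0 ^ 2 - 1), sq_nonneg (xi k 1 ^ 2 - 1),
      sq_nonneg (xi k 0 ^ 2 - xi k 1 ^ 2)]
  rw [Finset.sum_add_distrib, Finset.sum_add_distrib, ← Finset.mul_sum, ← Finset.mul_sum,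
    ← Finset.mul_sum] at h4
  nlinarith

/-! ### Sup bounds -/

/-- Dimension two enters here: `wt k ≥ 1 + k₁² + k₂²`, whose square dominates `(1 + k₁²)(1 + k₂²)`,
so the series is bounded by a product of two convergent one-dimensional ones. -/
lemma summable_wt : Summable fun k => (wt k ^ 2)⁻¹ := by
  have h1 : Summable fun n : ℤ => (1 + (n : ℝ) ^ 2)⁻¹ := by
    have h := (Real.summable_one_div_int_pow (p := 2)).2 (by norm_num)
    refine Summable.of_norm_bounded_eventually h ?_
    rw [Filter.eventually_cofinite]
    refine (Set.finite_singleton (0 : ℤ)).subset fun n hn => ?_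
    by_contra hn0
    apply hn
    have hn1 : (n : ℝ) ≠ 0 := by exact_mod_cast hn0
    have : 0 < (n : ℝ) ^ 2 := by positivity
    rw [norm_inv, Real.norm_of_nonneg (by positivity), one_div]
    exact inv_anti₀ this (by linarith)
  have h2 := h1.mul_of_nonneg h1 (fun n => by positivity) (fun n => by positivity)
  refine Summable.of_nonneg_of_le (fun k => by have := wt_pos k; positivity) (fun k => ?_) h2
  rw [← mul_inv]
  apply inv_anti₀ (by positivity)
  have hw : 1 + (k.1 : ℝ) ^ 2 + (k.2 : ℝ) ^ 2 ≤ wt k := by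
    have hpi : 9 ≤ Real.pi ^ 2 := by nlinarith [Real.pi_gt_three]
    have h3 : Real.sqrt 3 ^ 2 = 3 := Real.sq_sqrt (by norm_num)
    have e0 : xi k 0 ^ 2 = 4 * Real.pi ^ 2 * ((k.1 : ℝ) + k.2) ^ 2 / 3 := by
      simp [xi, div_pow, h3]; ring
    have e1 : xi k 1 ^ 2 = 4 * Real.pi ^ 2 * ((k.1 : ℝ) - k.2) ^ 2 := by
      simp [xi]; ring
    rw [wt, e0, e1]
    nlinarith [mul_le_mul_of_nonneg_right hpi (sq_nonneg ((k.1 : ℝ) + k.2)),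
      mul_le_mul_of_nonneg_right hpi (sq_nonneg ((k.1 : ℝ) - k.2)),
      sq_nonneg ((k.1 : ℝ) + k.2), sq_nonneg ((k.1 : ℝ) - k.2)]
  have hw2 := pow_le_pow_left₀ (by positivity) hw 2
  nlinarith [sq_nonneg ((k.1 : ℝ) * k.2), sq_nonneg (k.1 : ℝ), sq_nonneg (k.2 : ℝ),
    sq_nonneg ((k.1 : ℝ) ^ 2), sq_nonneg ((k.2 : ℝ) ^ 2)]

/-- The sum of the inverse squared weights. -/
def wtSum : ℝ := ∑' k, (wt k ^ 2)⁻¹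

lemma wtSum_nonneg : 0 ≤ wtSum := tsum_nonneg fun k => by have := wt_pos k; positivity

/-- Cauchy-Schwarz against the weights, over a finite set. -/
lemma SobBound.sum_norm_fc_le {f : Plane → ℂ} {A : ℝ} (h : SobBound 2 f A) (S : Finset (ℤ × ℤ))
    {T : ℝ} (hT0 : 0 ≤ T) (hT : ∑ k ∈ S, (wt k ^ 2)⁻¹ ≤ T ^ 2) : ∑ k ∈ S, ‖fc f k‖ ≤ T * A := by
  have h1 := Finset.sum_mul_sq_le_sq_mul_sq S (fun k => (wt k)⁻¹) (fun k => wt k * ‖fc f k‖)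
  have e1 : ∀ k, (wt k)⁻¹ * (wt k * ‖fc f k‖) = ‖fc f k‖ := fun k => by
    rw [inv_mul_cancel_left₀ (wt_pos k).ne']
  simp only [e1, mul_pow, inv_pow] at h1
  apply le_of_sq_le_sq _ (mul_nonneg hT0 h.nonneg)
  rw [mul_pow]
  exact h1.trans (mul_le_mul hT (h.sum_le S) (Finset.sum_nonneg fun k _ =>
    mul_nonneg (sq_nonneg _) (sq_nonneg _)) (sq_nonneg _))

lemma SobBound.summable_norm_fc {f : Plane → ℂ} {A : ℝ} (h : SobBound 2 f A) :
    Summable fun k => ‖fc f k‖ := by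
  refine summable_of_sum_le (fun _ => norm_nonneg _) fun S =>
    h.sum_norm_fc_le S (Real.sqrt_nonneg wtSum) ?_
  rw [Real.sq_sqrt wtSum_nonneg]
  exact summable_wt.sum_le_tsum S fun k _ => by have := wt_pos k; positivity

/-- The constant of the embedding of `H²` into the bounded functions. -/
def supConst : ℝ := cellNorm * Real.sqrt wtSum

lemma supConst_nonneg : 0 ≤ supConst := mul_nonneg cellNorm_pos.le (Real.sqrt_nonneg _)

lemma SobBound.tsum_norm_fc_le {f : Plane → ℂ} {A : ℝ} (h : SobBound 2 f A) :
    cellNorm * ∑' k, ‖fc f k‖ ≤ supConst * A := by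
  rw [supConst, mul_assoc]
  refine mul_le_mul_of_nonneg_left ?_ cellNorm_pos.le
  refine h.summable_norm_fc.tsum_le_of_sum_le fun S => h.sum_norm_fc_le S (Real.sqrt_nonneg _) ?_
  rw [Real.sq_sqrt wtSum_nonneg]
  exact summable_wt.sum_le_tsum S fun k _ => by have := wt_pos k; positivity

lemma ae_norm_le_tsum {f : Plane → ℂ} (hf : MemL2 f) (h : Summable fun k => ‖fc f k‖) :
    ∀ᵐ x, ‖f x‖ ≤ cellNorm * ∑' k, ‖fc f k‖ := by
  filter_upwards [ae_eq_tsum_mode hf h] with x hx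
  rw [hx, ← tsum_mul_left]
  refine tsum_of_norm_bounded (h.mul_left _).hasSum fun k => ?_
  simp [norm_mode, abs_of_pos cellNorm_pos]

lemma SobBound.ae_norm_le {f : Plane → ℂ} {A : ℝ} (h : SobBound 2 f A) :
    ∀ᵐ x, ‖f x‖ ≤ supConst * A :=
  (ae_norm_le_tsum h.memL2 h.summable_norm_fc).mono fun _ hx => hx.trans h.tsum_norm_fc_le

/-- The sup norm is controlled by a small multiple of the `H²` norm and the `L²` norm. -/
lemma exists_ae_norm_le {τ : ℝ} (hτ : 0 < τ) : ∃ C : ℝ, 0 ≤ C ∧ ∀ (f : Plane → ℂ) (A B : ℝ),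
    SobBound 2 f A → SobBound 0 f B → ∀ᵐ x, ‖f x‖ ≤ τ * A + C * B := by
  set τ' := τ / cellNorm with hτ'
  have hτ'0 : 0 < τ' := div_pos hτ cellNorm_pos
  -- Frequencies are split at a finite set `F`. Outside it the tail of the weights is below `τ'²`,
  -- which puts the factor `τ` on the `H²` bound; inside it Cauchy-Schwarz with `F.card` terms uses
  -- only the `L²` bound.
  obtain ⟨F, hF⟩ := summable_iff_vanishing_norm.1 summable_wt (τ' ^ 2) (by positivity)
  refine ⟨cellNorm * Real.sqrt F.card, mul_nonneg cellNorm_pos.le (Real.sqrt_nonneg _),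
    fun f A B hA hB => ?_⟩
  have h1 : ∑ k ∈ F, ‖fc f k‖ ≤ Real.sqrt F.card * B := by
    apply le_of_sq_le_sq _ (mul_nonneg (Real.sqrt_nonneg _) hB.nonneg)
    rw [mul_pow, Real.sq_sqrt (Nat.cast_nonneg _)]
    have := hB.sum_le F
    simp only [pow_zero, one_mul] at this
    exact (sq_sum_le_card_mul_sum_sq).trans (mul_le_mul_of_nonneg_left this (Nat.cast_nonneg _))
  have h2 : ∑' k, ‖fc f k‖ ≤ τ' * A + Real.sqrt F.card * B := by
    refine hA.summable_norm_fc.tsum_le_of_sum_le fun S => ?_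
    rw [← Finset.sum_inter_add_sum_sdiff S F, add_comm]
    refine add_le_add (hA.sum_norm_fc_le _ hτ'0.le ?_) ?_
    · have := hF (S \ F) Finset.sdiff_disjoint
      rw [Real.norm_of_nonneg (Finset.sum_nonneg fun k _ => by have := wt_pos k; positivity)] at this
      exact this.le
    · exact (Finset.sum_le_sum_of_subset_of_nonneg Finset.inter_subset_right
        fun _ _ _ => norm_nonneg _).trans h1
  filter_upwards [ae_norm_le_tsum hA.memL2 hA.summable_norm_fc] with x hx
  refine hx.trans ((mul_le_mul_of_nonneg_left h2 cellNorm_pos.le).trans (le_of_eq ?_))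
  rw [hτ', mul_add, ← mul_assoc, ← mul_assoc, mul_div_cancel₀ _ cellNorm_pos.ne']

/-! ### The Bloch Laplacian -/

/-- The Fourier symbol of `-(∇ + iK)²`. -/
def blochSymb (k : ℤ × ℤ) : ℝ := (xi k 0 + diracPt 0) ^ 2 + (xi k 1 + diracPt 1) ^ 2

lemma blochSymb_nonneg (k : ℤ × ℤ) : 0 ≤ blochSymb k := by unfold blochSymb; positivity

lemma MemSobolev.fc_blochLaplacian {f : Plane → ℂ} (h : MemSobolev 2 f) :
    MemL2 (blochLaplacian f) ∧ ∀ k, fc (blochLaplacian f) k = -(blochSymb k * fc f k) := by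
  have w := fun m n (hmn : m + n ≤ 2) => (weakDeriv_spec (h.2 m n hmn)).1
  have h20 := w 2 0 (by norm_num)
  have h02 := w 0 2 (by norm_num)
  have h10 := w 1 0 (by norm_num)
  have h01 := w 0 1 (by norm_num)
  have m1 := h20.add h02
  have m2 := ((h10.const_mul (diracPt 0)).add (h01.const_mul (diracPt 1))).const_mul
    (2 * Complex.I)
  have m3 := h.1.const_mul ((‖diracPt‖ ^ 2 : ℝ) : ℂ)
  refine ⟨(m1.add m2).sub m3, fun k => ?_⟩
  have e : fc (blochLaplacian f) k = fc (fun x => (weakDeriv 2 0 f x + weakDeriv 0 2 f x)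
    + 2 * Complex.I * ((diracPt 0 : ℂ) * weakDeriv 1 0 f x + (diracPt 1 : ℂ) * weakDeriv 0 1 f x)
    - ((‖diracPt‖ ^ 2 : ℝ) : ℂ) * f x) k := rfl
  rw [e, fc_sub (m1.add m2) m3, fc_add m1 m2, fc_add h20 h02, fc_const_mul,
    fc_add (h10.const_mul _) (h01.const_mul _), fc_const_mul, fc_const_mul, fc_const_mul,
    fc_weakDeriv h (by norm_num), fc_weakDeriv h (by norm_num), fc_weakDeriv h (by norm_num),
    fc_weakDeriv h (by norm_num)]
  have hn : ‖diracPt‖ ^ 2 = diracPt 0 ^ 2 + diracPt 1 ^ 2 := by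
    rw [EuclideanSpace.norm_sq_eq, Fin.sum_univ_two]; simp
  rw [hn]
  simp only [symb, blochSymb]
  push_cast
  linear_combination ((xi k 0 : ℂ) ^ 2 + (xi k 1 : ℂ) ^ 2
    + 2 * (diracPt 0 * xi k 0 + diracPt 1 * xi k 1)) * fc f k * Complex.I_sq

/-- The constant comparing `1 + |ξ|²` with `1 + |ξ + K|²`. -/
def ellConst : ℝ := 2 + 2 * ‖diracPt‖ ^ 2

lemma ellConst_nonneg : 0 ≤ ellConst := by unfold ellConst; positivity

/-- Follows from `|ξ|² ≤ 2 |ξ + K|² + 2 |K|²`, that is, `|ξ + 2K|² ≥ 0`. -/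
lemma wt_le (k : ℤ × ℤ) : wt k ≤ ellConst * (1 + blochSymb k) := by
  have hn : ‖diracPt‖ ^ 2 = diracPt 0 ^ 2 + diracPt 1 ^ 2 := by
    rw [EuclideanSpace.norm_sq_eq, Fin.sum_univ_two]; simp
  have h1 : wt k ≤ 1 + 2 * blochSymb k + 2 * ‖diracPt‖ ^ 2 := by
    rw [hn, wt, blochSymb]
    nlinarith [sq_nonneg (xi k 0 + 2 * diracPt 0), sq_nonneg (xi k 1 + 2 * diracPt 1)]
  have := mul_nonneg (sq_nonneg ‖diracPt‖) (blochSymb_nonneg k)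
  unfold ellConst
  nlinarith [blochSymb_nonneg k]

/-- Elliptic regularity. -/
lemma SobBound.elliptic {s : ℕ} {f g : Plane → ℂ} {A B : ℝ} (hf : SobBound s f A)
    (hg : SobBound s g B) (h : ∀ k, blochSymb k * fc f k = fc g k) :
    SobBound (s + 2) f (ellConst * (A + B)) := by
  refine hf.of_le (r := 1) hg hf.memL2 ellConst_nonneg fun k => ?_
  rw [pow_one, ← h, norm_mul, Complex.norm_real, Real.norm_of_nonneg (blochSymb_nonneg k)]
  calc wt k * ‖fc f k‖ ≤ ellConst * (1 + blochSymb k) * ‖fc f k‖ :=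
        mul_le_mul_of_nonneg_right (wt_le k) (norm_nonneg _)
    _ = _ := by ring

lemma memSobolev_two_of_fc {f g : Plane → ℂ} (hf : MemL2 f) (hg : MemL2 g)
    (h : ∀ k, blochSymb k * fc f k = fc g k) : MemSobolev 2 f :=
  (hf.sobBound.elliptic hg.sobBound h).memSobolev

/-- The equation `-(∇ + iK)² f = g` in terms of Fourier coefficients. -/
lemma neg_blochLaplacian_ae_eq_iff {f g : Plane → ℂ} (hf : MemSobolev 2 f) (hg : MemL2 g) :
    (∀ᵐ x, -blochLaplacian f x = g x) ↔ ∀ k, blochSymb k * fc f k = fc g k := by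
  obtain ⟨hm, hc⟩ := hf.fc_blochLaplacian
  have hneg : MemL2 fun x => -1 * blochLaplacian f x := hm.const_mul (-1)
  have e : ∀ k, fc (fun x => -1 * blochLaplacian f x) k = blochSymb k * fc f k := by
    intro k; rw [fc_const_mul, hc]; ring
  constructor
  · intro h k
    rw [← e]
    apply fc_congr
    filter_upwards [ae_restrict_of_ae h] with x hx
    rw [← hx]; ring
  · intro h
    filter_upwards [ae_eq_of_fc_eq hneg hg fun k => by rw [e, h]] with x hx
    rw [← hx]; ring

/-! ### Smooth periodic functions -/

variable {G H W : Type} [NormedAddCommGroup G] [NormedSpace ℝ G] [NormedAddCommGroup H]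
  [NormedSpace ℝ H] [NormedAddCommGroup W] [NormedSpace ℝ W]

/-- Smooth periodic functions. -/
structure SmoothPer (f : Plane → G) : Prop where
  smooth : ContDiff ℝ ∞ f
  per : LatPeriodic f

lemma SmoothPer.fderiv {f : Plane → G} (hf : SmoothPer f) : SmoothPer (fderiv ℝ f) := by
  refine ⟨hf.smooth.fderiv_right (m := ∞) (by simp), fun x => ?_, fun x => ?_⟩
  · rw [← fderiv_comp_add_right]; simp only [hf.per.1]
  · rw [← fderiv_comp_add_right]; simp only [hf.per.2]

lemma SmoothPer.differentiable {f : Plane → G} (hf : SmoothPer f) : Differentiable ℝ f :=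
  hf.smooth.differentiable (by simp)

lemma SmoothPer.clm {f : Plane → G} (hf : SmoothPer f) (L : G →L[ℝ] H) :
    SmoothPer (fun x => L (f x)) :=
  ⟨L.contDiff.comp hf.smooth, hf.per.comp L⟩

lemma SmoothPer.add {f g : Plane → G} (hf : SmoothPer f) (hg : SmoothPer g) :
    SmoothPer (fun x => f x + g x) :=
  ⟨hf.smooth.add hg.smooth, hf.per.comp₂ hg.per _⟩

lemma SmoothPer.bilin {f : Plane → G} {g : Plane → H} (hf : SmoothPer f) (hg : SmoothPer g)
    (L : G →L[ℝ] H →L[ℝ] W) : SmoothPer (fun x => L (f x) (g x)) :=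
  ⟨(L.contDiff.comp hf.smooth).clm_apply hg.smooth, hf.per.comp₂ hg.per fun a b => L a b⟩

lemma smoothPer_const (c : G) : SmoothPer (fun _ : Plane => c) :=
  ⟨contDiff_const, fun _ => rfl, fun _ => rfl⟩

lemma integrable_cell_of_continuous {f : Plane → ℝ} (hf : Continuous f) :
    Integrable f (volume.restrict cell) :=
  (hf.continuousOn.integrableOn_compact isBounded_cell.isCompact_closure).mono_set subset_closure

lemma SmoothPer.integrable_norm_sq {f : Plane → G} (hf : SmoothPer f) :
    Integrable (fun x => ‖f x‖ ^ 2) (volume.restrict cell) :=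
  integrable_cell_of_continuous (hf.smooth.continuous.norm.pow 2)

lemma SmoothPer.memL2 {f : Plane → ℂ} (hf : SmoothPer f) : MemL2 f :=
  ⟨hf.per, (memLp_two_iff_integrable_sq_norm hf.smooth.continuous.aestronglyMeasurable).2
    hf.integrable_norm_sq⟩

lemma setIntegral_sq_le_of_le {f : Plane → G} (hf : SmoothPer f) {B : ℝ} (h : ∀ x, ‖f x‖ ≤ B) :
    ∫ x in cell, ‖f x‖ ^ 2 ≤ cellVol * B ^ 2 := by
  have h1 : ∫ x in cell, ‖f x‖ ^ 2 ≤ ∫ x in cell, B ^ 2 :=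
    integral_mono hf.integrable_norm_sq (integrable_const _)
      fun x => pow_le_pow_left₀ (norm_nonneg _) (h x) 2
  simpa [cellVol] using h1

lemma setIntegral_sq_le_of_le_add {f : Plane → G} {g : Plane → H} {h : Plane → W}
    (hf : SmoothPer f) (hg : SmoothPer g) (hh : SmoothPer h) {A B : ℝ}
    (hle : ∀ x, ‖f x‖ ≤ A * ‖g x‖ + B * ‖h x‖) : ∫ x in cell, ‖f x‖ ^ 2
      ≤ 2 * A ^ 2 * (∫ x in cell, ‖g x‖ ^ 2) + 2 * B ^ 2 * ∫ x in cell, ‖h x‖ ^ 2 := by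
  rw [← integral_const_mul, ← integral_const_mul, ← integral_add
    (hg.integrable_norm_sq.const_mul _) (hh.integrable_norm_sq.const_mul _)]
  refine integral_mono hf.integrable_norm_sq ((hg.integrable_norm_sq.const_mul _).add
    (hh.integrable_norm_sq.const_mul _)) fun x => ?_
  have := pow_le_pow_left₀ (norm_nonneg _) (hle x) 2
  simp only
  nlinarith [sq_nonneg (A * ‖g x‖ - B * ‖h x‖)]

/-- Derivatives of order at most `k` are bounded by `B`, and those of order `k + 1` are bounded by
`B` in `L²`. -/
def YBound : ∀ (_ : ℕ) {G : Type} [NormedAddCommGroup G] [NormedSpace ℝ G], (Plane → G) → ℝ → Prop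
  | 0, _, _, _, f, B => (∀ x, ‖f x‖ ≤ B) ∧ ∫ x in cell, ‖fderiv ℝ f x‖ ^ 2 ≤ B ^ 2
  | k + 1, _, _, _, f, B => (∀ x, ‖f x‖ ≤ B) ∧ YBound k (fderiv ℝ f) B

/-- A constant relating sup norms and `L²` norms on the cell. -/
def volConst : ℝ := 1 + cellVol

lemma one_le_volConst : 1 ≤ volConst := by have := cellVol_pos; unfold volConst; linarith

lemma cellVol_le_volConst_sq : cellVol ≤ volConst ^ 2 := by
  have := cellVol_pos; unfold volConst; nlinarith

namespace YBound

lemma norm_le {k : ℕ} {f : Plane → G} {B : ℝ} (h : YBound k f B) (x : Plane) : ‖f x‖ ≤ B := by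
  cases k with
  | zero => exact h.1 x
  | succ k => exact h.1 x

lemma nonneg {k : ℕ} {f : Plane → G} {B : ℝ} (h : YBound k f B) : 0 ≤ B :=
  (norm_nonneg _).trans (h.norm_le 0)

lemma mono {k : ℕ} {f : Plane → G} {A B : ℝ} (h : YBound k f A) (hAB : A ≤ B) : YBound k f B := by
  induction k generalizing G with
  | zero => exact ⟨fun x => (h.1 x).trans hAB, h.2.trans (pow_le_pow_left₀ h.nonneg hAB 2)⟩
  | succ k ih => exact ⟨fun x => (h.1 x).trans hAB, ih h.2⟩

/-- The only loss is at the top order, where a sup bound becomes an `L²` bound on a cell of finite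
volume. -/
lemma of_succ {k : ℕ} {f : Plane → G} {B : ℝ} (hf : SmoothPer f) (h : YBound (k + 1) f B) :
    YBound k f (volConst * B) := by
  have hB := h.nonneg
  have hle : B ≤ volConst * B := le_mul_of_one_le_left hB one_le_volConst
  induction k generalizing G with
  | zero =>
    refine ⟨fun x => (h.1 x).trans hle, ?_⟩
    refine (setIntegral_sq_le_of_le hf.fderiv h.2.norm_le).trans ?_
    rw [mul_pow]
    exact mul_le_mul_of_nonneg_right cellVol_le_volConst_sq (sq_nonneg _)
  | succ k ih => exact ⟨fun x => (h.1 x).trans hle, ih hf.fderiv h.2⟩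

lemma const (k : ℕ) (c : G) : YBound k (fun _ : Plane => c) ‖c‖ := by
  induction k generalizing G with
  | zero =>
    refine ⟨fun _ => le_rfl, ?_⟩
    simp
  | succ k ih =>
    refine ⟨fun _ => le_rfl, ?_⟩
    have : (fderiv ℝ fun _ : Plane => c) = fun _ => (0 : Plane →L[ℝ] G) := by ext; simp
    rw [this]
    exact (ih (0 : Plane →L[ℝ] G)).mono (by simp)

/-- The derivative of `L ∘ f` is a fixed linear map of norm at most `c` applied to the derivative of
`f`, so the induction runs over varying target spaces with the same constant. -/
lemma clm {k : ℕ} {f : Plane → G} {B : ℝ} (hf : SmoothPer f) (h : YBound k f B) (L : G →L[ℝ] H)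
    {c : ℝ} (hL : ‖L‖ ≤ c) : YBound k (fun x => L (f x)) (c * B) := by
  have hc : 0 ≤ c := (norm_nonneg _).trans hL
  have hd : fderiv ℝ (fun x => L (f x))
      = fun x => ContinuousLinearMap.compL ℝ Plane G H L (fderiv ℝ f x) := by
    ext1 x
    exact (L.hasFDerivAt.comp x (hf.differentiable x).hasFDerivAt).fderiv
  have hs : ∀ x, ‖L (f x)‖ ≤ c * B := fun x =>
    (L.le_opNorm _).trans (mul_le_mul hL (h.norm_le x) (norm_nonneg _) hc)
  have hL' : ‖ContinuousLinearMap.compL ℝ Plane G H L‖ ≤ c := by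
    refine ContinuousLinearMap.opNorm_le_bound _ hc fun T => ?_
    exact (ContinuousLinearMap.opNorm_comp_le _ _).trans
      (mul_le_mul_of_nonneg_right hL (norm_nonneg _))
  induction k generalizing G H with
  | zero =>
    refine ⟨hs, ?_⟩
    rw [hd]
    have h1 := setIntegral_sq_le_of_le_add (A := c) (B := 0)
      (hf.fderiv.clm (ContinuousLinearMap.compL ℝ Plane G H L)) hf.fderiv hf.fderiv (fun x => by
        rw [zero_mul, add_zero]
        exact (ContinuousLinearMap.le_opNorm _ _).trans
          (mul_le_mul_of_nonneg_right hL' (norm_nonneg _)))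
    have h2 : ∫ x in cell, ‖ContinuousLinearMap.compL ℝ Plane G H L (fderiv ℝ f x)‖ ^ 2
        ≤ ∫ x in cell, c ^ 2 * ‖fderiv ℝ f x‖ ^ 2 := by
      refine integral_mono (hf.fderiv.clm _).integrable_norm_sq
        (hf.fderiv.integrable_norm_sq.const_mul _) fun x => ?_
      simp only
      rw [← mul_pow]
      exact pow_le_pow_left₀ (norm_nonneg _) ((ContinuousLinearMap.le_opNorm _ _).trans
          (mul_le_mul_of_nonneg_right hL' (norm_nonneg _))) 2
    refine h2.trans ?_
    rw [integral_const_mul, mul_pow]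
    exact mul_le_mul_of_nonneg_left h.2 (sq_nonneg c)
  | succ k ih =>
    refine ⟨hs, ?_⟩
    rw [hd]
    refine ih hf.fderiv h.2 _ hL' ?_ ?_ ?_
    · ext1 x
      exact ((ContinuousLinearMap.compL ℝ Plane G H L).hasFDerivAt.comp x
        (hf.fderiv.differentiable x).hasFDerivAt).fderiv
    · exact fun x => (ContinuousLinearMap.le_opNorm _ _).trans
        (mul_le_mul hL' (h.2.norm_le x) (norm_nonneg _) hc)
    · refine ContinuousLinearMap.opNorm_le_bound _ hc fun T => ?_
      exact (ContinuousLinearMap.opNorm_comp_le _ _).trans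
        (mul_le_mul_of_nonneg_right hL' (norm_nonneg _))

lemma add {k : ℕ} {f g : Plane → G} {A B : ℝ} (hf : SmoothPer f) (hg : SmoothPer g)
    (h : YBound k f A) (h' : YBound k g B) : YBound k (fun x => f x + g x) (2 * (A + B)) := by
  have hA := h.nonneg
  have hB := h'.nonneg
  have hd : fderiv ℝ (fun x => f x + g x) = fun x => fderiv ℝ f x + fderiv ℝ g x := by
    ext1 x; exact fderiv_fun_add (hf.differentiable x) (hg.differentiable x)
  have hs : ∀ x, ‖f x + g x‖ ≤ 2 * (A + B) := fun x => by
    have := norm_add_le (f x) (g x)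
    linarith [h.norm_le x, h'.norm_le x]
  induction k generalizing G with
  | zero =>
    refine ⟨hs, ?_⟩
    rw [hd]
    have h1 := setIntegral_sq_le_of_le_add (A := 1) (B := 1) (hf.fderiv.add hg.fderiv) hf.fderiv
      hg.fderiv (fun x => by rw [one_mul, one_mul]; exact norm_add_le _ _)
    nlinarith [h.2, h'.2]
  | succ k ih =>
    refine ⟨hs, ?_⟩
    rw [hd]
    refine ih hf.fderiv hg.fderiv h.2 h'.2 ?_ ?_
    · ext1 x; exact fderiv_fun_add (hf.fderiv.differentiable x) (hg.fderiv.differentiable x)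
    · intro x
      have := norm_add_le (fderiv ℝ f x) (fderiv ℝ g x)
      linarith [h.2.norm_le x, h'.2.norm_le x]

/-- The constant of the product estimate. -/
def mulConst (k : ℕ) : ℝ := 2 * (4 * volConst) ^ k

lemma mulConst_nonneg (k : ℕ) : 0 ≤ mulConst k := by
  have := one_le_volConst; unfold mulConst; positivity

lemma one_le_mulConst (k : ℕ) : 1 ≤ mulConst k := by
  have := one_le_volConst
  have : 1 ≤ (4 * volConst) ^ k := one_le_pow₀ (by linarith)
  unfold mulConst; linarith

/-- The Leibniz rule writes the derivative as two bilinear terms with norms still at most `c`. At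
level zero one factor is in sup norm while the differentiated one is in `L²`, so no interpolation
inequality is needed. Each further level costs `volConst` for lowering the undifferentiated factor
and `4` for the sum: `2` from `add` and two equal terms. -/
lemma bilin {k : ℕ} {f : Plane → G} {g : Plane → H} {A B : ℝ} (hf : SmoothPer f)
    (hg : SmoothPer g) (h : YBound k f A) (h' : YBound k g B) (L : G →L[ℝ] H →L[ℝ] W) {c : ℝ}
    (hL : ‖L‖ ≤ c) : YBound k (fun x => L (f x) (g x)) (mulConst k * (c * A * B)) := by
  have hc : 0 ≤ c := le_trans (norm_nonneg L) hL
  induction k generalizing G H W A B with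
  | zero =>
    have hA := h.nonneg
    have hB := h'.nonneg
    have hLe : ∀ a b, ‖L a b‖ ≤ c * ‖a‖ * ‖b‖ := fun a b => (L.le_opNorm₂ a b).trans (by gcongr)
    refine ⟨fun x => ?_, ?_⟩
    · refine (hLe _ _).trans ?_
      have h1 : c * ‖f x‖ * ‖g x‖ ≤ c * A * B := by
        have := h.1 x; have := h'.1 x; gcongr
      exact h1.trans (le_mul_of_one_le_left (by positivity) (one_le_mulConst 0))
    · have h1 := setIntegral_sq_le_of_le_add (A := c * A) (B := c * B) (hf.bilin hg L).fderiv
        hg.fderiv hf.fderiv (fun x => by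
          rw [((L.hasFDerivAt_of_bilinear (hf.differentiable x).hasFDerivAt
            (hg.differentiable x).hasFDerivAt)).fderiv]
          refine (norm_add_le _ _).trans (add_le_add ?_ ?_)
          · refine ContinuousLinearMap.opNorm_le_bound _ (by positivity) fun v => ?_
            refine (hLe _ _).trans ?_
            rw [mul_assoc]
            have := h.1 x
            have := (fderiv ℝ g x).le_opNorm v
            calc c * (‖f x‖ * ‖(fderiv ℝ g x) v‖) ≤ c * (A * (‖fderiv ℝ g x‖ * ‖v‖)) := by gcongr
              _ = _ := by ring
          · refine ContinuousLinearMap.opNorm_le_bound _ (by positivity) fun v => ?_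
            refine (hLe _ _).trans ?_
            have := h'.1 x
            have := (fderiv ℝ f x).le_opNorm v
            calc c * ‖(fderiv ℝ f x) v‖ * ‖g x‖ ≤ c * (‖fderiv ℝ f x‖ * ‖v‖) * B := by gcongr
              _ = _ := by ring)
      have e : mulConst 0 = 2 := by simp [mulConst]
      rw [e]
      have h2 : (c * A) ^ 2 * (∫ x in cell, ‖fderiv ℝ g x‖ ^ 2) ≤ (c * A) ^ 2 * B ^ 2 :=
        mul_le_mul_of_nonneg_left h'.2 (sq_nonneg _)
      have h3 : (c * B) ^ 2 * (∫ x in cell, ‖fderiv ℝ f x‖ ^ 2) ≤ (c * B) ^ 2 * A ^ 2 :=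
        mul_le_mul_of_nonneg_left h.2 (sq_nonneg _)
      nlinarith
  | succ k ih =>
    have hA := h.nonneg
    have hB := h'.nonneg
    refine ⟨fun x => ?_, ?_⟩
    · have h1 : ‖L (f x) (g x)‖ ≤ c * A * B := by
        refine (L.le_opNorm₂ _ _).trans ?_
        have := h.1 x; have := h'.1 x; gcongr
      exact h1.trans (le_mul_of_one_le_left (by positivity) (one_le_mulConst _))
    · have hd : fderiv ℝ (fun x => L (f x) (g x)) = fun x =>
          L.precompR Plane (f x) (fderiv ℝ g x) + L.precompL Plane (fderiv ℝ f x) (g x) := by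
        ext1 x
        exact (L.hasFDerivAt_of_bilinear (hf.differentiable x).hasFDerivAt
            (hg.differentiable x).hasFDerivAt).fderiv
      rw [hd]
      have i1 := ih hf hg.fderiv (h.of_succ hf) h'.2 (L.precompR Plane)
        ((L.norm_precompR_le Plane).trans hL)
      have i2 := ih hf.fderiv hg h.2 (h'.of_succ hg) (L.precompL Plane)
        ((L.norm_precompL_le Plane).trans hL)
      refine (i1.add (hf.bilin hg.fderiv _) (hf.fderiv.bilin hg _) i2).mono (le_of_eq ?_)
      simp only [mulConst]
      ring

end YBound

/-! ### Composition with smooth functions -/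

/-- By periodicity it suffices to bound a continuous function on the compact product of the closed
cell and a ball. -/
lemma exists_bound_of_periodic {E X : Type} [NormedAddCommGroup E] [NormedSpace ℝ E]
    [FiniteDimensional ℝ E] [NormedAddCommGroup X] {F : Plane × E → X} (hF : Continuous F)
    (hper : ∀ e, LatPeriodic fun x => F (x, e)) (A : ℝ) :
    ∃ C, 0 ≤ C ∧ ∀ x e, ‖e‖ ≤ A → ‖F (x, e)‖ ≤ C := by
  have : ProperSpace E := FiniteDimensional.proper ℝ E
  have hK : IsCompact (closure cell ×ˢ Metric.closedBall (0 : E) A) :=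
    isBounded_cell.isCompact_closure.prod (isCompact_closedBall _ _)
  obtain ⟨C, hC⟩ := hK.exists_bound_of_continuousOn hF.continuousOn
  refine ⟨max C 0, le_max_right _ _, fun x e he => ?_⟩
  obtain ⟨g, hg⟩ := exists_vadd_mem_cell x
  have e1 : F (x, e) = F (g +ᵥ x, e) := ((hper e).vadd g x).symm
  rw [e1]
  exact (hC _ ⟨subset_closure hg, by simpa using he⟩).trans (le_max_left _ _)

lemma smoothPer_comp {E : Type} [NormedAddCommGroup E] [NormedSpace ℝ E]
    {F : Plane × E → G} (hF : ContDiff ℝ ∞ F) (hper : ∀ e, LatPeriodic fun x => F (x, e))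
    {u : Plane → E} (hu : SmoothPer u) : SmoothPer (fun x => F (x, u x)) :=
  ⟨hF.comp (contDiff_id.prodMk hu.smooth),
    fun x => by simp only [hu.per.1]; exact (hper _).1 x,
    fun x => by simp only [hu.per.2]; exact (hper _).2 x⟩

lemma latPeriodic_fderiv_prod {E : Type} [NormedAddCommGroup E] [NormedSpace ℝ E]
    {F : Plane × E → G} (hper : ∀ e, LatPeriodic fun x => F (x, e)) (e : E) :
    LatPeriodic fun x => fderiv ℝ F (x, e) := by
  have key : ∀ v : Plane, (∀ e x, F (x + v, e) = F (x, e)) → ∀ x,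
      fderiv ℝ F (x + v, e) = fderiv ℝ F (x, e) := by
    intro v hv x
    have h1 : (x + v, e) = (x, e) + (v, (0 : E)) := by simp
    rw [h1, ← fderiv_comp_add_right]
    congr 1
    ext ⟨y, e'⟩
    simpa using hv e' y
  exact ⟨key _ fun e x => (hper e).1 x, key _ fun e x => (hper e).2 x⟩

/-- The derivative of the graph map of `u`. -/
def graphDeriv {E : Type} [NormedAddCommGroup E] [NormedSpace ℝ E] (u : Plane → E) (x : Plane) :
    Plane →L[ℝ] Plane × E :=
  ContinuousLinearMap.inl ℝ Plane E
    + ContinuousLinearMap.compL ℝ Plane E (Plane × E) (ContinuousLinearMap.inr ℝ Plane E)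
      (fderiv ℝ u x)

lemma norm_compL_inr_le (E : Type) [NormedAddCommGroup E] [NormedSpace ℝ E] :
    ‖ContinuousLinearMap.compL ℝ Plane E (Plane × E) (ContinuousLinearMap.inr ℝ Plane E)‖ ≤ 1 := by
  refine ContinuousLinearMap.opNorm_le_bound _ zero_le_one fun T => ?_
  exact (ContinuousLinearMap.opNorm_comp_le _ _).trans
    (mul_le_mul_of_nonneg_right (ContinuousLinearMap.norm_inr_le_one ℝ Plane E) (norm_nonneg _))

lemma SmoothPer.graphDeriv {E : Type} [NormedAddCommGroup E] [NormedSpace ℝ E] {u : Plane → E}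
    (hu : SmoothPer u) : SmoothPer (graphDeriv u) :=
  (smoothPer_const _).add (hu.fderiv.clm _)

lemma norm_graphDeriv_le {E : Type} [NormedAddCommGroup E] [NormedSpace ℝ E] (u : Plane → E)
    (x : Plane) : ‖graphDeriv u x‖ ≤ 1 + ‖fderiv ℝ u x‖ := by
  refine (norm_add_le _ _).trans (add_le_add (ContinuousLinearMap.norm_inl_le_one ℝ Plane E) ?_)
  refine (ContinuousLinearMap.le_opNorm _ _).trans ?_
  exact mul_le_of_le_one_left (norm_nonneg _) (norm_compL_inr_le E)

lemma fderiv_comp_graph {E : Type} [NormedAddCommGroup E] [NormedSpace ℝ E] {F : Plane × E → G}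
    (hF : ContDiff ℝ ∞ F) {u : Plane → E} (hu : SmoothPer u) :
    fderiv ℝ (fun x => F (x, u x)) = fun x => (fderiv ℝ F (x, u x)).comp (graphDeriv u x) := by
  ext1 x
  have h1 : HasFDerivAt (fun x => (x, u x)) (graphDeriv u x) x := by
    have h2 := (hasFDerivAt_id x).prodMk (hu.differentiable x).hasFDerivAt
    have h3 : (ContinuousLinearMap.id ℝ Plane).prod (fderiv ℝ u x) = graphDeriv u x := by
      ext v <;> simp [HoneycombNLS.graphDeriv]
    rw [h3] at h2
    exact h2
  exact (((hF.differentiable (by simp)) _).hasFDerivAt.comp x h1).fderiv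

/-- Chain rule and induction on `k` over all smooth periodic `F`: the derivative is `DF(x, u)`,
controlled by the induction hypothesis, times the derivative of the graph map, and `bilin` handles
the product. -/
lemma exists_yBound_comp {E : Type} [NormedAddCommGroup E] [NormedSpace ℝ E]
    [FiniteDimensional ℝ E] (k : ℕ) {F : Plane × E → G} (hF : ContDiff ℝ ∞ F)
    (hper : ∀ e, LatPeriodic fun x => F (x, e)) (A : ℝ) :
    ∃ C, 0 ≤ C ∧ ∀ u : Plane → E, SmoothPer u → YBound k u A → YBound k (fun x => F (x, u x)) C := by
  obtain ⟨C₀, hC₀, hb⟩ := exists_bound_of_periodic hF.continuous hper A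
  have hF' : ContDiff ℝ ∞ (fderiv ℝ F) := hF.fderiv_right (m := ∞) (by simp)
  have hper' := fun e => latPeriodic_fderiv_prod hper e
  induction k generalizing G A C₀ with
  | zero =>
    obtain ⟨C₁, hC₁, hb₁⟩ := exists_bound_of_periodic hF'.continuous hper' A
    set C₂ := 2 * C₁ ^ 2 * cellVol + 2 * C₁ ^ 2 * A ^ 2 with hC₂
    have hC₂0 : 0 ≤ C₂ := by have := cellVol_pos; positivity
    -- The `L²` clause compares with the square of the constant; the summand `1` makes that square
    -- dominate `C₂`.
    refine ⟨C₀ + C₂ + 1, by positivity, fun u hu hY => ⟨fun x => (hb x _ (hY.norm_le x)).trans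
      (by linarith), ?_⟩⟩
    have h1 := setIntegral_sq_le_of_le_add (A := C₁) (B := C₁) (smoothPer_comp hF hper hu).fderiv
      (smoothPer_const (1 : ℝ)) hu.fderiv (fun x => by
        rw [fderiv_comp_graph hF hu]
        refine (ContinuousLinearMap.opNorm_comp_le _ _).trans ?_
        rw [norm_one, ← mul_add]
        exact mul_le_mul (hb₁ x _ (hY.norm_le x)) (norm_graphDeriv_le u x) (norm_nonneg _) hC₁)
    have h2 : ∫ x in cell, ‖(1 : ℝ)‖ ^ 2 = cellVol := by simp [cellVol]
    rw [h2] at h1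
    have h3 : 2 * C₁ ^ 2 * (∫ x in cell, ‖fderiv ℝ u x‖ ^ 2) ≤ 2 * C₁ ^ 2 * A ^ 2 :=
      mul_le_mul_of_nonneg_left hY.2 (by positivity)
    nlinarith
  | succ k ih =>
    -- The enlarged radius `volConst * A` is the bound for `u` after `of_succ` lowers it to level
    -- `k`.
    obtain ⟨C₁, hC₁, hb₁⟩ := exists_bound_of_periodic hF'.continuous hper' (volConst * A)
    obtain ⟨C₂, hC₂, h₂⟩ := ih hF' hper' (volConst * A) C₁ hC₁ hb₁
      (hF'.fderiv_right (m := ∞) (by simp)) (fun e => latPeriodic_fderiv_prod hper' e)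
    set C₃ := YBound.mulConst k * (1 * C₂ * (2 * (1 + 1 * A))) with hC₃
    refine ⟨C₀ + |C₃|, by positivity, fun u hu hY => ⟨fun x => ?_, ?_⟩⟩
    · refine (hb x _ (hY.norm_le x)).trans ?_
      linarith [abs_nonneg C₃]
    · rw [fderiv_comp_graph hF hu]
      have y1 := h₂ u hu (hY.of_succ hu)
      have y2 : YBound k (graphDeriv u) (2 * (1 + 1 * A)) :=
        ((YBound.const k (ContinuousLinearMap.inl ℝ Plane E)).mono
          (ContinuousLinearMap.norm_inl_le_one ℝ Plane E)).add (smoothPer_const _)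
            (hu.fderiv.clm _) (hY.2.clm hu.fderiv _ (norm_compL_inr_le E))
      exact (YBound.bilin (smoothPer_comp hF' hper' hu) hu.graphDeriv y1 y2
        (ContinuousLinearMap.compL ℝ Plane (Plane × E) G)
        (ContinuousLinearMap.norm_compL_le ℝ Plane (Plane × E) G)).mono
          ((le_abs_self C₃).trans (by linarith))

/-! ### Comparison with the Fourier side -/

/-- The partial derivative of a complex function. -/
def dpart (i : Fin 2) (f : Plane → ℂ) (x : Plane) : ℂ := fderiv ℝ f x (EuclideanSpace.single i 1)

lemma SmoothPer.pd {f : Plane → ℂ} (hf : SmoothPer f) (i : Fin 2) : SmoothPer (dpart i f) :=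
  hf.fderiv.clm (ContinuousLinearMap.apply ℝ ℂ (EuclideanSpace.single i 1))

lemma SmoothPer.fc_pd {f : Plane → ℂ} (hf : SmoothPer f) (i : Fin 2) (k : ℤ × ℤ) :
    fc (dpart i f) k = Complex.I * xi k i * fc f k := by
  have key : ∀ m n, ((partialDeriv 0)^[m] ∘ (partialDeriv 1)^[n] = partialDeriv i) → m + n = 1 →
      IsWeakDeriv m n f (dpart i f) := by
    intro m n h h1 η hη hc
    have e : (partialDeriv 0)^[m] ((partialDeriv 1)^[n] η) = partialDeriv i η := congrFun h η
    rw [e, integral_partialDeriv_smul hη hc hf.smooth, h1]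
    simp [dpart]
  fin_cases i
  · have := (key 1 0 rfl rfl).fc_eq hf.memL2 (hf.pd 0).memL2 k
    simpa [symb] using this
  · have := (key 0 1 rfl rfl).fc_eq hf.memL2 (hf.pd 1).memL2 k
    simpa [symb] using this

/-- As `wt = 1 + ξ₀² + ξ₁²`, the squared norm of order `s + 1` is the sum of those of order `s` of
`f` and its two partial derivatives, and `3 A² ≤ (2 A)²`. -/
lemma SobBound.succ_of_pd {s : ℕ} {f : Plane → ℂ} {A : ℝ} (hf : SmoothPer f) (h : SobBound s f A)
    (h' : ∀ i, SobBound s (dpart i f) A) : SobBound (s + 1) f (2 * A) := by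
  refine ⟨h.memL2, by linarith [h.nonneg], fun S => ?_⟩
  have e : ∀ k, wt k ^ (s + 1) * ‖fc f k‖ ^ 2 = wt k ^ s * ‖fc f k‖ ^ 2
      + wt k ^ s * ‖fc (dpart 0 f) k‖ ^ 2 + wt k ^ s * ‖fc (dpart 1 f) k‖ ^ 2 := by
    intro k
    have hp : ∀ i, ‖fc (dpart i f) k‖ ^ 2 = xi k i ^ 2 * ‖fc f k‖ ^ 2 := by
      intro i
      rw [hf.fc_pd]
      simp [mul_pow]
    rw [hp, hp, pow_succ, wt]
    ring
  simp only [e, Finset.sum_add_distrib]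
  nlinarith [h.sum_le S, (h' 0).sum_le S, (h' 1).sum_le S, sq_nonneg A]

lemma norm_apply_single_le (i : Fin 2) : ‖ContinuousLinearMap.apply ℝ ℂ
    (EuclideanSpace.single i 1 : Plane)‖ ≤ 1 := by
  refine ContinuousLinearMap.opNorm_le_bound _ zero_le_one fun T => ?_
  rw [one_mul, ContinuousLinearMap.apply_apply]
  refine (T.le_opNorm _).trans ?_
  simp

lemma sobBound_zero_of_sq_le {f : Plane → ℂ} (hf : MemL2 f) {B : ℝ} (hB : 0 ≤ B)
    (h : ∫ x in cell, ‖f x‖ ^ 2 ≤ B ^ 2) : SobBound 0 f B :=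
  hf.sobBound.mono (Real.sqrt_le_iff.2 ⟨hB, h⟩)

lemma SmoothPer.sobBound_of_norm_le {f : Plane → ℂ} (hf : SmoothPer f) {B : ℝ} (hB : 0 ≤ B)
    (h : ∀ x, ‖f x‖ ≤ B) : SobBound 0 f (volConst * B) := by
  refine sobBound_zero_of_sq_le hf.memL2 (mul_nonneg (by linarith [one_le_volConst]) hB) ?_
  refine (setIntegral_sq_le_of_le hf h).trans ?_
  rw [mul_pow]
  exact mul_le_mul_of_nonneg_right cellVol_le_volConst_sq (sq_nonneg _)

lemma YBound.sobBound {k : ℕ} {f : Plane → ℂ} {B : ℝ} (hf : SmoothPer f) (h : YBound k f B) :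
    SobBound (k + 1) f ((2 * volConst) ^ (k + 1) * B) := by
  have hB := h.nonneg
  have hv := one_le_volConst
  induction k generalizing f B with
  | zero =>
    have h0 := hf.sobBound_of_norm_le hB h.norm_le
    refine (SobBound.succ_of_pd hf h0 fun i => ?_).mono (by simp; linarith)
    refine (sobBound_zero_of_sq_le (hf.pd i).memL2 hB (le_trans ?_ h.2)).mono
      (le_mul_of_one_le_left hB hv)
    refine integral_mono (hf.pd i).integrable_norm_sq hf.fderiv.integrable_norm_sq fun x => ?_
    refine pow_le_pow_left₀ (norm_nonneg _) ?_ 2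
    have := (ContinuousLinearMap.apply ℝ ℂ (EuclideanSpace.single i 1 : Plane)).le_of_opNorm_le
      (norm_apply_single_le i) (fderiv ℝ f x)
    simpa [dpart] using this
  | succ k ih =>
    have h0 := ih hf (h.of_succ hf) (mul_nonneg (by linarith) hB)
    refine (SobBound.succ_of_pd hf h0 fun i => ?_).mono (le_of_eq (by ring))
    have h1 := ih (hf.pd i) (h.2.clm hf.fderiv _ (norm_apply_single_le i)) (by linarith)
    refine h1.mono ?_
    rw [one_mul]
    exact mul_le_mul_of_nonneg_left (le_mul_of_one_le_left hB hv) (by positivity)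

lemma SobBound.pd {s : ℕ} {f : Plane → ℂ} {A : ℝ} (hf : SmoothPer f) (h : SobBound (s + 1) f A)
    (i : Fin 2) : SobBound s (dpart i f) A := by
  refine ⟨(hf.pd i).memL2, h.nonneg, fun S => (Finset.sum_le_sum fun k _ => ?_).trans (h.sum_le S)⟩
  rw [hf.fc_pd, pow_succ (wt k), mul_assoc (wt k ^ s)]
  refine mul_le_mul_of_nonneg_left ?_ (pow_nonneg (wt_pos k).le _)
  rw [norm_mul, mul_pow]
  refine mul_le_mul_of_nonneg_right ?_ (sq_nonneg _)
  have : ‖Complex.I * (xi k i : ℂ)‖ ^ 2 = xi k i ^ 2 := by simp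
  rw [this, wt]
  fin_cases i
  · simp only [Fin.zero_eta]; nlinarith [sq_nonneg (xi k 1)]
  · simp only [Fin.mk_one]; nlinarith [sq_nonneg (xi k 0)]

/-- A continuous function that agrees almost everywhere with its absolutely convergent Fourier
series equals it everywhere, so the sup bound holds at every point. -/
lemma SobBound.norm_le {f : Plane → ℂ} {A : ℝ} (hf : Continuous f) (h : SobBound 2 f A)
    (x : Plane) : ‖f x‖ ≤ supConst * A := by
  have hs := h.summable_norm_fc
  have ha : Summable fun k => ‖cellNorm * fc f k‖ := by
    simp only [norm_mul]; exact hs.mul_left _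
  have he : f = fun x => ∑' k, cellNorm * fc f k * mode k x :=
    (hf.ae_eq_iff_eq volume (continuous_tsum_mode ha)).1 (ae_eq_tsum_mode h.memL2 hs)
  rw [he]
  refine le_trans (tsum_of_norm_bounded (hs.mul_left cellNorm).hasSum fun k => ?_)
    (by rw [tsum_mul_left]; exact h.tsum_norm_fc_le)
  simp [norm_mode, abs_of_pos cellNorm_pos]

/-- The linear map reconstructing a differential from a partial derivative. -/
def coordMap (i : Fin 2) : ℂ →L[ℝ] Plane →L[ℝ] ℂ :=
  ContinuousLinearMap.smulRightL ℝ Plane ℂ (EuclideanSpace.proj i)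

lemma norm_coordMap_le (i : Fin 2) : ‖coordMap i‖ ≤ 1 := by
  refine ContinuousLinearMap.opNorm_le_bound _ zero_le_one fun c => ?_
  refine ContinuousLinearMap.opNorm_le_bound _ (by positivity) fun v => ?_
  have : ‖v i‖ ≤ ‖v‖ := PiLp.norm_apply_le v i
  have e : coordMap i c v = v i • c := rfl
  rw [e, norm_smul, one_mul, mul_comm]
  exact mul_le_mul_of_nonneg_left this (norm_nonneg _)

lemma fderiv_eq_coordMap (f : Plane → ℂ) (x : Plane) :
    fderiv ℝ f x = coordMap 0 (dpart 0 f x) + coordMap 1 (dpart 1 f x) := by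
  ext v
  have hv : v = v 0 • EuclideanSpace.single 0 (1 : ℝ) + v 1 • EuclideanSpace.single 1 (1 : ℝ) := by
    apply plane_ext <;> simp
  conv_lhs => rw [hv]
  simp [coordMap, dpart]

/-- The constant of the estimate of `YBound k` by `H^{k+2}`. -/
def embConst (k : ℕ) : ℝ := 4 ^ k * (supConst + 2)

lemma embConst_nonneg (k : ℕ) : 0 ≤ embConst k := by
  have := supConst_nonneg; unfold embConst; positivity

/-- In dimension two `H²` embeds into the bounded functions; apply this to all derivatives of order
at most `k`, and Parseval to those of order `k + 1`. With `YBound.sobBound`, passing through `YBound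
k` loses exactly one Sobolev order. -/
lemma SobBound.yBound {k : ℕ} {f : Plane → ℂ} {A : ℝ} (hf : SmoothPer f)
    (h : SobBound (k + 2) f A) : YBound k f (embConst k * A) := by
  have hs := supConst_nonneg
  have hA := h.nonneg
  have hsup : ∀ x, ‖f x‖ ≤ embConst k * A := by
    intro x
    refine ((h.mono_order (by omega)).norm_le hf.smooth.continuous x).trans ?_
    refine mul_le_mul_of_nonneg_right ?_ hA
    have : (1 : ℝ) ≤ 4 ^ k := one_le_pow₀ (by norm_num)
    unfold embConst; nlinarith
  induction k generalizing f with
  | zero =>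
    refine ⟨hsup, ?_⟩
    have h1 := setIntegral_sq_le_of_le_add (A := 1) (B := 1) hf.fderiv (hf.pd 0) (hf.pd 1)
      (fun x => by
        rw [fderiv_eq_coordMap]
        exact (norm_add_le _ _).trans (add_le_add ((coordMap 0).le_of_opNorm_le
          (norm_coordMap_le 0) _) ((coordMap 1).le_of_opNorm_le (norm_coordMap_le 1) _)))
    have h2 := ((h.pd hf 0).mono_order (Nat.zero_le _)).setIntegral_le
    have h3 := ((h.pd hf 1).mono_order (Nat.zero_le _)).setIntegral_le
    have e : embConst 0 = supConst + 2 := by simp [embConst]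
    rw [e]
    nlinarith [mul_nonneg hs (sq_nonneg A), sq_nonneg (supConst * A)]
  | succ k ih =>
    refine ⟨hsup, ?_⟩
    have key : ∀ i, YBound k (fun x => coordMap i (dpart i f x)) (1 * (embConst k * A)) := by
      intro i
      refine (ih (hf.pd i) (h.pd hf i) fun x => ?_).clm (hf.pd i) _ (norm_coordMap_le i)
      refine (((h.pd hf i).mono_order (by omega)).norm_le (hf.pd i).smooth.continuous x).trans ?_
      refine mul_le_mul_of_nonneg_right ?_ hA
      have : (1 : ℝ) ≤ 4 ^ k := one_le_pow₀ (by norm_num)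
      unfold embConst; nlinarith
    have e : fderiv ℝ f = fun x => coordMap 0 (dpart 0 f x)
        + coordMap 1 (dpart 1 f x) := by
      ext1 x; exact fderiv_eq_coordMap f x
    rw [e]
    refine ((key 0).add ((hf.pd 0).clm _) ((hf.pd 1).clm _) (key 1)).mono (le_of_eq ?_)
    unfold embConst; ring

/-! ### Trigonometric approximation and nonlinear estimates -/

/-- The partial sum of the Fourier series over a finite set of frequencies. -/
def trigSum (f : Plane → ℂ) (S : Finset (ℤ × ℤ)) (x : Plane) : ℂ :=
  ∑ k ∈ S, cellNorm * fc f k * mode k x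

lemma smoothPer_trigSum (f : Plane → ℂ) (S : Finset (ℤ × ℤ)) : SmoothPer (trigSum f S) := by
  refine ⟨?_, fun x => ?_, fun x => ?_⟩
  · exact ContDiff.sum fun k _ => contDiff_const.mul (contDiff_mode k)
  · simp only [trigSum, (latPeriodic_mode _).1]
  · simp only [trigSum, (latPeriodic_mode _).2]

lemma fc_trigSum (f : Plane → ℂ) (S : Finset (ℤ × ℤ)) (l : ℤ × ℤ) :
    fc (trigSum f S) l = if l ∈ S then fc f l else 0 := by
  classical
  set a : ℤ × ℤ → ℂ := fun k => if k ∈ S then cellNorm * fc f k else 0 with ha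
  have hs : Summable fun k => ‖a k‖ :=
    summable_of_ne_finset_zero (s := S) fun k hk => by simp [ha, hk]
  have e : trigSum f S = fun x => ∑' k, a k * mode k x := by
    ext x
    rw [tsum_eq_sum (s := S) fun k hk => by simp [ha, hk], trigSum]
    exact Finset.sum_congr rfl fun k hk => by simp [ha, hk]
  rw [e, fc_tsum_mode hs]
  have : (cellNorm : ℂ) ^ 2 * cellVol = 1 := by exact_mod_cast cellNorm_sq
  simp only [ha]
  split_ifs
  · linear_combination fc f l * this
  · simp

lemma SobBound.trigSum {s : ℕ} {f : Plane → ℂ} {A : ℝ} (h : SobBound s f A)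
    (S : Finset (ℤ × ℤ)) : SobBound s (trigSum f S) A := by
  refine ⟨(smoothPer_trigSum f S).memL2, h.nonneg, fun T => le_trans ?_ (h.sum_le T)⟩
  refine Finset.sum_le_sum fun k _ => ?_
  rw [fc_trigSum]
  split_ifs
  · exact le_rfl
  · have := pow_nonneg (wt_pos k).le s
    simpa using mul_nonneg this (sq_nonneg _)

lemma SobBound.tendsto_trigSum {f : Plane → ℂ} {A : ℝ} (h : SobBound 2 f A) :
    ∀ᵐ x, Filter.Tendsto (fun S => HoneycombNLS.trigSum f S x) Filter.atTop (nhds (f x)) := by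
  filter_upwards [ae_eq_tsum_mode h.memL2 h.summable_norm_fc] with x hx
  rw [hx]
  refine Summable.hasSum (Summable.of_norm ?_)
  simp only [norm_mul, norm_mode, mul_one]
  exact h.summable_norm_fc.mul_left _

/-- The space of parameters of the nonlinearity: two function values and an amplitude. -/
abbrev Par : Type := ℂ × ℂ × ℝ

lemma SmoothPer.triple {u₁ u₂ : Plane → ℂ} (h₁ : SmoothPer u₁) (h₂ : SmoothPer u₂) (ε : ℝ) :
    SmoothPer (fun x => ((u₁ x, u₂ x, ε) : Par)) :=
  ⟨h₁.smooth.prodMk (h₂.smooth.prodMk contDiff_const),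
    fun x => by simp only [h₁.per.1, h₂.per.1], fun x => by simp only [h₁.per.2, h₂.per.2]⟩

lemma YBound.triple {k : ℕ} {u₁ u₂ : Plane → ℂ} (h₁ : SmoothPer u₁) (h₂ : SmoothPer u₂) {ε A : ℝ}
    (y₁ : YBound k u₁ A) (y₂ : YBound k u₂ A) (hε : |ε| ≤ A) :
    YBound k (fun x => ((u₁ x, u₂ x, ε) : Par)) (10 * A) := by
  have z₁ := y₁.clm h₁ _ (ContinuousLinearMap.norm_inl_le_one ℝ ℂ (ℂ × ℝ))
  have z₂ := (y₂.clm h₂ _ (ContinuousLinearMap.norm_inl_le_one ℝ ℂ ℝ)).clm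
    (h₂.clm _) _ (ContinuousLinearMap.norm_inr_le_one ℝ ℂ (ℂ × ℝ))
  have z₃ := (YBound.const k ((0, 0, ε) : Par)).mono (B := A) (by simpa [Prod.norm_def] using hε)
  have := z₁.add (h₁.clm _) (((h₂.clm _).clm _).add (smoothPer_const _))
    (z₂.add ((h₂.clm _).clm _) (smoothPer_const _) z₃)
  have e : (fun x => ((u₁ x, u₂ x, ε) : Par)) = fun x =>
      ContinuousLinearMap.inl ℝ ℂ (ℂ × ℝ) (u₁ x) + (ContinuousLinearMap.inr ℝ ℂ (ℂ × ℝ)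
        (ContinuousLinearMap.inl ℝ ℂ ℝ (u₂ x)) + ((0, 0, ε) : Par)) := by
    ext x <;> simp
  rw [e]
  -- Two nested uses of `YBound.add` give `2 * (A + 2 * (A + A)) = 10 * A`.
  exact this.mono (le_of_eq (by ring))

/-- From `H^{k+2}` into `YBound k`, where composition and product are available, and back into
`H^{k+1}`. Keeping `ε` among the arguments of `F` makes the constant uniform in `ε`. -/
lemma exists_sobBound_comp_smooth (k : ℕ) {F : Plane × Par → ℂ →L[ℝ] ℂ} (hF : ContDiff ℝ ∞ F)
    (hper : ∀ e, LatPeriodic fun x => F (x, e)) (A : ℝ) :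
    ∃ C, 0 ≤ C ∧ ∀ (u₁ u₂ v : Plane → ℂ) (ε B : ℝ), SmoothPer u₁ → SmoothPer u₂ → SmoothPer v →
      SobBound (k + 2) u₁ A → SobBound (k + 2) u₂ A → |ε| ≤ A → SobBound (k + 2) v B →
      SobBound (k + 1) (fun x => F (x, u₁ x, u₂ x, ε) (v x)) (C * B) := by
  have he := embConst_nonneg k
  have hv := one_le_volConst
  obtain ⟨C, hC, h⟩ := exists_yBound_comp k hF hper (10 * ((embConst k + 1) * A))
  have hm := YBound.mulConst_nonneg k
  refine ⟨(2 * volConst) ^ (k + 1) * (YBound.mulConst k * (1 * C * embConst k)), by positivity,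
    fun u₁ u₂ v ε B s₁ s₂ s₃ h₁ h₂ hε h₃ => ?_⟩
  have hA := h₁.nonneg
  have y₁ := (h₁.yBound s₁).mono (B := (embConst k + 1) * A) (by linarith)
  have y₂ := (h₂.yBound s₂).mono (B := (embConst k + 1) * A) (by linarith)
  have hu := s₁.triple s₂ ε
  have y := h _ hu (YBound.triple s₁ s₂ y₁ y₂ (by nlinarith))
  have z := YBound.bilin (smoothPer_comp hF hper hu) s₃ y (h₃.yBound s₃)
    (ContinuousLinearMap.id ℝ (ℂ →L[ℝ] ℂ)) ContinuousLinearMap.norm_id_le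
  exact (z.sobBound ((smoothPer_comp hF hper hu).bilin s₃
    (ContinuousLinearMap.id ℝ (ℂ →L[ℝ] ℂ)))).mono (le_of_eq (by ring))

lemma aestronglyMeasurable_comp_apply {F : Plane × Par → ℂ →L[ℝ] ℂ} (hF : Continuous F)
    {u₁ u₂ v : Plane → ℂ} (h₁ : MemL2 u₁) (h₂ : MemL2 u₂) (h₃ : MemL2 v) (ε : ℝ) :
    AEStronglyMeasurable (fun x => F (x, u₁ x, u₂ x, ε) (v x)) (volume.restrict cell) := by
  have hu : AEStronglyMeasurable (fun x => (x, u₁ x, u₂ x, ε)) (volume.restrict cell) :=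
    aestronglyMeasurable_id.prodMk (h₁.2.1.prodMk (h₂.2.1.prodMk aestronglyMeasurable_const))
  have hc : Continuous fun p : (ℂ →L[ℝ] ℂ) × ℂ => p.1 p.2 := continuous_fst.clm_apply continuous_snd
  exact hc.comp_aestronglyMeasurable ((hF.comp_aestronglyMeasurable hu).prodMk h₃.2.1)

lemma latPeriodic_comp_apply {F : Plane × Par → ℂ →L[ℝ] ℂ}
    (hper : ∀ e, LatPeriodic fun x => F (x, e)) {u₁ u₂ v : Plane → ℂ} (h₁ : LatPeriodic u₁)
    (h₂ : LatPeriodic u₂) (h₃ : LatPeriodic v) (ε : ℝ) :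
    LatPeriodic (fun x => F (x, u₁ x, u₂ x, ε) (v x)) :=
  ⟨fun x => by
      simp only [h₁.1, h₂.1, h₃.1]
      exact congrArg (fun T : ℂ →L[ℝ] ℂ => T (v x)) ((hper (u₁ x, u₂ x, ε)).1 x),
    fun x => by
      simp only [h₁.2, h₂.2, h₃.2]
      exact congrArg (fun T : ℂ →L[ℝ] ℂ => T (v x)) ((hper (u₁ x, u₂ x, ε)).2 x)⟩

/-- Smoothness is removed by truncating the Fourier series. Truncations keep their Sobolev bounds
and converge almost everywhere with a uniform sup bound, so dominated convergence gives convergence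
of each Fourier coefficient, and finite weighted sums pass to the limit. -/
lemma exists_sobBound_comp (k : ℕ) {F : Plane × Par → ℂ →L[ℝ] ℂ} (hF : ContDiff ℝ ∞ F)
    (hper : ∀ e, LatPeriodic fun x => F (x, e)) (A : ℝ) :
    ∃ C, 0 ≤ C ∧ ∀ (u₁ u₂ v : Plane → ℂ) (ε B : ℝ),
      SobBound (k + 2) u₁ A → SobBound (k + 2) u₂ A → |ε| ≤ A → SobBound (k + 2) v B →
      SobBound (k + 1) (fun x => F (x, u₁ x, u₂ x, ε) (v x)) (C * B) := by
  obtain ⟨C, hC, h⟩ := exists_sobBound_comp_smooth k hF hper A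
  obtain ⟨D, hD, hb⟩ := exists_bound_of_periodic hF.continuous hper ((supConst + 1) * A)
  refine ⟨C, hC, fun u₁ u₂ v ε B h₁ h₂ hε h₃ => ?_⟩
  have hA := h₁.nonneg
  have hs := supConst_nonneg
  have hB := h₃.nonneg
  have hbd : ∀ x (a b : ℂ), ‖a‖ ≤ supConst * A → ‖b‖ ≤ supConst * A → ‖F (x, a, b, ε)‖ ≤ D := by
    intro x a b ha hb'
    refine hb x _ ?_
    simp only [Prod.norm_def, Real.norm_eq_abs]
    exact max_le (by nlinarith) (max_le (by nlinarith) (by nlinarith))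
  have hm := fun (w₁ w₂ w₃ : Plane → ℂ) (m₁ : MemL2 w₁) (m₂ : MemL2 w₂) (m₃ : MemL2 w₃) =>
    aestronglyMeasurable_comp_apply hF.continuous m₁ m₂ m₃ ε
  have o₁ := h₁.mono_order (r := 2) (by omega)
  have o₂ := h₂.mono_order (r := 2) (by omega)
  have o₃ := h₃.mono_order (r := 2) (by omega)
  have hmem : MemL2 (fun x => F (x, u₁ x, u₂ x, ε) (v x)) := by
    refine memL2_of_bound (latPeriodic_comp_apply hper h₁.memL2.1 h₂.memL2.1 h₃.memL2.1 ε)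
      (hm _ _ _ h₁.memL2 h₂.memL2 h₃.memL2) (B := D * (supConst * B)) ?_
    filter_upwards [ae_restrict_of_ae o₁.ae_norm_le, ae_restrict_of_ae o₂.ae_norm_le,
      ae_restrict_of_ae o₃.ae_norm_le] with x x₁ x₂ x₃
    exact (ContinuousLinearMap.le_opNorm _ _).trans
      (mul_le_mul (hbd x _ _ x₁ x₂) x₃ (norm_nonneg _) hD)
  refine ⟨hmem, mul_nonneg hC hB, fun S => ?_⟩
  set g : Finset (ℤ × ℤ) → Plane → ℂ := fun T x =>
    F (x, trigSum u₁ T x, trigSum u₂ T x, ε) (trigSum v T x) with hg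
  have hg' : ∀ T, SobBound (k + 1) (g T) (C * B) := fun T =>
    h _ _ _ ε B (smoothPer_trigSum u₁ T) (smoothPer_trigSum u₂ T) (smoothPer_trigSum v T)
      (h₁.trigSum T) (h₂.trigSum T) hε (h₃.trigSum T)
  have hlim : ∀ l, Filter.Tendsto (fun T => fc (g T) l) Filter.atTop
      (nhds (fc (fun x => F (x, u₁ x, u₂ x, ε) (v x)) l)) := by
    intro l
    refine Filter.Tendsto.const_mul _ ?_
    refine tendsto_integral_filter_of_dominated_convergence (fun _ => D * (supConst * B))
      (Filter.Eventually.of_forall fun T => ?_) (Filter.Eventually.of_forall fun T => ?_)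
      (integrable_const _) ?_
    · exact (Complex.continuous_conj.comp (continuous_mode l)).aestronglyMeasurable.mul
        (hm _ _ _ (h₁.trigSum T).memL2 (h₂.trigSum T).memL2 (h₃.trigSum T).memL2)
    · refine Filter.Eventually.of_forall fun x => ?_
      rw [norm_mul, RCLike.norm_conj, norm_mode, one_mul]
      exact (ContinuousLinearMap.le_opNorm _ _).trans (mul_le_mul
        (hbd x _ _ ((o₁.trigSum T).norm_le (smoothPer_trigSum _ _).smooth.continuous x)
          ((o₂.trigSum T).norm_le (smoothPer_trigSum _ _).smooth.continuous x))
        ((o₃.trigSum T).norm_le (smoothPer_trigSum _ _).smooth.continuous x) (norm_nonneg _) hD)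
    · filter_upwards [ae_restrict_of_ae o₁.tendsto_trigSum, ae_restrict_of_ae o₂.tendsto_trigSum,
        ae_restrict_of_ae o₃.tendsto_trigSum] with x x₁ x₂ x₃
      refine Filter.Tendsto.const_mul _ ?_
      have hc : Continuous fun p : (ℂ →L[ℝ] ℂ) × ℂ => p.1 p.2 :=
        continuous_fst.clm_apply continuous_snd
      have h4 : Filter.Tendsto (fun T => F (x, trigSum u₁ T x, trigSum u₂ T x, ε)) Filter.atTop
          (nhds (F (x, u₁ x, u₂ x, ε))) :=
        (hF.continuous.tendsto _).comp (tendsto_const_nhds.prodMk_nhds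
          (x₁.prodMk_nhds (x₂.prodMk_nhds tendsto_const_nhds)))
      exact (hc.tendsto (F (x, u₁ x, u₂ x, ε), v x)).comp (h4.prodMk_nhds x₃)
  refine le_of_tendsto' (tendsto_finsetSum S fun l _ => ((hlim l).norm.pow 2).const_mul _)
    fun T => (hg' T).sum_le S

/-! ### Smooth dependence of integrals on parameters -/

lemma hasFDerivAt_parametric_integral {P G : Type} [NormedAddCommGroup P] [NormedSpace ℝ P]
    [FiniteDimensional ℝ P] [NormedAddCommGroup G] [NormedSpace ℝ G] [CompleteSpace G]
    {f : ℝ × P → G} (hf : ContDiff ℝ ∞ f) (p : P) :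
    HasFDerivAt (fun p => ∫ t in (0 : ℝ)..1, f (t, p))
      (∫ t in (0 : ℝ)..1, (fderiv ℝ f (t, p)).comp (ContinuousLinearMap.inr ℝ ℝ P)) p := by
  have : ProperSpace P := FiniteDimensional.proper ℝ P
  have hd : Continuous fun q : ℝ × P => (fderiv ℝ f q).comp (ContinuousLinearMap.inr ℝ ℝ P) :=
    ((hf.fderiv_right (m := ∞) (by simp)).continuous).clm_comp continuous_const
  obtain ⟨C, hC⟩ := (isCompact_Icc.prod (isCompact_closedBall p 1) :
    IsCompact (Icc (0 : ℝ) 1 ×ˢ Metric.closedBall p 1)).exists_bound_of_continuousOn hd.continuousOn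
  refine intervalIntegral.hasFDerivAt_integral_of_dominated_of_fderiv_le (𝕜 := ℝ) (μ := volume)
    (F := fun p t => f (t, p))
    (F' := fun p t => (fderiv ℝ f (t, p)).comp (ContinuousLinearMap.inr ℝ ℝ P)) (bound := fun _ => C) (Metric.ball_mem_nhds p one_pos) ?_ ?_ ?_ ?_ ?_ ?_
  · exact Filter.Eventually.of_forall fun q =>
      (hf.continuous.comp (by fun_prop : Continuous fun t : ℝ => (t, q))).aestronglyMeasurable
  · exact (hf.continuous.comp (by fun_prop : Continuous fun t : ℝ => (t, p))).intervalIntegrable _ _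
  · exact (hd.comp (by fun_prop : Continuous fun t : ℝ => (t, p))).aestronglyMeasurable
  · refine Filter.Eventually.of_forall fun t ht q hq => hC (t, q) ⟨?_, Metric.ball_subset_closedBall hq⟩
    rw [uIoc_of_le zero_le_one] at ht
    exact Ioc_subset_Icc_self ht
  · exact intervalIntegrable_const
  · refine Filter.Eventually.of_forall fun t _ q _ => ?_
    have h1 : HasFDerivAt (fun q : P => (t, q)) (ContinuousLinearMap.inr ℝ ℝ P) q :=
      hasFDerivAt_prodMk_right t q
    exact ((hf.differentiable (by simp)) (t, q)).hasFDerivAt.comp q h1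

/-- The derivative is again a parametric integral of a smooth integrand, so induction on the order
closes, with varying target space. -/
lemma contDiff_parametric_integral {P G : Type} [NormedAddCommGroup P] [NormedSpace ℝ P]
    [FiniteDimensional ℝ P] [NormedAddCommGroup G] [NormedSpace ℝ G] [CompleteSpace G]
    {f : ℝ × P → G} (hf : ContDiff ℝ ∞ f) : ContDiff ℝ ∞ fun p => ∫ t in (0 : ℝ)..1, f (t, p) := by
  rw [contDiff_infty]
  intro n
  induction n generalizing G with
  | zero =>
    refine contDiff_zero.2 (continuous_iff_continuousAt.2 fun p => ?_)
    exact (hasFDerivAt_parametric_integral hf p).continuousAt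
  | succ n ih =>
    refine contDiff_succ_iff_hasFDerivAt.2 ⟨_, ?_, fun p => hasFDerivAt_parametric_integral hf p⟩
    exact ih ((hf.fderiv_right (m := ∞) (by simp)).clm_comp contDiff_const)

/-! ### The structure of the nonlinearity -/

section Nonlinearity

variable {V : Plane → ℝ → ℝ}

/-- The `ρ`-derivative of the potential. -/
def potDeriv (V : Plane → ℝ → ℝ) (p : Plane × ℝ) : ℝ :=
  fderivWithin ℝ (fun p : Plane × ℝ => V p.1 p.2) (univ ×ˢ Ici (0 : ℝ)) p (0, 1)

lemma uniqueDiffOn_halfSpace : UniqueDiffOn ℝ ((univ : Set Plane) ×ˢ Ici (0 : ℝ)) :=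
  uniqueDiffOn_univ.prod (uniqueDiffOn_Ici 0)

lemma contDiffOn_potDeriv
    (hV : ContDiffOn ℝ ∞ (fun p : Plane × ℝ => V p.1 p.2) (univ ×ˢ Ici (0 : ℝ))) :
    ContDiffOn ℝ ∞ (potDeriv V) (univ ×ˢ Ici (0 : ℝ)) :=
  (hV.fderivWithin uniqueDiffOn_halfSpace (m := ∞) (by simp)).clm_apply contDiffOn_const

/-- The path `t ↦ t² ρ` never leaves the half-line, so composition with `V`, smooth only up to the
boundary, has a genuine two-sided derivative for all real `t`. -/
lemma hasDerivAt_pot_sq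
    (hV : ContDiffOn ℝ ∞ (fun p : Plane × ℝ => V p.1 p.2) (univ ×ˢ Ici (0 : ℝ))) (x : Plane)
    {ρ : ℝ} (hρ : 0 ≤ ρ) (t : ℝ) :
    HasDerivAt (fun t => V x (t ^ 2 * ρ)) (2 * t * ρ * potDeriv V (x, t ^ 2 * ρ)) t := by
  have hmem : ∀ t : ℝ, (x, t ^ 2 * ρ) ∈ (univ : Set Plane) ×ˢ Ici (0 : ℝ) :=
    fun t => ⟨mem_univ _, by simp only [mem_Ici]; positivity⟩
  have h1 := ((hV.differentiableOn (by simp)) _ (hmem t)).hasFDerivWithinAt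
  have h2 : HasDerivAt (fun t : ℝ => (x, t ^ 2 * ρ)) ((0 : Plane), 2 * t * ρ) t := by
    refine (hasDerivAt_const t x).prodMk ?_
    simpa using (hasDerivAt_pow 2 t).mul_const ρ
  have h3 := h1.comp_hasDerivWithinAt t (h2.hasDerivWithinAt (s := univ)) fun s _ => hmem s
  rw [hasDerivWithinAt_univ] at h3
  have e : ((0 : Plane), 2 * t * ρ) = (2 * t * ρ) • ((0 : Plane), (1 : ℝ)) := by simp
  rw [e, map_smul, smul_eq_mul] at h3
  exact h3

/-- At fixed `x` this is a one-variable derivative, from which periodicity in `x` can be read off.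
-/
lemma potDeriv_eq_derivWithin
    (hV : ContDiffOn ℝ ∞ (fun p : Plane × ℝ => V p.1 p.2) (univ ×ˢ Ici (0 : ℝ))) (x : Plane)
    {ρ : ℝ} (hρ : 0 ≤ ρ) : potDeriv V (x, ρ) = derivWithin (V x) (Ici 0) ρ := by
  have h1 := ((hV.differentiableOn (by simp)) (x, ρ) ⟨mem_univ _, hρ⟩).hasFDerivWithinAt
  have h2 : HasDerivAt (fun ρ : ℝ => (x, ρ)) ((0 : Plane), (1 : ℝ)) ρ :=
    (hasDerivAt_const ρ x).prodMk (hasDerivAt_id ρ)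
  have h3 := h1.comp_hasDerivWithinAt ρ (h2.hasDerivWithinAt (s := Ici 0))
    fun s hs => ⟨mem_univ _, hs⟩
  exact (h3.derivWithin (uniqueDiffOn_Ici 0 ρ hρ)).symm

lemma latPeriodic_potDeriv
    (hV : ContDiffOn ℝ ∞ (fun p : Plane × ℝ => V p.1 p.2) (univ ×ˢ Ici (0 : ℝ)))
    (hper : ∀ ρ : ℝ, 0 ≤ ρ → LatPeriodic (fun x => V x ρ)) {ρ : ℝ} (hρ : 0 ≤ ρ) :
    LatPeriodic fun x => potDeriv V (x, ρ) := by
  constructor <;> intro x <;> simp only [potDeriv_eq_derivWithin hV _ hρ]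
  · exact derivWithin_congr (fun s hs => (hper s hs).1 x) ((hper ρ hρ).1 x)
  · exact derivWithin_congr (fun s hs => (hper s hs).2 x) ((hper ρ hρ).2 x)

/-- The integrand in the formula for `potQuot`. -/
def potQuotIntegrand (V : Plane → ℝ → ℝ) (q : ℝ × Plane × ℂ) : ℝ :=
  2 * q.1 * potDeriv V (q.2.1, q.1 ^ 2 * ‖q.2.2‖ ^ 2)

/-- The difference quotient `(V(x,|u|²) - V(x,0)) / |u|²`, extended smoothly to `u = 0`. -/
def potQuot (V : Plane → ℝ → ℝ) (p : Plane × ℂ) : ℝ := ∫ t in (0 : ℝ)..1, potQuotIntegrand V (t, p)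

/-- The density argument `t² |u|²` is smooth and nonnegative on the whole space, so the one-sided
smoothness of `V` becomes unrestricted smoothness in `(t, x, u)`. -/
lemma contDiff_potQuotIntegrand
    (hV : ContDiffOn ℝ ∞ (fun p : Plane × ℝ => V p.1 p.2) (univ ×ˢ Ici (0 : ℝ))) :
    ContDiff ℝ ∞ (potQuotIntegrand V) := by
  have h1 : ContDiff ℝ ∞ fun q : ℝ × Plane × ℂ => (q.2.1, q.1 ^ 2 * ‖q.2.2‖ ^ 2) := by
    have := (contDiff_norm_sq ℝ (E := ℂ) (n := ∞))
    exact contDiff_snd.fst.prodMk ((contDiff_fst.pow 2).mul (this.comp contDiff_snd.snd))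
  have h2 := (contDiffOn_potDeriv hV).comp (s := univ) h1.contDiffOn
    (fun q _ => ⟨mem_univ _, by simp only [mem_Ici]; positivity⟩)
  rw [contDiffOn_univ] at h2
  exact (contDiff_const.mul contDiff_fst).mul h2

lemma contDiff_potQuot
    (hV : ContDiffOn ℝ ∞ (fun p : Plane × ℝ => V p.1 p.2) (univ ×ˢ Ici (0 : ℝ))) :
    ContDiff ℝ ∞ (potQuot V) :=
  contDiff_parametric_integral (contDiff_potQuotIntegrand hV)

lemma latPeriodic_potQuot
    (hV : ContDiffOn ℝ ∞ (fun p : Plane × ℝ => V p.1 p.2) (univ ×ˢ Ici (0 : ℝ)))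
    (hper : ∀ ρ : ℝ, 0 ≤ ρ → LatPeriodic (fun x => V x ρ)) (u : ℂ) :
    LatPeriodic fun x => potQuot V (x, u) := by
  have h : ∀ t : ℝ, LatPeriodic fun x => potDeriv V (x, t ^ 2 * ‖u‖ ^ 2) :=
    fun t => latPeriodic_potDeriv hV hper (by positivity)
  exact ⟨fun x => by simp only [potQuot, potQuotIntegrand, (h _).1],
    fun x => by simp only [potQuot, potQuotIntegrand, (h _).2]⟩

/-- Fundamental theorem of calculus along `t ↦ V x (t² |u|²)` on `[0, 1]`. -/
lemma pot_sub_eq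
    (hV : ContDiffOn ℝ ∞ (fun p : Plane × ℝ => V p.1 p.2) (univ ×ˢ Ici (0 : ℝ))) (x : Plane)
    (u : ℂ) : V x (‖u‖ ^ 2) - V x 0 = ‖u‖ ^ 2 * potQuot V (x, u) := by
  have hc : Continuous fun t : ℝ => potQuotIntegrand V (t, x, u) :=
    (contDiff_potQuotIntegrand hV).continuous.comp (by fun_prop)
  have h := intervalIntegral.integral_eq_sub_of_hasDerivAt (a := 0) (b := 1)
    (fun t _ => hasDerivAt_pot_sq hV x (sq_nonneg ‖u‖) t) (by
      refine Continuous.intervalIntegrable ?_ _ _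
      have e : (fun t : ℝ => 2 * t * ‖u‖ ^ 2 * potDeriv V (x, t ^ 2 * ‖u‖ ^ 2))
          = fun t => ‖u‖ ^ 2 * potQuotIntegrand V (t, x, u) := by
        ext t; simp only [potQuotIntegrand]; ring
      rw [e]
      exact continuous_const.mul hc)
  rw [potQuot, ← intervalIntegral.integral_const_mul]
  have e2 : V x (‖u‖ ^ 2) - V x 0 = V x (1 ^ 2 * ‖u‖ ^ 2) - V x (0 ^ 2 * ‖u‖ ^ 2) := by simp
  rw [e2, ← h]
  congr 1 with t
  simp only [potQuotIntegrand]; ring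

/-- The nonlinearity `(V(x,|z|²) - V(x,0)) z`. -/
def nonlin (V : Plane → ℝ → ℝ) (x : Plane) (z : ℂ) : ℂ := ((V x (‖z‖ ^ 2) - V x 0 : ℝ) : ℂ) * z

/-- The rescaled nonlinearity. -/
def scaledNonlin (V : Plane → ℝ → ℝ) (q : Plane × ℂ × ℝ) : ℂ :=
  ((potQuot V (q.1, (q.2.2 : ℂ) * q.2.1) * ‖q.2.1‖ ^ 2 : ℝ) : ℂ) * q.2.1

/-- The full cubic factor is extracted while the rescaled nonlinearity stays smooth up to and
through `ε = 0`; uniformity in small `ε` rests on this. -/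
lemma nonlin_scaled
    (hV : ContDiffOn ℝ ∞ (fun p : Plane × ℝ => V p.1 p.2) (univ ×ˢ Ici (0 : ℝ))) (x : Plane)
    (v : ℂ) (ε : ℝ) : nonlin V x (ε * v) = (ε : ℂ) ^ 3 * scaledNonlin V (x, v, ε) := by
  rw [nonlin, pot_sub_eq hV, scaledNonlin]
  have : ‖(ε : ℂ) * v‖ ^ 2 = ε ^ 2 * ‖v‖ ^ 2 := by
    rw [norm_mul, mul_pow, Complex.norm_real, Real.norm_eq_abs, sq_abs]
  rw [this]
  push_cast
  ring

lemma contDiff_scaledNonlin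
    (hV : ContDiffOn ℝ ∞ (fun p : Plane × ℝ => V p.1 p.2) (univ ×ˢ Ici (0 : ℝ))) :
    ContDiff ℝ ∞ (scaledNonlin V) := by
  have h0 : ContDiff ℝ ∞ fun q : Plane × ℂ × ℝ => (q.1, (q.2.2 : ℂ) * q.2.1) :=
    contDiff_fst.prodMk ((Complex.ofRealCLM.contDiff.comp contDiff_snd.snd).mul contDiff_snd.fst)
  have h1 := (contDiff_potQuot hV).comp h0
  have h2 := (contDiff_norm_sq ℝ (E := ℂ) (n := ∞)).comp
    (contDiff_snd.fst : ContDiff ℝ ∞ fun q : Plane × ℂ × ℝ => q.2.1)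
  exact (Complex.ofRealCLM.contDiff.comp (h1.mul h2)).mul contDiff_snd.fst

lemma latPeriodic_scaledNonlin
    (hV : ContDiffOn ℝ ∞ (fun p : Plane × ℝ => V p.1 p.2) (univ ×ˢ Ici (0 : ℝ)))
    (hper : ∀ ρ : ℝ, 0 ≤ ρ → LatPeriodic (fun x => V x ρ)) (e : ℂ × ℝ) :
    LatPeriodic fun x => scaledNonlin V (x, e) :=
  (latPeriodic_potQuot hV hper ((e.2 : ℂ) * e.1)).comp
    fun w => ((w * ‖e.1‖ ^ 2 : ℝ) : ℂ) * e.1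

/-- The inclusion of the function value direction. -/
def valDir : ℂ →L[ℝ] Plane × ℂ × ℝ :=
  (ContinuousLinearMap.inr ℝ Plane (ℂ × ℝ)).comp (ContinuousLinearMap.inl ℝ ℂ ℝ)

/-- The averaged derivative of the rescaled nonlinearity between two values. -/
def nonlinSlope (V : Plane → ℝ → ℝ) (p : Plane × Par) : ℂ →L[ℝ] ℂ :=
  ∫ t in (0 : ℝ)..1,
    (fderiv ℝ (scaledNonlin V) (p.1, p.2.2.1 + t • (p.2.1 - p.2.2.1), p.2.2.2)).comp valDir

lemma contDiff_nonlinSlope_integrand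
    (hV : ContDiffOn ℝ ∞ (fun p : Plane × ℝ => V p.1 p.2) (univ ×ˢ Ici (0 : ℝ))) :
    ContDiff ℝ ∞ fun q : ℝ × Plane × Par => (fderiv ℝ (scaledNonlin V)
      (q.2.1, q.2.2.2.1 + q.1 • (q.2.2.1 - q.2.2.2.1), q.2.2.2.2)).comp valDir := by
  have h1 : ContDiff ℝ ∞ (fderiv ℝ (scaledNonlin V)) :=
    (contDiff_scaledNonlin hV).fderiv_right (m := ∞) (by simp)
  refine (h1.comp ?_).clm_comp contDiff_const
  fun_prop

lemma contDiff_nonlinSlope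
    (hV : ContDiffOn ℝ ∞ (fun p : Plane × ℝ => V p.1 p.2) (univ ×ˢ Ici (0 : ℝ))) :
    ContDiff ℝ ∞ (nonlinSlope V) :=
  contDiff_parametric_integral (contDiff_nonlinSlope_integrand hV)

lemma latPeriodic_nonlinSlope
    (hV : ContDiffOn ℝ ∞ (fun p : Plane × ℝ => V p.1 p.2) (univ ×ˢ Ici (0 : ℝ)))
    (hper : ∀ ρ : ℝ, 0 ≤ ρ → LatPeriodic (fun x => V x ρ)) (e : Par) :
    LatPeriodic fun x => nonlinSlope V (x, e) := by
  have h := fun e' => latPeriodic_fderiv_prod (latPeriodic_scaledNonlin hV hper) e'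
  exact ⟨fun x => by simp only [nonlinSlope, (h _).1],
    fun x => by simp only [nonlinSlope, (h _).2]⟩

lemma scaledNonlin_sub
    (hV : ContDiffOn ℝ ∞ (fun p : Plane × ℝ => V p.1 p.2) (univ ×ˢ Ici (0 : ℝ))) (x : Plane)
    (v₁ v₂ : ℂ) (ε : ℝ) : scaledNonlin V (x, v₁, ε) - scaledNonlin V (x, v₂, ε)
      = nonlinSlope V (x, v₁, v₂, ε) (v₁ - v₂) := by
  have hc : Continuous fun t : ℝ => (fderiv ℝ (scaledNonlin V)
      (x, v₂ + t • (v₁ - v₂), ε)).comp valDir :=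
    (contDiff_nonlinSlope_integrand hV).continuous.comp
      (by fun_prop : Continuous fun t : ℝ => (t, x, ((v₁, v₂, ε) : Par)))
  have hd : ∀ t : ℝ, HasDerivAt (fun t : ℝ => scaledNonlin V (x, v₂ + t • (v₁ - v₂), ε))
      ((fderiv ℝ (scaledNonlin V) (x, v₂ + t • (v₁ - v₂), ε)).comp valDir (v₁ - v₂)) t := by
    intro t
    have h1 := (((contDiff_scaledNonlin hV).differentiable (by simp))
      (x, v₂ + t • (v₁ - v₂), ε)).hasFDerivAt
    have h2 : HasDerivAt (fun t : ℝ => (x, v₂ + t • (v₁ - v₂), ε)) (valDir (v₁ - v₂)) t := by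
      have h3 : HasDerivAt (fun t : ℝ => v₂ + t • (v₁ - v₂)) (v₁ - v₂) t := by
        simpa using ((hasDerivAt_id t).smul_const (v₁ - v₂)).const_add v₂
      exact (hasDerivAt_const t x).prodMk (h3.prodMk (hasDerivAt_const t ε))
    exact h1.comp_hasDerivAt t h2
  have h := intervalIntegral.integral_eq_sub_of_hasDerivAt (a := 0) (b := 1) (fun t _ => hd t)
    ((hc.clm_apply continuous_const).intervalIntegrable _ _)
  rw [nonlinSlope, ContinuousLinearMap.intervalIntegral_apply (hc.intervalIntegrable _ _)]
  rw [h]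
  simp

/-- The cubic factor `ε³` loses one power because the rescaled difference is `ε⁻¹ (z₁ - z₂)`. For
solutions of size `ε` the arguments `ε⁻¹ zᵢ` stay bounded. -/
lemma nonlin_sub
    (hV : ContDiffOn ℝ ∞ (fun p : Plane × ℝ => V p.1 p.2) (univ ×ˢ Ici (0 : ℝ))) (x : Plane)
    (z₁ z₂ : ℂ) {ε : ℝ} (hε : ε ≠ 0) : nonlin V x z₁ - nonlin V x z₂
      = (ε : ℂ) ^ 2 * nonlinSlope V (x, (ε : ℂ)⁻¹ * z₁, (ε : ℂ)⁻¹ * z₂, ε) (z₁ - z₂) := by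
  have hε' : (ε : ℂ) ≠ 0 := by exact_mod_cast hε
  have e1 := nonlin_scaled hV x ((ε : ℂ)⁻¹ * z₁) ε
  have e2 := nonlin_scaled hV x ((ε : ℂ)⁻¹ * z₂) ε
  rw [mul_inv_cancel_left₀ hε'] at e1 e2
  have e3 : (ε : ℂ)⁻¹ * z₁ - (ε : ℂ)⁻¹ * z₂ = ε⁻¹ • (z₁ - z₂) := by
    rw [Complex.real_smul]; push_cast; ring
  rw [e1, e2, ← mul_sub, scaledNonlin_sub hV, e3, map_smul, Complex.real_smul]
  push_cast
  field_simp

end Nonlinearity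

/-! ### The linear problem -/

lemma norm_fc_le {f : Plane → ℂ} (hf : MemL2 f) (k : ℤ × ℤ) : ‖fc f k‖ ≤ l2Norm f := by
  have := hf.sobBound.sum_le {k}
  simp only [pow_zero, one_mul, Finset.sum_singleton] at this
  exact le_of_sq_le_sq this (l2Norm_nonneg f)

lemma MemL2.of_norm_le {f g : Plane → ℂ} (hf : MemL2 f) (hg : LatPeriodic g)
    (hm : AEStronglyMeasurable g (volume.restrict cell)) {c : ℝ} (hc : 0 ≤ c)
    (h : ∀ᵐ x, ‖g x‖ ≤ c * ‖f x‖) : MemL2 g ∧ l2Norm g ≤ c * l2Norm f := by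
  have h' := ae_restrict_of_ae (s := cell) h
  have hg2 : MemL2 g := ⟨hg, hf.2.of_le_mul hm h'⟩
  refine ⟨hg2, ?_⟩
  rw [l2Norm, Real.sqrt_le_iff]
  refine ⟨mul_nonneg hc (l2Norm_nonneg f), ?_⟩
  rw [mul_pow, l2Norm_sq, ← integral_const_mul]
  have i1 := (memLp_two_iff_integrable_sq_norm hg2.2.1).1 hg2.2
  have i2 := (memLp_two_iff_integrable_sq_norm hf.2.1).1 hf.2
  refine integral_mono_ae i1 (i2.const_mul _) ?_
  filter_upwards [h'] with x hx
  rw [← mul_pow]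
  exact pow_le_pow_left₀ (norm_nonneg _) hx 2

lemma l2Norm_add_le {f g : Plane → ℂ} (hf : MemL2 f) (hg : MemL2 g) :
    l2Norm (fun x => f x + g x) ≤ l2Norm f + l2Norm g :=
  (hf.sobBound.add hg.sobBound).l2Norm_le

lemma l2Norm_sub_le {f g : Plane → ℂ} (hf : MemL2 f) (hg : MemL2 g) :
    l2Norm (fun x => f x - g x) ≤ l2Norm f + l2Norm g :=
  (hf.sobBound.sub hg.sobBound).l2Norm_le

lemma l2Norm_const_mul_le {f : Plane → ℂ} (hf : MemL2 f) (c : ℂ) :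
    l2Norm (fun x => c * f x) ≤ ‖c‖ * l2Norm f :=
  (hf.sobBound.const_mul c).l2Norm_le

lemma integrable_conj_mul {f g : Plane → ℂ} (hf : MemL2 f) (hg : MemL2 g) :
    Integrable (fun x => (starRingEnd ℂ) (f x) * g x) (volume.restrict cell) :=
  hf.2.star.integrable_mul hg.2

lemma l2Inner_add_right {f g h : Plane → ℂ} (hf : MemL2 f) (hg : MemL2 g) (hh : MemL2 h) :
    l2Inner f (fun x => g x + h x) = l2Inner f g + l2Inner f h := by
  simp only [l2Inner, mul_add]
  exact integral_add (integrable_conj_mul hf hg) (integrable_conj_mul hf hh)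

lemma l2Inner_sub_right {f g h : Plane → ℂ} (hf : MemL2 f) (hg : MemL2 g) (hh : MemL2 h) :
    l2Inner f (fun x => g x - h x) = l2Inner f g - l2Inner f h := by
  simp only [l2Inner, mul_sub]
  exact integral_sub (integrable_conj_mul hf hg) (integrable_conj_mul hf hh)

lemma l2Inner_const_mul_right (f g : Plane → ℂ) (c : ℂ) :
    l2Inner f (fun x => c * g x) = c * l2Inner f g := by
  simp only [l2Inner, mul_left_comm _ c, integral_const_mul]

lemma l2Inner_conj (f g : Plane → ℂ) : (starRingEnd ℂ) (l2Inner f g) = l2Inner g f := by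
  rw [l2Inner, ← integral_conj, l2Inner]
  congr 1 with x
  simp [mul_comm]

lemma l2Inner_congr_left {f f' g : Plane → ℂ} (h : ∀ᵐ x, f x = f' x) :
    l2Inner f g = l2Inner f' g := by
  apply integral_congr_ae
  filter_upwards [ae_restrict_of_ae h] with x hx
  rw [hx]

lemma norm_l2Inner_le {f g : Plane → ℂ} (hf : MemL2 f) (hg : MemL2 g) :
    ‖l2Inner f g‖ ≤ l2Norm f * l2Norm g := by
  have h := hasSum_l2Inner hf.2 hg.2
  have hbd : ∀ S : Finset (ℤ × ℤ), ‖∑ k ∈ S, (starRingEnd ℂ) (fc f k) * fc g k‖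
      ≤ l2Norm f * l2Norm g := by
    intro S
    refine (norm_sum_le _ _).trans ?_
    simp only [norm_mul, RCLike.norm_conj]
    apply le_of_sq_le_sq _ (mul_nonneg (l2Norm_nonneg f) (l2Norm_nonneg g))
    rw [mul_pow]
    refine (Finset.sum_mul_sq_le_sq_mul_sq _ _ _).trans ?_
    have h1 := hf.sobBound.sum_le S
    have h2 := hg.sobBound.sum_le S
    simp only [pow_zero, one_mul] at h1 h2
    exact mul_le_mul h1 h2 (Finset.sum_nonneg fun _ _ => sq_nonneg _) (sq_nonneg _)
  exact le_of_tendsto' h.norm hbd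

/-- The equation `(-(∇ + iK)² + W - E₀) ψ = g`. -/
structure BlochEq (W : Plane → ℝ) (E₀ : ℝ) (ψ g : Plane → ℂ) : Prop where
  memL2 : MemL2 ψ
  memL2_rhs : MemL2 g
  eq : ∀ k, blochSymb k * fc ψ k = fc (fun x => ((E₀ - W x : ℝ) : ℂ) * ψ x + g x) k

section Linear

variable {W : Plane → ℝ} {E₀ w : ℝ}

lemma potential_mul (hW : Continuous W) (hWp : LatPeriodic W) (hw : ∀ x, |W x| ≤ w)
    {ψ : Plane → ℂ} (hψ : MemL2 ψ) : MemL2 (fun x => ((E₀ - W x : ℝ) : ℂ) * ψ x) ∧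
      l2Norm (fun x => ((E₀ - W x : ℝ) : ℂ) * ψ x) ≤ (|E₀| + w) * l2Norm ψ := by
  refine hψ.of_norm_le (hWp.comp₂ hψ.1 fun a b => ((E₀ - a : ℝ) : ℂ) * b) ?_
    (add_nonneg (abs_nonneg _) ((abs_nonneg _).trans (hw 0))) ?_
  · exact (Complex.continuous_ofReal.comp (continuous_const.sub hW)).aestronglyMeasurable.mul hψ.2.1
  · refine Filter.Eventually.of_forall fun x => ?_
    rw [norm_mul, Complex.norm_real, Real.norm_eq_abs]
    exact mul_le_mul_of_nonneg_right ((abs_sub _ _).trans (by linarith [hw x])) (norm_nonneg _)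

lemma BlochEq.sub (hW : Continuous W) (hWp : LatPeriodic W) (hw : ∀ x, |W x| ≤ w)
    {ψ ψ' g g' : Plane → ℂ} (h : BlochEq W E₀ ψ g) (h' : BlochEq W E₀ ψ' g') :
    BlochEq W E₀ (fun x => ψ x - ψ' x) (fun x => g x - g' x) := by
  refine ⟨h.memL2.sub h'.memL2, h.memL2_rhs.sub h'.memL2_rhs, fun k => ?_⟩
  have m := (potential_mul (E₀ := E₀) hW hWp hw h.memL2).1.add h.memL2_rhs
  have m' := (potential_mul (E₀ := E₀) hW hWp hw h'.memL2).1.add h'.memL2_rhs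
  rw [fc_sub h.memL2 h'.memL2, mul_sub, h.eq, h'.eq, ← fc_sub m m']
  congr 1 with x
  ring

lemma BlochEq.const_mul {ψ g : Plane → ℂ} (h : BlochEq W E₀ ψ g) (c : ℂ) :
    BlochEq W E₀ (fun x => c * ψ x) (fun x => c * g x) := by
  refine ⟨h.memL2.const_mul c, h.memL2_rhs.const_mul c, fun k => ?_⟩
  rw [fc_const_mul, mul_left_comm, h.eq, ← fc_const_mul]
  congr 1 with x
  ring

lemma BlochEq.memSobolev (hW : Continuous W) (hWp : LatPeriodic W) (hw : ∀ x, |W x| ≤ w)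
    {ψ g : Plane → ℂ} (h : BlochEq W E₀ ψ g) : MemSobolev 2 ψ :=
  memSobolev_two_of_fc h.memL2 ((potential_mul hW hWp hw h.memL2).1.add h.memL2_rhs) h.eq

lemma memL2_zero : MemL2 (fun _ => (0 : ℂ)) := (SobBound.zero 0).memL2

lemma solvesBloch_iff (hW : Continuous W) (hWp : LatPeriodic W) (hw : ∀ x, |W x| ≤ w)
    {φ : Plane → ℂ} : SolvesBloch W E₀ φ ↔ BlochEq W E₀ φ (fun _ => 0) := by
  constructor
  · rintro ⟨hs, h⟩
    have m := (potential_mul (E₀ := E₀) hW hWp hw hs.1).1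
    refine ⟨hs.1, memL2_zero, ?_⟩
    simp only [add_zero]
    rw [← neg_blochLaplacian_ae_eq_iff hs m]
    filter_upwards [h] with x hx
    push_cast
    linear_combination hx
  · intro h
    have hs := h.memSobolev hW hWp hw
    have m := (potential_mul (E₀ := E₀) hW hWp hw hs.1).1
    refine ⟨hs, ?_⟩
    have h2 := h.eq
    simp only [add_zero] at h2
    rw [← neg_blochLaplacian_ae_eq_iff hs m] at h2
    filter_upwards [h2] with x hx
    push_cast at hx
    linear_combination hx

/-- Fredholm solvability: the symbol and the potential are real, so the operator is symmetric, and
its range is orthogonal to its kernel. It is the source of all information on the energies. -/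
lemma BlochEq.l2Inner_rhs (hW : Continuous W) (hWp : LatPeriodic W) (hw : ∀ x, |W x| ≤ w)
    {ψ g φ : Plane → ℂ} (h : BlochEq W E₀ ψ g) (hφ : BlochEq W E₀ φ (fun _ => 0)) :
    l2Inner φ g = 0 := by
  have m := (potential_mul (E₀ := E₀) hW hWp hw h.memL2).1
  have mφ := (potential_mul (E₀ := E₀) hW hWp hw hφ.memL2).1
  have h1 := hasSum_l2Inner hφ.memL2.2 (m.add h.memL2_rhs).2
  have h2 := hasSum_l2Inner mφ.2 h.memL2.2
  have e := hφ.eq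
  simp only [add_zero] at e
  have h3 := h1.unique (h2.congr_fun fun k => by
    rw [← e, ← h.eq, map_mul, Complex.conj_ofReal]; ring)
  rw [l2Inner_add_right hφ.memL2 m h.memL2_rhs] at h3
  have h4 : l2Inner φ (fun x => ((E₀ - W x : ℝ) : ℂ) * ψ x)
      = l2Inner (fun x => ((E₀ - W x : ℝ) : ℂ) * φ x) ψ := by
    simp only [l2Inner, map_mul, Complex.conj_ofReal]
    congr 1 with x
    ring
  rw [h4] at h3
  simpa using h3

lemma BlochEq.sobBound_two (hW : Continuous W) (hWp : LatPeriodic W) (hw : ∀ x, |W x| ≤ w)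
    {ψ g : Plane → ℂ} (h : BlochEq W E₀ ψ g) :
    SobBound 2 ψ (ellConst * (l2Norm ψ + ((|E₀| + w) * l2Norm ψ + l2Norm g))) := by
  have m := potential_mul (E₀ := E₀) hW hWp hw h.memL2
  exact h.memL2.sobBound.elliptic ((m.1.sobBound.mono m.2).add h.memL2_rhs.sobBound) h.eq

lemma tendsto_tsum_sq_sub {c : ℕ → ℤ × ℤ → ℂ} {c' : ℤ × ℤ → ℂ} {B : ℝ}
    (hc : ∀ n k, ‖c n k‖ ≤ B * (wt k)⁻¹) (hc' : ∀ k, ‖c' k‖ ≤ B * (wt k)⁻¹)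
    (hlim : ∀ k, Filter.Tendsto (fun n => c n k) Filter.atTop (nhds (c' k))) :
    Filter.Tendsto (fun n => ∑' k, ‖c n k - c' k‖ ^ 2) Filter.atTop (nhds 0) := by
  have := tendsto_tsum_of_dominated_convergence (f := fun n k => ‖c n k - c' k‖ ^ 2)
    (g := fun _ => (0 : ℝ)) (𝓕 := Filter.atTop) (bound := fun k => (2 * B) ^ 2 * (wt k ^ 2)⁻¹)
    (summable_wt.mul_left _) (fun k => ?_) (Filter.Eventually.of_forall fun n k => ?_)
  · simpa using this
  · simpa using ((hlim k).sub_const (c' k)).norm.pow 2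
  · rw [Real.norm_of_nonneg (sq_nonneg _), ← inv_pow, ← mul_pow]
    refine pow_le_pow_left₀ (norm_nonneg _) ((norm_sub_le _ _).trans ?_) 2
    linarith [hc n k, hc' k]

lemma l2Norm_sq_eq_tsum {f : Plane → ℂ} (hf : MemL2 f) : l2Norm f ^ 2 = ∑' k, ‖fc f k‖ ^ 2 := by
  rw [l2Norm_sq, (hasSum_fc_sq hf).tsum_eq]

/-- Compactness of the embedding of `H²` into `L²`. -/
lemma exists_subseq_l2 {ψ : ℕ → Plane → ℂ} {B : ℝ} (h : ∀ n, SobBound 2 (ψ n) B) :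
    ∃ (u : ℕ → ℕ) (f : Plane → ℂ), StrictMono u ∧ MemL2 f ∧
      Filter.Tendsto (fun n => l2Norm (fun x => ψ (u n) x - f x)) Filter.atTop (nhds 0) := by
  have hb : ∀ n k, ‖fc (ψ n) k‖ ≤ B * (wt k)⁻¹ := by
    intro n k
    have h1 := (h n).sum_le {k}
    rw [Finset.sum_singleton, ← mul_pow] at h1
    have h2 := le_of_sq_le_sq h1 (h n).nonneg
    rw [← div_eq_mul_inv, le_div_iff₀ (wt_pos k), mul_comm]
    exact h2
  -- The coefficient sequences lie in a countable product of closed discs, compact by Tychonoff. A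
  -- coefficientwise limit is then an `ℓ²` limit by domination with `B² wt⁻²`.
  have hK : IsCompact (Set.univ.pi fun k : ℤ × ℤ => Metric.closedBall (0 : ℂ) (B * (wt k)⁻¹)) :=
    isCompact_univ_pi fun k => isCompact_closedBall _ _
  obtain ⟨c, hc, u, hu, hlim⟩ := hK.tendsto_subseq (x := fun n k => fc (ψ n) k)
    (fun n k _ => by simpa using hb n k)
  have hc' : ∀ k, ‖c k‖ ≤ B * (wt k)⁻¹ := fun k => by simpa using hc k (Set.mem_univ k)
  have hs : Summable fun k => ‖c k‖ ^ 2 := by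
    refine Summable.of_nonneg_of_le (fun _ => sq_nonneg _) (fun k => ?_)
      (summable_wt.mul_left (B ^ 2))
    rw [← inv_pow, ← mul_pow]
    exact pow_le_pow_left₀ (norm_nonneg _) (hc' k) 2
  obtain ⟨f, hf, hfc⟩ := exists_of_summable_sq hs
  refine ⟨u, f, hu, hf, ?_⟩
  have h1 := tendsto_tsum_sq_sub (c := fun n k => fc (ψ (u n)) k) (fun n k => hb (u n) k) hc'
    (fun k => (tendsto_pi_nhds.1 hlim) k)
  have h2 : ∀ n, l2Norm (fun x => ψ (u n) x - f x)
      = Real.sqrt (∑' k, ‖fc (ψ (u n)) k - c k‖ ^ 2) := by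
    intro n
    have m := (h (u n)).memL2.sub hf
    rw [← Real.sqrt_sq (l2Norm_nonneg _), l2Norm_sq_eq_tsum m]
    simp only [fc_sub (h (u n)).memL2 hf, hfc]
  simp only [h2]
  simpa using h1.sqrt

lemma tendsto_of_norm_sub_le {a : ℕ → ℂ} {b : ℂ} {r : ℕ → ℝ} (h : ∀ n, ‖a n - b‖ ≤ r n)
    (hr : Filter.Tendsto r Filter.atTop (nhds 0)) : Filter.Tendsto a Filter.atTop (nhds b) :=
  tendsto_iff_norm_sub_tendsto_zero.2 (squeeze_zero (fun _ => norm_nonneg _) h hr)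

/-- The spectral gap. -/
lemma exists_gap (hW : Continuous W) (hWp : LatPeriodic W) (hw : ∀ x, |W x| ≤ w) :
    ∃ C, 0 ≤ C ∧ ∀ ψ g, BlochEq W E₀ ψ g → (∀ φ, SolvesBloch W E₀ φ → l2Inner φ ψ = 0) →
      l2Norm ψ ≤ C * l2Norm g := by
  -- Failing a gap, normalised `Ψ n` have right-hand sides tending to zero and are bounded in `H²`.
  -- A subsequence converges in `L²` to a solution `f` of the homogeneous equation. Each `Ψ n` is
  -- orthogonal to `f`, hence `f = 0`, against `‖Ψ n‖ = 1`.
  by_contra! hne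
  have hw0 : 0 ≤ w := (abs_nonneg _).trans (hw 0)
  choose ψ g heq horth hlt using fun n : ℕ => hne ((n : ℝ) + 1) (by positivity)
  have hpos : ∀ n, 0 < l2Norm (ψ n) := fun n =>
    (mul_nonneg (by positivity) (l2Norm_nonneg (g n))).trans_lt (hlt n)
  set Ψ : ℕ → Plane → ℂ := fun n x => ((l2Norm (ψ n))⁻¹ : ℝ) * ψ n x with hΨ
  set γ : ℕ → Plane → ℂ := fun n x => ((l2Norm (ψ n))⁻¹ : ℝ) * g n x with hγ
  have hE : ∀ n, BlochEq W E₀ (Ψ n) (γ n) := fun n => (heq n).const_mul _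
  have hΨ1 : ∀ n, l2Norm (Ψ n) = 1 := by
    intro n
    have h0 := (hpos n).ne'
    have h1 := l2Norm_sq_eq_tsum (hE n).memL2
    have h2 : ∀ k, ‖fc (Ψ n) k‖ ^ 2 = (l2Norm (ψ n) ^ 2)⁻¹ * ‖fc (ψ n) k‖ ^ 2 := by
      intro k
      have : fc (Ψ n) k = _ := fc_const_mul _ _ _
      rw [this, norm_mul, mul_pow, Complex.norm_real, Real.norm_eq_abs, sq_abs, inv_pow]
    simp only [h2] at h1
    rw [tsum_mul_left, ← l2Norm_sq_eq_tsum (heq n).memL2, inv_mul_cancel₀ (pow_ne_zero 2 h0)] at h1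
    exact (pow_eq_one_iff_of_nonneg (l2Norm_nonneg _) two_ne_zero).1 h1
  have hγ1 : ∀ n, l2Norm (γ n) ≤ 1 / ((n : ℝ) + 1) := by
    intro n
    refine (l2Norm_const_mul_le (heq n).memL2_rhs _).trans ?_
    rw [Complex.norm_real, Real.norm_of_nonneg (inv_nonneg.2 (hpos n).le), le_div_iff₀
      (by positivity), mul_assoc, mul_comm (l2Norm (g n)), inv_mul_le_iff₀ (hpos n), mul_one]
    exact (hlt n).le
  have hγ2 : Filter.Tendsto (fun n => l2Norm (γ n)) Filter.atTop (nhds 0) :=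
    squeeze_zero (fun n => l2Norm_nonneg _) hγ1 tendsto_one_div_add_atTop_nhds_zero_nat
  have hB : ∀ n, SobBound 2 (Ψ n) (ellConst * (1 + ((|E₀| + w) * 1 + 1))) := by
    intro n
    have h1 := (hE n).sobBound_two hW hWp hw
    rw [hΨ1] at h1
    refine h1.mono (mul_le_mul_of_nonneg_left ?_ ellConst_nonneg)
    have : l2Norm (γ n) ≤ 1 := (hγ1 n).trans (by
      rw [div_le_one (by positivity)]; linarith [Nat.cast_nonneg (α := ℝ) n])
    linarith
  obtain ⟨u, f, hu, hf, hlim⟩ := exists_subseq_l2 hB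
  have hγu := hγ2.comp hu.tendsto_atTop
  have hsol : BlochEq W E₀ f (fun _ => 0) := by
    refine ⟨hf, memL2_zero, fun k => ?_⟩
    have t1 : Filter.Tendsto (fun n => blochSymb k * fc (Ψ (u n)) k) Filter.atTop
        (nhds (blochSymb k * fc f k)) := by
      refine Filter.Tendsto.const_mul _ (tendsto_of_norm_sub_le (fun n => ?_) hlim)
      rw [← fc_sub (hE _).memL2 hf]
      exact norm_fc_le ((hE _).memL2.sub hf) k
    have t2 : Filter.Tendsto (fun n => blochSymb k * fc (Ψ (u n)) k) Filter.atTop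
        (nhds (fc (fun x => ((E₀ - W x : ℝ) : ℂ) * f x + 0) k)) := by
      have r0 : Filter.Tendsto (fun n => (|E₀| + w) * l2Norm (fun x => Ψ (u n) x - f x)
          + l2Norm (γ (u n))) Filter.atTop (nhds 0) := by
        simpa using (hlim.const_mul (|E₀| + w)).add hγu
      refine tendsto_of_norm_sub_le (fun n => ?_) r0
      have m1 := potential_mul (E₀ := E₀) hW hWp hw ((hE (u n)).memL2.sub hf)
      have m2 := (potential_mul (E₀ := E₀) hW hWp hw (hE (u n)).memL2).1.add (hE (u n)).memL2_rhs
      have m3 := (potential_mul (E₀ := E₀) hW hWp hw hf).1.add memL2_zero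
      rw [(hE (u n)).eq, ← fc_sub m2 m3]
      have e : (fun x => ((E₀ - W x : ℝ) : ℂ) * Ψ (u n) x + γ (u n) x
          - (((E₀ - W x : ℝ) : ℂ) * f x + 0))
          = fun x => ((E₀ - W x : ℝ) : ℂ) * (Ψ (u n) x - f x) + γ (u n) x := by
        ext x; ring
      rw [e]
      exact (norm_fc_le (m1.1.add (hE (u n)).memL2_rhs) k).trans
        ((l2Norm_add_le m1.1 (hE (u n)).memL2_rhs).trans (by gcongr; exact m1.2))
    exact tendsto_nhds_unique t1 t2
  have hsolv := (solvesBloch_iff hW hWp hw).2 hsol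
  have hzero : ∀ n, l2Inner f (Ψ n) = 0 := by
    intro n
    have : l2Inner f (Ψ n) = _ := l2Inner_const_mul_right _ _ _
    rw [this, horth n f hsolv, mul_zero]
  have hle : ∀ n, ‖l2Inner f f‖ ≤ l2Norm f * l2Norm (fun x => Ψ (u n) x - f x) := by
    intro n
    have h1 := l2Inner_sub_right hf (hE (u n)).memL2 hf
    rw [hzero, zero_sub] at h1
    rw [← norm_neg, ← h1]
    exact norm_l2Inner_le hf ((hE (u n)).memL2.sub hf)
  have h0 : ‖l2Inner f f‖ ≤ 0 := by
    refine ge_of_tendsto' (x := Filter.atTop) ?_ hle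
    simpa using hlim.const_mul (l2Norm f)
  have hf0 : l2Norm f = 0 := by
    rw [l2Inner_self, ← l2Norm_sq, Complex.norm_real, Real.norm_of_nonneg (sq_nonneg _)] at h0
    exact pow_eq_zero_iff (two_ne_zero) |>.1 (le_antisymm h0 (sq_nonneg _))
  have h1 : ∀ n, 1 ≤ l2Norm (fun x => Ψ (u n) x - f x) := by
    intro n
    have h2 := l2Norm_add_le ((hE (u n)).memL2.sub hf) hf
    simp only [sub_add_cancel] at h2
    have h3 : l2Norm (fun x => Ψ (u n) x) = 1 := hΨ1 (u n)
    rw [h3, hf0, add_zero] at h2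
    exact h2
  have := ge_of_tendsto' hlim h1
  norm_num at this

end Linear

/-! ### Regularity, ground states and the perpendicular projection for a smooth potential -/

section SmoothPotential

variable {W : Plane → ℝ} {E₀ : ℝ} {φa φb : Plane → ℂ}

lemma exists_abs_le_of_periodic (hW : Continuous W) (hWp : LatPeriodic W) :
    ∃ w, ∀ x, |W x| ≤ w := by
  obtain ⟨w, -, h⟩ := exists_bound_of_periodic (E := ℝ) (F := fun p => W p.1)
    (hW.comp continuous_fst) (fun _ => hWp) 0
  exact ⟨w, fun x => h x 0 (by simp)⟩

lemma exists_sobBound_potential_mul (k : ℕ) (hW : ContDiff ℝ ∞ W) (hWp : LatPeriodic W) (E₀ : ℝ) :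
    ∃ C, 0 ≤ C ∧ ∀ ψ B, SobBound (k + 2) ψ B →
      SobBound (k + 1) (fun x => ((E₀ - W x : ℝ) : ℂ) * ψ x) (C * B) := by
  obtain ⟨C, hC, h⟩ := exists_sobBound_comp k
    (F := fun p : Plane × Par => (E₀ - W p.1) • ContinuousLinearMap.id ℝ ℂ)
    ((contDiff_const.sub (hW.comp contDiff_fst)).smul contDiff_const)
    (fun e => hWp.comp fun w => (E₀ - w) • ContinuousLinearMap.id ℝ ℂ) 0
  refine ⟨C, hC, fun ψ B hψ => ?_⟩
  have := h (fun _ => 0) (fun _ => 0) ψ 0 B (.zero _) (.zero _) (by simp) hψ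
  simpa only [_root_.smul_apply, ContinuousLinearMap.id_apply, Complex.real_smul]
    using this

/-- Elliptic regularity for the operator with smooth potential. -/
lemma exists_sobBound_regularity (k : ℕ) (hW : ContDiff ℝ ∞ W) (hWp : LatPeriodic W) (E₀ : ℝ) :
    ∃ C, 0 ≤ C ∧ ∀ ψ g A B, BlochEq W E₀ ψ g → SobBound (k + 2) ψ A → SobBound (k + 1) g B →
      SobBound (k + 3) ψ (C * (A + B)) := by
  obtain ⟨C, hC, h⟩ := exists_sobBound_potential_mul k hW hWp E₀
  refine ⟨ellConst * (1 + C + 1), mul_nonneg ellConst_nonneg (by positivity),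
    fun ψ g A B he hψ hg => ?_⟩
  have := (hψ.mono_order (Nat.le_succ _)).elliptic ((h ψ A hψ).add hg) he.eq
  refine this.mono ?_
  rw [mul_assoc]
  refine mul_le_mul_of_nonneg_left ?_ ellConst_nonneg
  nlinarith [hψ.nonneg, hg.nonneg, mul_nonneg hC hg.nonneg]

/-- The bound is uniform over all normalised eigenfunctions at `E₀`, so later constants do not
depend on the ground pair. Each bootstrap step gains one order: multiplication by the potential
costs one, ellipticity gives two. -/
lemma exists_sobBound_eigenfunction (k : ℕ) (hW : ContDiff ℝ ∞ W) (hWp : LatPeriodic W)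
    (E₀ : ℝ) : ∃ G, 0 ≤ G ∧ ∀ φ, BlochEq W E₀ φ (fun _ => 0) → l2Norm φ = 1 →
      SobBound (k + 2) φ G := by
  induction k with
  | zero =>
    obtain ⟨w, hw⟩ := exists_abs_le_of_periodic hW.continuous hWp
    have hw0 : 0 ≤ w := (abs_nonneg _).trans (hw 0)
    refine ⟨ellConst * (1 + ((|E₀| + w) * 1 + l2Norm fun _ => 0)), mul_nonneg ellConst_nonneg
      (add_nonneg zero_le_one (add_nonneg (by positivity) (l2Norm_nonneg _))), fun φ he h1 => ?_⟩
    have := he.sobBound_two hW.continuous hWp hw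
    rwa [h1] at this
  | succ k ih =>
    obtain ⟨G, hG, h⟩ := ih
    obtain ⟨C, hC, h'⟩ := exists_sobBound_regularity k hW hWp E₀
    exact ⟨C * (G + 0), mul_nonneg hC (by linarith), fun φ he h1 =>
      h' φ _ G 0 he (h φ he h1) (.zero _)⟩

lemma conj_exp_I_mul (t : ℝ) : (starRingEnd ℂ) (Complex.exp (Complex.I * t))
    * Complex.exp (Complex.I * t) = 1 := by
  rw [← Complex.exp_conj, map_mul, Complex.conj_I, Complex.conj_ofReal, ← Complex.exp_add]
  simp

lemma conj_twistedRot_mul (f g : Plane → ℂ) (x : Plane) :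
    (starRingEnd ℂ) (twistedRot f x) * twistedRot g x
      = (starRingEnd ℂ) (f (rot x)) * g (rot x) := by
  have h1 := conj_exp_I_mul (-inner ℝ diracPt x)
  have h2 := conj_exp_I_mul (inner ℝ diracPt (rot x))
  rw [Complex.ofReal_neg, mul_neg] at h1
  simp only [twistedRot, map_mul]
  linear_combination (starRingEnd ℂ) (f (rot x)) * g (rot x) *
    ((starRingEnd ℂ) (Complex.exp (Complex.I * (inner ℝ diracPt (rot x) : ℝ)))
      * Complex.exp (Complex.I * (inner ℝ diracPt (rot x) : ℝ)) * h1 + h2)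

lemma isPrimitiveRoot_omega : IsPrimitiveRoot omega 3 := by
  have := Complex.isPrimitiveRoot_exp 3 (by norm_num)
  rwa [Nat.cast_ofNat] at this

/-- The phases in `twistedRot` have modulus one and cancel in the pairing. Rotation invariance of
the integral then gives `⟨φa, φb⟩ = ω̄² ⟨φa, φb⟩`, and `ω² ≠ 1`. -/
lemma IsGroundPair.l2Inner_ab (h : IsGroundPair W E₀ φa φb) : l2Inner φa φb = 0 := by
  have hp : LatPeriodic fun x => (starRingEnd ℂ) (φa x) * φb x :=
    h.solves_a.1.1.1.comp₂ h.solves_b.1.1.1 fun u v => (starRingEnd ℂ) u * v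
  have h1 : l2Inner φa φb = (starRingEnd ℂ) omega ^ 2 * l2Inner φa φb := by
    calc l2Inner φa φb = ∫ x in cell, (starRingEnd ℂ) (φa (rot x)) * φb (rot x) :=
          (setIntegral_rot hp).symm
      _ = ∫ x in cell, (starRingEnd ℂ) omega ^ 2 * ((starRingEnd ℂ) (φa x) * φb x) := by
          refine integral_congr_ae (ae_restrict_of_ae ?_)
          filter_upwards [h.rot_a, h.rot_b] with x ha hb
          rw [← conj_twistedRot_mul, ha, hb, map_mul]
          ring
      _ = _ := integral_const_mul _ _
  have h2 : (starRingEnd ℂ) omega ^ 2 ≠ 1 := by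
    intro h3
    have h4 : omega ^ 2 = 1 := by
      have := congrArg (starRingEnd ℂ) h3
      simpa using this
    exact isPrimitiveRoot_omega.ne_one (by norm_num)
      (by linear_combination isPrimitiveRoot_omega.pow_eq_one - omega * h4)
  by_contra hne
  exact h2 (mul_right_cancel₀ hne (by rw [one_mul, ← h1]))

lemma l2Inner_self_of_norm {φ : Plane → ℂ} (h : l2Norm φ = 1) : l2Inner φ φ = 1 := by
  rw [l2Inner_self, ← l2Norm_sq, h]; simp

lemma IsGroundPair.l2Inner_ba (h : IsGroundPair W E₀ φa φb) : l2Inner φb φa = 0 := by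
  rw [← l2Inner_conj, h.l2Inner_ab, map_zero]

/-- The first eigenvalue is determined by the potential. -/
lemma IsGroundPair.energy_unique {E₀' : ℝ} {φa' φb' : Plane → ℂ} (h : IsGroundPair W E₀ φa φb)
    (h' : IsGroundPair W E₀' φa' φb') : E₀ = E₀' := by
  have key : ∀ {φ : Plane → ℂ}, l2Norm φ = 1 → ¬ ∀ᵐ x, φ x = 0 := by
    intro φ h1 h0
    have h2 := l2Inner_congr_left (g := φ) h0
    rw [l2Inner_self_of_norm h1] at h2
    simp [l2Inner] at h2
  exact le_antisymm (h.first _ _ h'.solves_a (key h'.norm_a))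
    (h'.first _ _ h.solves_a (key h.norm_a))

lemma MemL2.projPerp {f : Plane → ℂ} (ha : MemL2 φa) (hb : MemL2 φb) (hf : MemL2 f) :
    MemL2 (projPerp φa φb f) :=
  (hf.sub (ha.const_mul _)).sub (hb.const_mul _)

lemma IsGroundPair.l2Inner_projPerp (h : IsGroundPair W E₀ φa φb) {f : Plane → ℂ}
    (hf : MemL2 f) : l2Inner φa (projPerp φa φb f) = 0 ∧ l2Inner φb (projPerp φa φb f) = 0 := by
  have ma := h.solves_a.1.1
  have mb := h.solves_b.1.1
  have key : ∀ φ, MemL2 φ → l2Inner φ (HoneycombNLS.projPerp φa φb f)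
      = l2Inner φ f - l2Inner φa f * l2Inner φ φa - l2Inner φb f * l2Inner φ φb := by
    intro φ hφ
    have h1 := l2Inner_sub_right hφ (hf.sub (ma.const_mul (l2Inner φa f)))
      (mb.const_mul (l2Inner φb f))
    rw [l2Inner_sub_right hφ hf (ma.const_mul _), l2Inner_const_mul_right,
      l2Inner_const_mul_right] at h1
    exact h1
  rw [key φa ma, key φb mb, h.l2Inner_ab, h.l2Inner_ba, l2Inner_self_of_norm h.norm_a,
    l2Inner_self_of_norm h.norm_b]
  constructor <;> ring

lemma IsGroundPair.blochEq (h : IsGroundPair W E₀ φa φb) (hW : ContDiff ℝ ∞ W)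
    (hWp : LatPeriodic W) : BlochEq W E₀ φa (fun _ => 0) ∧ BlochEq W E₀ φb (fun _ => 0) := by
  obtain ⟨w, hw⟩ := exists_abs_le_of_periodic hW.continuous hWp
  exact ⟨(solvesBloch_iff hW.continuous hWp hw).1 h.solves_a,
    (solvesBloch_iff hW.continuous hWp hw).1 h.solves_b⟩

/-- The removed components lie in the kernel of `L - E₀`. -/
lemma BlochEq.projPerp (h : IsGroundPair W E₀ φa φb) (hW : ContDiff ℝ ∞ W)
    (hWp : LatPeriodic W) {f g : Plane → ℂ} (hf : BlochEq W E₀ f g) :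
    BlochEq W E₀ (projPerp φa φb f) g := by
  obtain ⟨w, hw⟩ := exists_abs_le_of_periodic hW.continuous hWp
  obtain ⟨ea, eb⟩ := h.blochEq hW hWp
  have := (hf.sub hW.continuous hWp hw (ea.const_mul (l2Inner φa f))).sub hW.continuous hWp hw
    (eb.const_mul (l2Inner φb f))
  simp only [mul_zero, sub_zero] at this
  exact this

/-- The gap estimate for a linear equation projected off the ground space. -/
lemma exists_projPerp_le (hW : ContDiff ℝ ∞ W) (hWp : LatPeriodic W) (E₀ : ℝ) :
    ∃ C, 0 ≤ C ∧ ∀ φa φb f g, IsGroundPair W E₀ φa φb → BlochEq W E₀ f g →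
      l2Norm (projPerp φa φb f) ≤ C * l2Norm g := by
  obtain ⟨w, hw⟩ := exists_abs_le_of_periodic hW.continuous hWp
  obtain ⟨C, hC, h⟩ := exists_gap (E₀ := E₀) hW.continuous hWp hw
  refine ⟨C, hC, fun φa φb f g hg hf => h _ _ (hf.projPerp hg hW hWp) fun φ hφ => ?_⟩
  have m := MemL2.projPerp hg.solves_a.1.1 hg.solves_b.1.1 hf.memL2
  obtain ⟨o1, o2⟩ := hg.l2Inner_projPerp hf.memL2
  -- The gap requires orthogonality to the whole eigenspace; spanning reduces this to `φa` and `φb`.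
  obtain ⟨α, β, hs⟩ := hg.spans φ hφ
  rw [l2Inner_congr_left hs, ← l2Inner_conj, l2Inner_add_right m (hg.solves_a.1.1.const_mul α)
    (hg.solves_b.1.1.const_mul β), l2Inner_const_mul_right, l2Inner_const_mul_right,
    ← l2Inner_conj φa, ← l2Inner_conj φb, o1, o2]
  simp

/-- Removing and restoring the ground state components. -/
lemma SobBound.of_projPerp {s : ℕ} {f : Plane → ℂ} {B G : ℝ} (ha : SobBound s φa G)
    (hb : SobBound s φb G) (h : SobBound s (HoneycombNLS.projPerp φa φb f) B) :
    SobBound s f (B + (‖l2Inner φa f‖ + ‖l2Inner φb f‖) * G) := by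
  have h1 := (h.add (ha.const_mul (l2Inner φa f))).add (hb.const_mul (l2Inner φb f))
  have e : (fun x => HoneycombNLS.projPerp φa φb f x + l2Inner φa f * φa x
      + l2Inner φb f * φb x) = f := by
    ext x; simp only [HoneycombNLS.projPerp]; ring
  rw [e] at h1
  exact h1.mono (le_of_eq (by ring))

end SmoothPotential

/-! ### Estimates for the nonlinear term and bootstrap of small solutions -/

section Nonlinear

variable {V : Plane → ℝ → ℝ} {E₀ : ℝ} {φa φb : Plane → ℂ}

lemma contDiff_pot_zero
    (hV : ContDiffOn ℝ ∞ (fun p : Plane × ℝ => V p.1 p.2) (univ ×ˢ Ici (0 : ℝ))) :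
    ContDiff ℝ ∞ fun x => V x 0 := by
  rw [← contDiffOn_univ]
  exact hV.comp (contDiff_id.prodMk contDiff_const).contDiffOn fun x _ => ⟨mem_univ _, mem_Ici.2 le_rfl⟩

lemma nonlin_eq
    (hV : ContDiffOn ℝ ∞ (fun p : Plane × ℝ => V p.1 p.2) (univ ×ˢ Ici (0 : ℝ))) (x : Plane)
    (z : ℂ) : nonlin V x z = ((‖z‖ ^ 2 * potQuot V (x, z) : ℝ) : ℂ) * z := by
  rw [nonlin, pot_sub_eq hV]

lemma exists_norm_nonlin_le
    (hV : ContDiffOn ℝ ∞ (fun p : Plane × ℝ => V p.1 p.2) (univ ×ˢ Ici (0 : ℝ)))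
    (hper : ∀ ρ : ℝ, 0 ≤ ρ → LatPeriodic (fun x => V x ρ)) :
    ∃ C, 0 ≤ C ∧ ∀ x z, ‖z‖ ≤ 1 → ‖nonlin V x z‖ ≤ C * ‖z‖ ^ 2 * ‖z‖ := by
  obtain ⟨C, hC, h⟩ := exists_bound_of_periodic (contDiff_potQuot hV).continuous
    (latPeriodic_potQuot hV hper) 1
  refine ⟨C, hC, fun x z hz => ?_⟩
  rw [nonlin_eq hV, norm_mul, Complex.norm_real, norm_mul, Real.norm_of_nonneg (sq_nonneg _),
    mul_comm C]
  gcongr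
  exact h x z hz

lemma nonlin_zero (x : Plane) : nonlin V x 0 = 0 := mul_zero _

lemma aestronglyMeasurable_nonlin
    (hV : ContDiffOn ℝ ∞ (fun p : Plane × ℝ => V p.1 p.2) (univ ×ˢ Ici (0 : ℝ)))
    {φ : Plane → ℂ} (hφ : MemL2 φ) :
    AEStronglyMeasurable (fun x => nonlin V x (φ x)) (volume.restrict cell) := by
  have hc : Continuous fun p : Plane × ℂ => ((‖p.2‖ ^ 2 * potQuot V p : ℝ) : ℂ) * p.2 :=
    (Complex.continuous_ofReal.comp ((continuous_snd.norm.pow 2).mul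
      (contDiff_potQuot hV).continuous)).mul continuous_snd
  have := hc.comp_aestronglyMeasurable
    (continuous_id.aestronglyMeasurable.prodMk hφ.2.1 : AEStronglyMeasurable
      (fun x => (id x, φ x)) (volume.restrict cell))
  simp only [nonlin_eq hV]
  exact this

lemma latPeriodic_nonlin (hper : ∀ ρ : ℝ, 0 ≤ ρ → LatPeriodic (fun x => V x ρ))
    {φ : Plane → ℂ} (hφ : LatPeriodic φ) : LatPeriodic fun x => nonlin V x (φ x) := by
  have key : ∀ {x y}, φ y = φ x → V y (‖φ x‖ ^ 2) = V x (‖φ x‖ ^ 2) → V y 0 = V x 0 →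
      nonlin V y (φ y) = nonlin V x (φ x) := fun h1 h2 h3 => by rw [nonlin, h1, h2, h3, nonlin]
  exact ⟨fun x => key (hφ.1 x) ((hper _ (sq_nonneg _)).1 x) ((hper 0 le_rfl).1 x),
    fun x => key (hφ.2 x) ((hper _ (sq_nonneg _)).2 x) ((hper 0 le_rfl).2 x)⟩

/-- The nonlinear term of a small function is small in `L²`. -/
lemma memL2_nonlin
    (hV : ContDiffOn ℝ ∞ (fun p : Plane × ℝ => V p.1 p.2) (univ ×ˢ Ici (0 : ℝ)))
    (hper : ∀ ρ : ℝ, 0 ≤ ρ → LatPeriodic (fun x => V x ρ)) {C η : ℝ} (hC : 0 ≤ C)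
    (h : ∀ x z, ‖z‖ ≤ 1 → ‖nonlin V x z‖ ≤ C * ‖z‖ ^ 2 * ‖z‖) (hη1 : η ≤ 1)
    {φ : Plane → ℂ} (hφ : MemL2 φ) (hb : ∀ᵐ x, ‖φ x‖ ≤ η) :
    MemL2 (fun x => nonlin V x (φ x)) ∧
      l2Norm (fun x => nonlin V x (φ x)) ≤ C * η ^ 2 * l2Norm φ := by
  refine hφ.of_norm_le (latPeriodic_nonlin hper hφ.1) (aestronglyMeasurable_nonlin hV hφ)
    (by positivity) ?_
  filter_upwards [hb] with x hx
  refine (h x _ (hx.trans hη1)).trans ?_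
  gcongr

/-- The nonlinear eigenvalue problem as a perturbation of the linear one. -/
lemma SolvesBloch.blochEq
    (hV : ContDiffOn ℝ ∞ (fun p : Plane × ℝ => V p.1 p.2) (univ ×ˢ Ici (0 : ℝ)))
    (hper : ∀ ρ : ℝ, 0 ≤ ρ → LatPeriodic (fun x => V x ρ)) {E : ℂ} {φ : Plane → ℂ}
    (hs : SolvesBloch (fun x => V x (‖φ x‖ ^ 2)) E φ)
    (hN : MemL2 fun x => nonlin V x (φ x)) (E₀ : ℝ) :
    BlochEq (fun x => V x 0) E₀ φ (fun x => (E - E₀) * φ x - nonlin V x (φ x)) := by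
  have hW := (contDiff_pot_zero hV).continuous
  obtain ⟨w, hw⟩ := exists_abs_le_of_periodic hW (hper 0 le_rfl)
  have hg : MemL2 fun x => (E - E₀) * φ x - nonlin V x (φ x) := (hs.1.1.const_mul _).sub hN
  have m := (potential_mul (E₀ := E₀) hW (hper 0 le_rfl) hw hs.1.1).1.add hg
  refine ⟨hs.1.1, hg, (neg_blochLaplacian_ae_eq_iff hs.1 m).1 ?_⟩
  filter_upwards [hs.2] with x hx
  simp only [nonlin]
  push_cast
  linear_combination hx

/-- Tame Lipschitz estimate for the nonlinear term at amplitude `ε`. -/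
lemma exists_sobBound_nonlin_sub
    (hV : ContDiffOn ℝ ∞ (fun p : Plane × ℝ => V p.1 p.2) (univ ×ˢ Ici (0 : ℝ)))
    (hper : ∀ ρ : ℝ, 0 ≤ ρ → LatPeriodic (fun x => V x ρ)) (k : ℕ) (A : ℝ) :
    ∃ C, 0 ≤ C ∧ ∀ (φ₁ φ₂ : Plane → ℂ) (ε B : ℝ), 0 < ε → ε ≤ 1 →
      SobBound (k + 2) φ₁ (A * ε) → SobBound (k + 2) φ₂ (A * ε) →
      SobBound (k + 2) (fun x => φ₁ x - φ₂ x) B →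
      SobBound (k + 1) (fun x => nonlin V x (φ₁ x) - nonlin V x (φ₂ x)) (C * ε ^ 2 * B) := by
  -- The radius `max A 1` covers both the rescaled functions, bounded by `A`, and the parameter `ε ≤
  -- 1`.
  obtain ⟨C, hC, h⟩ := exists_sobBound_comp k (contDiff_nonlinSlope hV)
    (latPeriodic_nonlinSlope hV hper) (max A 1)
  refine ⟨C, hC, fun φ₁ φ₂ ε B hε hε1 h₁ h₂ hd => ?_⟩
  have scale : ∀ {φ : Plane → ℂ}, SobBound (k + 2) φ (A * ε) →
      SobBound (k + 2) (fun x => (ε : ℂ)⁻¹ * φ x) (max A 1) := by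
    intro φ hφ
    refine (hφ.const_mul _).mono ?_
    rw [norm_inv, Complex.norm_real, Real.norm_of_nonneg hε.le, mul_comm A, ← mul_assoc,
      inv_mul_cancel₀ hε.ne', one_mul]
    exact le_max_left _ _
  have h3 := (h _ _ _ ε B (scale h₁) (scale h₂)
    (by rw [abs_of_pos hε]; exact hε1.trans (le_max_right _ _)) hd).const_mul ((ε : ℂ) ^ 2)
  simp only [nonlin_sub hV _ _ _ hε.ne']
  refine h3.mono (le_of_eq ?_)
  rw [norm_pow, Complex.norm_real, Real.norm_of_nonneg hε.le]
  ring

lemma exists_sobBound_nonlin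
    (hV : ContDiffOn ℝ ∞ (fun p : Plane × ℝ => V p.1 p.2) (univ ×ˢ Ici (0 : ℝ)))
    (hper : ∀ ρ : ℝ, 0 ≤ ρ → LatPeriodic (fun x => V x ρ)) (k : ℕ) {A : ℝ} (hA : 0 ≤ A) :
    ∃ C, 0 ≤ C ∧ ∀ (φ : Plane → ℂ) (ε : ℝ), 0 < ε → ε ≤ 1 → SobBound (k + 2) φ (A * ε) →
      SobBound (k + 1) (fun x => nonlin V x (φ x)) (C * ε ^ 3) := by
  obtain ⟨C, hC, h⟩ := exists_sobBound_nonlin_sub hV hper k A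
  refine ⟨C * A, mul_nonneg hC hA, fun φ ε hε hε1 hφ => ?_⟩
  have := h φ (fun _ => 0) ε (A * ε) hε hε1 hφ
    ((SobBound.zero _).mono (mul_nonneg hA hε.le)) (by simpa using hφ)
  simp only [nonlin_zero, sub_zero] at this
  exact this.mono (le_of_eq (by ring))

/-- Bootstrap of the regularity of a small solution. -/
lemma exists_sobBound_bootstrap
    (hV : ContDiffOn ℝ ∞ (fun p : Plane × ℝ => V p.1 p.2) (univ ×ˢ Ici (0 : ℝ)))
    (hper : ∀ ρ : ℝ, 0 ≤ ρ → LatPeriodic (fun x => V x ρ)) (E₀ : ℝ) {A : ℝ} (hA : 0 ≤ A)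
    (k : ℕ) : ∃ A', 0 ≤ A' ∧ ∀ (φ : Plane → ℂ) (E : ℂ) (ε : ℝ), 0 < ε → ε ≤ 1 → ‖E - E₀‖ ≤ 1 →
      BlochEq (fun x => V x 0) E₀ φ (fun x => (E - E₀) * φ x - nonlin V x (φ x)) →
      SobBound 2 φ (A * ε) → SobBound (k + 2) φ (A' * ε) := by
  induction k with
  | zero => exact ⟨A, hA, fun φ E ε _ _ _ _ h => h⟩
  | succ k ih =>
    obtain ⟨A', hA', h⟩ := ih
    obtain ⟨C, hC, hN⟩ := exists_sobBound_nonlin hV hper k hA'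
    obtain ⟨C', hC', hR⟩ := exists_sobBound_regularity k (contDiff_pot_zero hV) (hper 0 le_rfl) E₀
    refine ⟨C' * (A' + (A' + C)), by positivity, fun φ E ε hε hε1 hE he h2 => ?_⟩
    have hk := h φ E ε hε hε1 hE he h2
    have h3 := hR _ _ _ _ he hk
      (((hk.mono_order (Nat.le_succ _)).const_mul (E - E₀)).sub (hN φ ε hε hε1 hk))
    refine h3.mono ?_
    rw [mul_assoc]
    refine mul_le_mul_of_nonneg_left ?_ hC'
    have e1 : ‖E - E₀‖ * (A' * ε) ≤ A' * ε := mul_le_of_le_one_left (by positivity) hE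
    have e2 : C * ε ^ 3 ≤ C * ε :=
      mul_le_mul_of_nonneg_left (pow_le_of_le_one hε.le hε1 (by norm_num)) hC
    linarith

end Nonlinear

/-- A solution of amplitude `ε`, of size `A k * ε` in every Sobolev space and with energy shift of
order `ε ^ 2`. -/
structure IsRegularSolution (V : Plane → ℝ → ℝ) (E₀ : ℝ) (φa φb : Plane → ℂ) (A : ℕ → ℝ)
    (ε : ℝ) (a b E : ℂ) (φ : Plane → ℂ) : Prop where
  one_le : 1 ≤ ‖a‖ + ‖b‖
  coeff_a : l2Inner φa φ = ε * a
  coeff_b : l2Inner φb φ = ε * b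
  eq : BlochEq (fun x => V x 0) E₀ φ (fun x => (E - E₀) * φ x - nonlin V x (φ x))
  bound : ∀ k, SobBound (k + 2) φ (A k * ε)
  memL2_nonlin : MemL2 fun x => nonlin V x (φ x)

/-! ### Size, energy and Lipschitz dependence of small solutions -/

section Solutions

variable {V : Plane → ℝ → ℝ} {E₀ : ℝ} {φa φb : Plane → ℂ}

lemma one_le_add_of_sq {s t : ℝ} (hs : 0 ≤ s) (ht : 0 ≤ t) (h : s ^ 2 + t ^ 2 = 1) :
    1 ≤ s + t := by nlinarith [mul_nonneg hs ht]

/-- Small solutions are of size comparable to their amplitude. -/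
lemma exists_sobBound_solution
    (hV : ContDiffOn ℝ ∞ (fun p : Plane × ℝ => V p.1 p.2) (univ ×ˢ Ici (0 : ℝ)))
    (hper : ∀ ρ : ℝ, 0 ≤ ρ → LatPeriodic (fun x => V x ρ)) (E₀ : ℝ) :
    ∃ A, 0 ≤ A ∧ ∀ M : ℝ, ∃ ε₀ : ℝ, 0 < ε₀ ∧ ε₀ ≤ 1 ∧
      ∀ φa φb, IsGroundPair (fun x => V x 0) E₀ φa φb → ∀ ε, 0 < ε → ε < ε₀ → ∀ a b E φ,
        IsSolutionTuple V E₀ φa φb M ε a b E φ →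
        BlochEq (fun x => V x 0) E₀ φ (fun x => (E - E₀) * φ x - nonlin V x (φ x)) ∧
        MemL2 (fun x => nonlin V x (φ x)) ∧ SobBound 2 φ (A * ε) := by
  have hW := contDiff_pot_zero hV
  have hWp := hper 0 le_rfl
  obtain ⟨w, hw⟩ := exists_abs_le_of_periodic hW.continuous hWp
  have hw0 : 0 ≤ w := (abs_nonneg _).trans (hw 0)
  obtain ⟨C₁, hC₁, hN⟩ := exists_norm_nonlin_le hV hper
  obtain ⟨Cg, hCg, hgap⟩ := exists_projPerp_le hW hWp E₀
  -- The target sup bound for `φ`, chosen so that the gap constant times the relative size `η + C₁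
  -- η²` of the right-hand side is at most `1/2`.
  set η : ℝ := (2 * (Cg * (1 + C₁)) + 1)⁻¹ with hη
  have hη0 : 0 < η := by positivity
  have hη1 : η ≤ 1 := inv_le_one_of_one_le₀ (by
    have : 0 ≤ Cg * (1 + C₁) := by positivity
    linarith)
  have hηg : Cg * (η + C₁ * η ^ 2) ≤ 1 / 2 := by
    have e1 : (2 * (Cg * (1 + C₁)) + 1) * η = 1 := mul_inv_cancel₀ (by positivity)
    have e2 : C₁ * η ^ 2 ≤ C₁ * η :=
      mul_le_mul_of_nonneg_left (pow_le_of_le_one hη0.le hη1 two_ne_zero) hC₁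
    have e3 : Cg * (η + C₁ * η ^ 2) ≤ Cg * (η + C₁ * η) :=
      mul_le_mul_of_nonneg_left (by linarith) hCg
    nlinarith
  -- This is the elliptic estimate evaluated with `‖φ‖ ≤ 4 ε`; it is fixed before `M`.
  refine ⟨ellConst * (4 + ((|E₀| + w) * 4 + (1 + C₁) * 4)), mul_nonneg ellConst_nonneg
    (by positivity), fun M => ?_⟩
  -- With this `τ` the `H²` bound `3 (|M| + 1)` contributes `η / 2`; the second condition on `ε`
  -- below leaves at most `η / 2` for the `L²` bound `|M| ε`.
  obtain ⟨Cτ, hCτ, hτ⟩ := exists_ae_norm_le (τ := η / (6 * (|M| + 1))) (by positivity)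
  refine ⟨min η (η / (2 * (Cτ * |M| + 1))), lt_min hη0 (by positivity),
    (min_le_left _ _).trans hη1, fun φa φb hg ε hε hε0 a b E φ hs => ?_⟩
  have hεη : ε ≤ η := (hε0.trans_le (min_le_left _ _)).le
  have hε2 : ε * (2 * (Cτ * |M| + 1)) ≤ η :=
    (le_div_iff₀ (by positivity)).1 (hε0.trans_le (min_le_right _ _)).le
  have hM : M ≤ |M| := le_abs_self M
  have hφ := hs.solves.1.1
  have hb : ∀ᵐ x, ‖φ x‖ ≤ η := by
    have h1 := hs.solves.1.sobBound.mono (B := 3 * (|M| + 1)) (by linarith [hs.h2_bound])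
    have h2 := hφ.sobBound.mono (hs.l2_small.trans (mul_le_mul_of_nonneg_right hM hε.le))
    filter_upwards [hτ φ _ _ h1 h2] with x hx
    refine hx.trans ?_
    have e1 : η / (6 * (|M| + 1)) * (3 * (|M| + 1)) = η / 2 := by
      field_simp
      norm_num
    rw [e1]
    nlinarith
  obtain ⟨mN, lN⟩ := memL2_nonlin hV hper hC₁ hN hη1 hφ hb
  have heq := hs.solves.blochEq hV hper mN E₀
  refine ⟨heq, mN, ?_⟩
  have hgle : l2Norm (fun x => (E - E₀) * φ x - nonlin V x (φ x))
      ≤ (η + C₁ * η ^ 2) * l2Norm φ := by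
    have h1 := l2Norm_sub_le (hφ.const_mul (E - E₀)) mN
    have h2 := l2Norm_const_mul_le hφ (E - E₀)
    have h3 := mul_le_mul_of_nonneg_right (hs.energy.trans hεη) (l2Norm_nonneg φ)
    linarith
  have hD := hgap φa φb φ _ hg heq
  have mD := MemL2.projPerp hg.solves_a.1.1 hg.solves_b.1.1 hφ
  -- The perpendicular part is at most half of `‖φ‖` and the ground components add at most `2 ε`.
  have h4 : l2Norm φ ≤ 4 * ε := by
    have h1 := (SobBound.of_projPerp (hg.norm_a ▸ hg.solves_a.1.1.sobBound)
      (hg.norm_b ▸ hg.solves_b.1.1.sobBound) mD.sobBound).l2Norm_le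
    rw [hs.coeff_a, hs.coeff_b, norm_mul, norm_mul, Complex.norm_real,
      Real.norm_of_nonneg hε.le, mul_one] at h1
    have ha : ‖a‖ ≤ 1 := by nlinarith [hs.normalised, norm_nonneg a, sq_nonneg ‖b‖]
    have hb' : ‖b‖ ≤ 1 := by nlinarith [hs.normalised, norm_nonneg b, sq_nonneg ‖a‖]
    have h2 : Cg * l2Norm (fun x => (E - E₀) * φ x - nonlin V x (φ x)) ≤ 1 / 2 * l2Norm φ :=
      (mul_le_mul_of_nonneg_left hgle hCg).trans (by
        rw [← mul_assoc]; exact mul_le_mul_of_nonneg_right hηg (l2Norm_nonneg φ))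
    nlinarith
  refine (heq.sobBound_two hW.continuous hWp hw).mono ?_
  rw [mul_assoc]
  refine mul_le_mul_of_nonneg_left ?_ ellConst_nonneg
  have h5 : η + C₁ * η ^ 2 ≤ 1 + C₁ :=
    add_le_add hη1 (mul_le_of_le_one_right hC₁ (pow_le_one₀ hη0.le hη1))
  have h6 : (η + C₁ * η ^ 2) * l2Norm φ ≤ (1 + C₁) * (4 * ε) :=
    mul_le_mul h5 h4 (l2Norm_nonneg φ) (by positivity)
  have h7 : (|E₀| + w) * l2Norm φ ≤ (|E₀| + w) * (4 * ε) :=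
    mul_le_mul_of_nonneg_left h4 (by positivity)
  linarith

lemma exists_regularSolution
    (hV : ContDiffOn ℝ ∞ (fun p : Plane × ℝ => V p.1 p.2) (univ ×ˢ Ici (0 : ℝ)))
    (hper : ∀ ρ : ℝ, 0 ≤ ρ → LatPeriodic (fun x => V x ρ)) (E₀ : ℝ) :
    ∃ A : ℕ → ℝ, (∀ k, 0 ≤ A k) ∧ ∀ M : ℝ, ∃ ε₀ : ℝ, 0 < ε₀ ∧ ε₀ ≤ 1 ∧
      ∀ φa φb, IsGroundPair (fun x => V x 0) E₀ φa φb → ∀ ε, 0 < ε → ε < ε₀ → ∀ a b E φ,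
        IsSolutionTuple V E₀ φa φb M ε a b E φ → IsRegularSolution V E₀ φa φb A ε a b E φ := by
  obtain ⟨A, hA, h⟩ := exists_sobBound_solution hV hper E₀
  choose A' hA' h' using exists_sobBound_bootstrap hV hper E₀ hA
  refine ⟨A', hA', fun M => ?_⟩
  obtain ⟨ε₀, h0, h1, hs⟩ := h M
  refine ⟨ε₀, h0, h1, fun φa φb hg ε hε hε0 a b E φ ht => ?_⟩
  obtain ⟨he, mN, h2⟩ := hs φa φb hg ε hε hε0 a b E φ ht
  have hε1 : ε ≤ 1 := hε0.le.trans h1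
  exact ⟨one_le_add_of_sq (norm_nonneg a) (norm_nonneg b) ht.normalised, ht.coeff_a, ht.coeff_b,
    he, fun k => h' k φ E ε hε hε1 (ht.energy.trans hε1) he h2, mN⟩

lemma norm_l2Inner_le_of_norm_one {f g : Plane → ℂ} (hf : MemL2 f) (hg : MemL2 g)
    (h : l2Norm f = 1) : ‖l2Inner f g‖ ≤ l2Norm g := by
  have := norm_l2Inner_le hf hg
  rwa [h, one_mul] at this

/-- Either amplitude may vanish, but not both; adding the two test equations avoids deciding which
one to divide by. -/
lemma le_two_mul_of_le_of_le {t s r a b : ℝ} (ht : 0 ≤ t) (hab : 1 ≤ a + b) (ha : t * a ≤ s)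
    (hb : t * b ≤ r) : t ≤ s + r := by nlinarith

/-- The energy shift is of second order. -/
lemma exists_energy_le
    (hV : ContDiffOn ℝ ∞ (fun p : Plane × ℝ => V p.1 p.2) (univ ×ˢ Ici (0 : ℝ)))
    (hper : ∀ ρ : ℝ, 0 ≤ ρ → LatPeriodic (fun x => V x ρ)) {E₀ : ℝ} {A : ℕ → ℝ}
    (hA : ∀ k, 0 ≤ A k) : ∃ C, 0 ≤ C ∧ ∀ φa φb, IsGroundPair (fun x => V x 0) E₀ φa φb →
      ∀ ε, 0 < ε → ε ≤ 1 → ∀ a b E φ, IsRegularSolution V E₀ φa φb A ε a b E φ →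
        ‖E - E₀‖ ≤ C * ε ^ 2 := by
  have hW := contDiff_pot_zero hV
  have hWp := hper 0 le_rfl
  obtain ⟨w, hw⟩ := exists_abs_le_of_periodic hW.continuous hWp
  obtain ⟨C, hC, h⟩ := exists_sobBound_nonlin hV hper 0 (hA 0)
  refine ⟨2 * C, by positivity, fun φa φb hg ε hε hε1 a b E φ hs => ?_⟩
  have hN := ((h φ ε hε hε1 (hs.bound 0)).mono_order (Nat.zero_le _)).l2Norm_le
  have key : ∀ φ' c, BlochEq (fun x => V x 0) E₀ φ' (fun _ => 0) → l2Norm φ' = 1 →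
      l2Inner φ' φ = ε * c → ‖E - E₀‖ * ε * ‖c‖ ≤ C * ε ^ 3 := by
    intro φ' c he h1 hc
    have h2 := hs.eq.l2Inner_rhs hW.continuous hWp hw he
    rw [l2Inner_sub_right he.memL2 (hs.eq.memL2.const_mul _) hs.memL2_nonlin,
      l2Inner_const_mul_right, hc, sub_eq_zero] at h2
    have h3 := norm_l2Inner_le_of_norm_one he.memL2 hs.memL2_nonlin h1
    rw [← h2, norm_mul, norm_mul, Complex.norm_real, Real.norm_of_nonneg hε.le, ← mul_assoc] at h3
    exact h3.trans hN
  obtain ⟨ea, eb⟩ := hg.blochEq hW hWp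
  have h4 := le_two_mul_of_le_of_le (mul_nonneg (norm_nonneg (E - E₀)) hε.le) hs.one_le
    (key φa a ea hg.norm_a hs.coeff_a) (key φb b eb hg.norm_b hs.coeff_b)
  refine le_of_mul_le_mul_right ?_ hε
  linarith [h4]

/-- The right-hand side of the equation for the difference of two solutions. -/
def diffRhs (V : Plane → ℝ → ℝ) (E₀ : ℝ) (E₁ E₂ : ℂ) (φ₁ φ₂ : Plane → ℂ) (x : Plane) : ℂ :=
  (E₁ - E₂) * φ₁ x + (E₂ - E₀) * (φ₁ x - φ₂ x) - (nonlin V x (φ₁ x) - nonlin V x (φ₂ x))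

lemma IsRegularSolution.blochEq_sub
    (hV : ContDiffOn ℝ ∞ (fun p : Plane × ℝ => V p.1 p.2) (univ ×ˢ Ici (0 : ℝ)))
    (hper : ∀ ρ : ℝ, 0 ≤ ρ → LatPeriodic (fun x => V x ρ)) {A : ℕ → ℝ} {ε : ℝ}
    {a₁ b₁ E₁ a₂ b₂ E₂ : ℂ} {φ₁ φ₂ : Plane → ℂ}
    (h₁ : IsRegularSolution V E₀ φa φb A ε a₁ b₁ E₁ φ₁)
    (h₂ : IsRegularSolution V E₀ φa φb A ε a₂ b₂ E₂ φ₂) :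
    BlochEq (fun x => V x 0) E₀ (fun x => φ₁ x - φ₂ x) (diffRhs V E₀ E₁ E₂ φ₁ φ₂) := by
  have hW := contDiff_pot_zero hV
  have hWp := hper 0 le_rfl
  obtain ⟨w, hw⟩ := exists_abs_le_of_periodic hW.continuous hWp
  have := h₁.eq.sub hW.continuous hWp hw h₂.eq
  have e : (fun x => (E₁ - E₀) * φ₁ x - nonlin V x (φ₁ x)
      - ((E₂ - E₀) * φ₂ x - nonlin V x (φ₂ x))) = diffRhs V E₀ E₁ E₂ φ₁ φ₂ := by
    ext x; simp only [diffRhs]; ring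
  rwa [e] at this

/-- The right-hand side of the difference equation gains a factor `ε ^ 2`. -/
lemma exists_sobBound_diffRhs
    (hV : ContDiffOn ℝ ∞ (fun p : Plane × ℝ => V p.1 p.2) (univ ×ˢ Ici (0 : ℝ)))
    (hper : ∀ ρ : ℝ, 0 ≤ ρ → LatPeriodic (fun x => V x ρ)) (E₀ : ℝ) {A : ℕ → ℝ}
    (hA : ∀ k, 0 ≤ A k) (k : ℕ) : ∃ C, 0 ≤ C ∧ ∀ φa φb,
      IsGroundPair (fun x => V x 0) E₀ φa φb → ∀ ε, 0 < ε → ε ≤ 1 →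
      ∀ a₁ b₁ E₁ φ₁ a₂ b₂ E₂ φ₂ B, IsRegularSolution V E₀ φa φb A ε a₁ b₁ E₁ φ₁ →
        IsRegularSolution V E₀ φa φb A ε a₂ b₂ E₂ φ₂ →
        SobBound (k + 2) (projPerp φa φb fun x => φ₁ x - φ₂ x) B →
        SobBound (k + 1) (diffRhs V E₀ E₁ E₂ φ₁ φ₂)
          (C * ε ^ 2 * (ε * (‖a₁ - a₂‖ + ‖b₁ - b₂‖) + B)) := by
  have hW := contDiff_pot_zero hV
  have hWp := hper 0 le_rfl
  obtain ⟨w, hw⟩ := exists_abs_le_of_periodic hW.continuous hWp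
  obtain ⟨Ce, hCe, hE⟩ := exists_energy_le hV hper (E₀ := E₀) hA
  obtain ⟨G, hG, hGs⟩ := exists_sobBound_eigenfunction k hW hWp E₀
  obtain ⟨Cn, hCn, hN⟩ := exists_sobBound_nonlin_sub hV hper k (A k)
  refine ⟨2 * (Ce + Cn * (G + 1)) * A k + (Ce + Cn) * (G + 1), by
    have := hA k; positivity, ?_⟩
  intro φa φb hg ε hε hε1 a₁ b₁ E₁ φ₁ a₂ b₂ E₂ φ₂ B h₁ h₂ hB
  obtain ⟨ea, eb⟩ := hg.blochEq hW hWp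
  set δ := ‖a₁ - a₂‖ + ‖b₁ - b₂‖ with hδ
  have hδ0 : 0 ≤ δ := by positivity
  have hB0 := hB.nonneg
  have md := h₁.eq.memL2.sub h₂.eq.memL2
  have mN := h₁.memL2_nonlin.sub h₂.memL2_nonlin
  have ca : l2Inner φa (fun x => φ₁ x - φ₂ x) = ε * (a₁ - a₂) := by
    rw [l2Inner_sub_right ea.memL2 h₁.eq.memL2 h₂.eq.memL2, h₁.coeff_a, h₂.coeff_a]; ring
  have cb : l2Inner φb (fun x => φ₁ x - φ₂ x) = ε * (b₁ - b₂) := by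
    rw [l2Inner_sub_right eb.memL2 h₁.eq.memL2 h₂.eq.memL2, h₁.coeff_b, h₂.coeff_b]; ring
  have hd : SobBound (k + 2) (fun x => φ₁ x - φ₂ x) ((G + 1) * (ε * δ + B)) := by
    refine (SobBound.of_projPerp (hGs _ ea hg.norm_a) (hGs _ eb hg.norm_b) hB).mono ?_
    rw [ca, cb, norm_mul, norm_mul, Complex.norm_real, Real.norm_of_nonneg hε.le]
    have : 0 ≤ G * B := by positivity
    have : 0 ≤ ε * δ := by positivity
    rw [← mul_add, ← hδ]
    nlinarith
  have hNd := hN φ₁ φ₂ ε _ hε hε1 (h₁.bound k) (h₂.bound k) hd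
  set Y := ε * δ + B with hY
  have hY0 : 0 ≤ Y := by positivity
  have hδY : ε * δ ≤ Y := by linarith
  have hNl := (hNd.mono_order (Nat.zero_le _)).l2Norm_le
  have hE₂ := hE φa φb hg ε hε hε1 a₂ b₂ E₂ φ₂ h₂
  have key : ∀ φ' c₁ c₂, BlochEq (fun x => V x 0) E₀ φ' (fun _ => 0) → l2Norm φ' = 1 →
      l2Inner φ' φ₁ = ε * c₁ → l2Inner φ' (fun x => φ₁ x - φ₂ x) = ε * (c₁ - c₂) →
      ‖c₁ - c₂‖ ≤ δ →
      ‖E₁ - E₂‖ * ε * ‖c₁‖ ≤ Ce * ε ^ 2 * Y + Cn * ε ^ 2 * ((G + 1) * Y) := by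
    intro φ' c₁ c₂ he h1 hc₁ hc hcδ
    have h2 : l2Inner φ' (fun x => (E₁ - E₂) * φ₁ x + (E₂ - E₀) * (φ₁ x - φ₂ x)
        - (nonlin V x (φ₁ x) - nonlin V x (φ₂ x))) = 0 :=
      (h₁.blochEq_sub hV hper h₂).l2Inner_rhs hW.continuous hWp hw he
    rw [l2Inner_sub_right he.memL2 ((h₁.eq.memL2.const_mul _).add (md.const_mul _)) mN,
      l2Inner_add_right he.memL2 (h₁.eq.memL2.const_mul _) (md.const_mul _),
      l2Inner_const_mul_right, l2Inner_const_mul_right, hc, hc₁] at h2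
    -- The solvability condition for the difference equation, solved for the difference of energies.
    have h3 : (E₁ - E₂) * ε * c₁ = l2Inner φ' (fun x => nonlin V x (φ₁ x) - nonlin V x (φ₂ x))
        - (E₂ - E₀) * (ε * (c₁ - c₂)) := by linear_combination h2
    have h4 := norm_l2Inner_le_of_norm_one he.memL2 mN h1
    have h5 := congrArg norm h3
    rw [norm_mul, norm_mul, Complex.norm_real, Real.norm_of_nonneg hε.le] at h5
    have h6 : ‖(E₂ - E₀) * (ε * (c₁ - c₂))‖ ≤ Ce * ε ^ 2 * Y := by
      rw [norm_mul, norm_mul, Complex.norm_real, Real.norm_of_nonneg hε.le]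
      exact mul_le_mul hE₂ ((mul_le_mul_of_nonneg_left hcδ hε.le).trans hδY) (by positivity)
        (by positivity)
    rw [h5]
    exact (norm_sub_le _ _).trans (by linarith)
  have hE₁₂ := le_two_mul_of_le_of_le (mul_nonneg (norm_nonneg (E₁ - E₂)) hε.le) h₁.one_le
    (key φa a₁ a₂ ea hg.norm_a h₁.coeff_a ca (le_add_of_nonneg_right (norm_nonneg _)))
    (key φb b₁ b₂ eb hg.norm_b h₁.coeff_b cb (le_add_of_nonneg_left (norm_nonneg _)))
  have hfin := ((((h₁.bound k).mono_order (Nat.le_succ _)).const_mul (E₁ - E₂)).add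
    ((hd.mono_order (Nat.le_succ _)).const_mul (E₂ - E₀))).sub hNd
  refine hfin.mono ?_
  -- Only `|E₁ - E₂| ε` has been bounded. This suffices, since `E₁ - E₂` multiplies `φ₁`, whose norm
  -- is at most `A k * ε`.
  have t1 := mul_le_mul_of_nonneg_right hE₁₂ (hA k)
  have t2 := mul_le_mul_of_nonneg_right hE₂ (show 0 ≤ (G + 1) * Y by positivity)
  calc _ ≤ (Ce * ε ^ 2 * Y + Cn * ε ^ 2 * ((G + 1) * Y)
        + (Ce * ε ^ 2 * Y + Cn * ε ^ 2 * ((G + 1) * Y))) * A k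
        + Ce * ε ^ 2 * ((G + 1) * Y) + Cn * ε ^ 2 * ((G + 1) * Y) := by linarith
    _ = _ := by ring

/-- Provides the least admissible bound. Absorption needs a single finite number that bounds the
function and is itself bounded by every other bound. -/
lemma SobBound.sqrt_tsum {s : ℕ} {f : Plane → ℂ} {B : ℝ} (h : SobBound s f B) :
    SobBound s f (Real.sqrt (∑' k, wt k ^ s * ‖fc f k‖ ^ 2)) ∧
      Real.sqrt (∑' k, wt k ^ s * ‖fc f k‖ ^ 2) ≤ B := by
  have hn : ∀ k, 0 ≤ wt k ^ s * ‖fc f k‖ ^ 2 := fun k => by have := wt_pos k; positivity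
  refine ⟨⟨h.memL2, Real.sqrt_nonneg _, fun S => ?_⟩,
    (Real.sqrt_le_left h.nonneg).2 h.tsum_le⟩
  rw [Real.sq_sqrt (tsum_nonneg hn)]
  exact h.summable.sum_le_tsum S fun k _ => hn k

/-- The Lipschitz estimate for the perpendicular part of the solutions, in `H²`. -/
lemma exists_sobBound_two_perp
    (hV : ContDiffOn ℝ ∞ (fun p : Plane × ℝ => V p.1 p.2) (univ ×ˢ Ici (0 : ℝ)))
    (hper : ∀ ρ : ℝ, 0 ≤ ρ → LatPeriodic (fun x => V x ρ)) (E₀ : ℝ) {A : ℕ → ℝ}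
    (hA : ∀ k, 0 ≤ A k) : ∃ C ε₁, 0 ≤ C ∧ 0 < ε₁ ∧ ∀ φa φb,
      IsGroundPair (fun x => V x 0) E₀ φa φb → ∀ ε, 0 < ε → ε ≤ 1 → ε ≤ ε₁ →
      ∀ a₁ b₁ E₁ φ₁ a₂ b₂ E₂ φ₂, IsRegularSolution V E₀ φa φb A ε a₁ b₁ E₁ φ₁ →
        IsRegularSolution V E₀ φa φb A ε a₂ b₂ E₂ φ₂ →
        SobBound 2 (projPerp φa φb fun x => φ₁ x - φ₂ x)
          (C * ε ^ 3 * (‖a₁ - a₂‖ + ‖b₁ - b₂‖)) := by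
  have hW := contDiff_pot_zero hV
  have hWp := hper 0 le_rfl
  obtain ⟨w, hw⟩ := exists_abs_le_of_periodic hW.continuous hWp
  have hw0 : 0 ≤ w := (abs_nonneg _).trans (hw 0)
  obtain ⟨Cr, hCr, hR⟩ := exists_sobBound_diffRhs hV hper E₀ hA 0
  obtain ⟨Cg, hCg, hgap⟩ := exists_projPerp_le hW hWp E₀
  set C := ellConst * (Cg + ((|E₀| + w) * Cg + 1)) * Cr with hC
  have hC0 : 0 ≤ C := mul_nonneg (mul_nonneg ellConst_nonneg (by positivity)) hCr
  refine ⟨2 * C, (2 * C + 1)⁻¹, by positivity, by positivity, ?_⟩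
  intro φa φb hg ε hε hε1 hε₁ a₁ b₁ E₁ φ₁ a₂ b₂ E₂ φ₂ h₁ h₂
  have he := h₁.blochEq_sub hV hper h₂
  have heD := he.projPerp hg hW hWp
  have hD := heD.sobBound_two hW.continuous hWp hw
  obtain ⟨hX, -⟩ := hD.sqrt_tsum
  set X := Real.sqrt (∑' k, wt k ^ 2 *
    ‖fc (projPerp φa φb fun x => φ₁ x - φ₂ x) k‖ ^ 2) with hXdef
  have hg1 := ((hR φa φb hg ε hε hε1 a₁ b₁ E₁ φ₁ a₂ b₂ E₂ φ₂ X h₁ h₂ hX).mono_order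
    (Nat.zero_le _)).l2Norm_le
  set δ := ‖a₁ - a₂‖ + ‖b₁ - b₂‖ with hδ
  have hg2 := hgap φa φb _ _ hg he
  -- Elliptic estimate for the projected difference, then the gap, then the bound on the right-hand
  -- side in terms of `X` itself.
  have hle : X ≤ C * ε ^ 2 * (ε * δ + X) := by
    refine hD.sqrt_tsum.2.trans ?_
    set n := l2Norm (diffRhs V E₀ E₁ E₂ φ₁ φ₂)
    have e1 : (|E₀| + w) * l2Norm (projPerp φa φb fun x => φ₁ x - φ₂ x)
        ≤ (|E₀| + w) * (Cg * n) := mul_le_mul_of_nonneg_left hg2 (by positivity)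
    calc _ ≤ ellConst * (Cg * n + ((|E₀| + w) * (Cg * n) + n)) :=
          mul_le_mul_of_nonneg_left (by linarith) ellConst_nonneg
      _ = ellConst * (Cg + ((|E₀| + w) * Cg + 1)) * n := by ring
      _ ≤ ellConst * (Cg + ((|E₀| + w) * Cg + 1)) * (Cr * ε ^ 2 * (ε * δ + X)) :=
          mul_le_mul_of_nonneg_left hg1 (mul_nonneg ellConst_nonneg (by positivity))
      _ = _ := by rw [hC]; ring
  -- The threshold `(2 C + 1)⁻¹` is what permits moving half of `X` to the left.
  have hsmall : C * ε ^ 2 ≤ 1 / 2 := by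
    have e1 : ε * (2 * C + 1) ≤ 1 := by
      have := mul_le_mul_of_nonneg_right hε₁ (show 0 ≤ 2 * C + 1 by positivity)
      rwa [inv_mul_cancel₀ (by positivity)] at this
    have e2 : C * ε ^ 2 ≤ C * ε :=
      mul_le_mul_of_nonneg_left (pow_le_of_le_one hε.le hε1 two_ne_zero) hC0
    linarith
  refine hX.mono ?_
  have := mul_le_mul_of_nonneg_right hsmall hX.nonneg
  linarith

/-- The Lipschitz estimate for the perpendicular part of the solutions, in all Sobolev spaces. -/
lemma exists_sobBound_perp
    (hV : ContDiffOn ℝ ∞ (fun p : Plane × ℝ => V p.1 p.2) (univ ×ˢ Ici (0 : ℝ)))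
    (hper : ∀ ρ : ℝ, 0 ≤ ρ → LatPeriodic (fun x => V x ρ)) (E₀ : ℝ) {A : ℕ → ℝ}
    (hA : ∀ k, 0 ≤ A k) : ∃ ε₁, 0 < ε₁ ∧ ∀ k, ∃ C, 0 ≤ C ∧ ∀ φa φb,
      IsGroundPair (fun x => V x 0) E₀ φa φb → ∀ ε, 0 < ε → ε ≤ 1 → ε ≤ ε₁ →
      ∀ a₁ b₁ E₁ φ₁ a₂ b₂ E₂ φ₂, IsRegularSolution V E₀ φa φb A ε a₁ b₁ E₁ φ₁ →
        IsRegularSolution V E₀ φa φb A ε a₂ b₂ E₂ φ₂ →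
        SobBound (k + 2) (projPerp φa φb fun x => φ₁ x - φ₂ x)
          (C * ε ^ 3 * (‖a₁ - a₂‖ + ‖b₁ - b₂‖)) := by
  have hW := contDiff_pot_zero hV
  have hWp := hper 0 le_rfl
  obtain ⟨C₀, ε₁, hC₀, hε₁, h₀⟩ := exists_sobBound_two_perp hV hper E₀ hA
  -- Smallness is spent once, on the absorption in `H²`. Higher orders only use regularity, so one
  -- threshold serves every `k`.
  refine ⟨ε₁, hε₁, fun k => ?_⟩
  induction k with
  | zero => exact ⟨C₀, hC₀, h₀⟩
  | succ k ih =>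
    obtain ⟨C, hC, h⟩ := ih
    obtain ⟨Cr, hCr, hR⟩ := exists_sobBound_diffRhs hV hper E₀ hA k
    obtain ⟨Ce, hCe, hel⟩ := exists_sobBound_regularity k hW hWp E₀
    refine ⟨Ce * (C + Cr * (1 + C)), by positivity, ?_⟩
    intro φa φb hg ε hε hε1 hεε a₁ b₁ E₁ φ₁ a₂ b₂ E₂ φ₂ h₁ h₂
    have hD := h φa φb hg ε hε hε1 hεε a₁ b₁ E₁ φ₁ a₂ b₂ E₂ φ₂ h₁ h₂
    have hg1 := hR φa φb hg ε hε hε1 a₁ b₁ E₁ φ₁ a₂ b₂ E₂ φ₂ _ h₁ h₂ hD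
    refine (hel _ _ _ _ ((h₁.blochEq_sub hV hper h₂).projPerp hg hW hWp) hD hg1).mono ?_
    set δ := ‖a₁ - a₂‖ + ‖b₁ - b₂‖ with hδ
    have hδ0 : 0 ≤ δ := by positivity
    have e1 : C * ε ^ 3 * δ ≤ C * ε * δ := by
      have := pow_le_of_le_one hε.le hε1 (show 3 ≠ 0 by norm_num)
      gcongr
    calc _ ≤ Ce * (C * ε ^ 3 * δ + Cr * ε ^ 2 * (ε * δ + C * ε * δ)) := by gcongr
      _ = _ := by ring

end Solutions

end HoneycombNLS

end

theorem mainTheorem5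
    (V : HoneycombNLS.Plane → ℝ → ℝ) (K : HoneycombNLS.Plane → ℝ)
    (hV : ContDiffOn ℝ ∞ (fun p : HoneycombNLS.Plane × ℝ => V p.1 p.2)
      (Set.univ ×ˢ Set.Ici (0 : ℝ)))
    (hper : ∀ ρ : ℝ, 0 ≤ ρ → HoneycombNLS.LatPeriodic (fun x => V x ρ))
    (hVL : HoneycombNLS.IsHoneycomb (fun x => V x 0))
    (hK : HoneycombNLS.IsHoneycomb K)
    (hexp : ∃ B r : ℝ, 0 < r ∧ ∀ (x : HoneycombNLS.Plane) (ρ : ℝ), 0 ≤ ρ → ρ ≤ r →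
      |V x ρ - V x 0 - K x * ρ| ≤ B * ρ ^ 2) :
    ∃ C : ℕ → ℝ, ∀ M : ℝ, ∃ ε₀ : ℝ, 0 < ε₀ ∧
      ∀ (E₀ : ℝ) (φa φb : HoneycombNLS.Plane → ℂ),
        HoneycombNLS.IsGroundPair (fun x => V x 0) E₀ φa φb →
        HoneycombNLS.Nonresonant K φa φb →
        ∀ ε : ℝ, 0 < ε → ε < ε₀ →
        ∀ (a₁ b₁ E₁ : ℂ) (φ₁ : HoneycombNLS.Plane → ℂ)
          (a₂ b₂ E₂ : ℂ) (φ₂ : HoneycombNLS.Plane → ℂ),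
          HoneycombNLS.IsSolutionTuple V E₀ φa φb M ε a₁ b₁ E₁ φ₁ →
          HoneycombNLS.IsSolutionTuple V E₀ φa φb M ε a₂ b₂ E₂ φ₂ →
          ∀ s : ℕ, 2 ≤ s →
            HoneycombNLS.MemSobolev s (HoneycombNLS.projPerp φa φb (φ₁ - φ₂)) ∧
            HoneycombNLS.sobolevNorm s (HoneycombNLS.projPerp φa φb (φ₁ - φ₂))
              ≤ C s * (‖a₁ - a₂‖ + ‖b₁ - b₂‖) * ε ^ 3 := by
  -- The constants must precede `E₀`. If the potential admits a ground pair, its energy is unique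
  -- and can be fixed in advance; otherwise the claim is vacuous.
  by_cases hne : ∃ (E₀ : ℝ) (φa φb : HoneycombNLS.Plane → ℂ),
      HoneycombNLS.IsGroundPair (fun x => V x 0) E₀ φa φb
  swap
  · exact ⟨0, fun M => ⟨1, one_pos, fun E₀ φa φb hg => (hne ⟨E₀, φa, φb, hg⟩).elim⟩⟩
  obtain ⟨E₀, ψa, ψb, hψ⟩ := hne
  obtain ⟨A, hA, hreg⟩ := HoneycombNLS.exists_regularSolution hV hper E₀
  obtain ⟨ε₁, hε₁, hperp⟩ := HoneycombNLS.exists_sobBound_perp hV hper E₀ hA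
  choose C hC hD using hperp
  -- The index `s - 2` undoes the shift `k + 2`, and the square root passes from the Fourier norm to
  -- the norm summed over weak derivatives.
  refine ⟨fun s => Real.sqrt (HoneycombNLS.sobCount s) * C (s - 2), fun M => ?_⟩
  obtain ⟨ε₀, hε₀, hε₀1, hsol⟩ := hreg M
  refine ⟨min ε₀ ε₁, lt_min hε₀ hε₁, ?_⟩
  intro E₀' φa φb hg _ ε hε hεlt a₁ b₁ E₁ φ₁ a₂ b₂ E₂ φ₂ h₁ h₂ s hs
  obtain rfl := hg.energy_unique hψ
  obtain ⟨k, rfl⟩ := Nat.exists_eq_add_of_le' hs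
  have hε0 : ε < ε₀ := hεlt.trans_le (min_le_left _ _)
  have key := hD k φa φb hg ε hε (hε0.le.trans hε₀1) (hεlt.le.trans (min_le_right _ _))
    a₁ b₁ E₁ φ₁ a₂ b₂ E₂ φ₂ (hsol φa φb hg ε hε hε0 a₁ b₁ E₁ φ₁ h₁)
    (hsol φa φb hg ε hε hε0 a₂ b₂ E₂ φ₂ h₂)
  refine ⟨key.memSobolev, key.sobolevNorm_le.trans (le_of_eq ?_)⟩
  simp only [Nat.add_sub_cancel]
  ring
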